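/- Theorem 4 (sample complexity under strict feasibility). Consider a finite discounted constrained MDP with non-empty finite state space $S$ and action space $A$, transition probabilities $P(\cdot\mid s,a)$, initial distribution $\rho$, discount factor $\gamma\in[0,1)$, reward $r:S\times A\to[0,1]$, constraint rewards $c_1,\dots,c_d:S\times A\to[0,1]$ ($d\ge 1$) and thresholds $b_1,\dots,b_d\in\mathbb R$. For a stationary policy $\pi:S\to\Delta_A$ and an objective $l$ let $V_l^\pi(\rho)=\mathbb E\big[\sum_{t\ge0}\gamma^t l(s_t,a_t)\big]$, where $s_0\sim\rho$, $a_t\sim\pi(\cdot\mid s_t)$, $s_{t+1}\sim P(\cdot\mid s_t,a_t)$. A policy is feasible if $V_{c_i}^\pi(\rho)\ge b_i$ for all $i$; $V_r^*(\rho)$ is the maximum of $V_r^\pi(\rho)$ over the feasible policies, and the Slater constant is $\zeta^*=\max\{\min_i (V_{c_i}^\pi(\rho)-b_i) : \pi \text{ feasible}\}$. Algorithm. Given $N,b',\omega,U,\varepsilon_1,T$: for each pair $(s,a)$ draw $N$ independent samples from $P(\cdot\mid s,a)$ and let $\hat P(\cdot\mid s,a)$ be their empirical distribution; set $r_p(s,a)=r(s,a)+\xi(s,a)$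 with $\xi(s,a)$ independent (of each other and of the samples) and uniform on $[0,\omega]$; write $\hat V$ for values with respect to $\hat P$. Put $\eta=U(1-\gamma)/\sqrt T$, $\Lambda=\{0,\varepsilon_1,2\varepsilon_1,\dots,U\}$ (the multiples of $\varepsilon_1$ in $[0,U]$, together with $U$) and $\lambda_0=0\in\mathbb R^d$. For $t=0,\dots,T-1$ let $\hat\pi_t$ be an optimal policy of the unconstrained MDP with transition probabilities $\hat P$ and reward $r_p+\sum_i\lambda_{t,i}c_i$ (optimal from every initial state), and let $\lambda_{t+1,i}$ be a point of $\Lambda$ closest to the projection of $\lambda_{t,i}-\eta\big(\hat V_{c_i}^{\hat\pi_t}(\rho)-b'_i\big)$ to $[0,U]$; ties are broken arbitrarily. The output is the mixture policy $\bar\pi_T$, which picks $t\in\{0,\dots,T-1\}$ uniformly and then follows $\hat\pi_t$, so that $V_l^{\bar\pi_T}(\rho)=\frac1T\sum_{t<T}V_l^{\hat\pi_t}(\rho)$. Theorem. There are universal constants $C>0$ and $k\in\mathbb N$ such that the following holds for all finite non-empty $S,A$, all $d\ge1$, $\gamma\in[0,1)$, $\varepsilon\in(0,\frac1{1-\gamma}]$,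 $\delta\in(0,1)$ and $\zeta^*>0$. Put $$\omega=\frac{\varepsilon(1-\gamma)}{10},\qquad U=\frac{4(1+\omega)}{\zeta^*(1-\gamma)},$$ $$N_0=\left\lceil C\,\frac{d^3\log(1/\delta)}{(1-\gamma)^5\varepsilon^2(\zeta^*)^2}\,\log^k\!\Big(3+|S|+|A|+d+\tfrac1{1-\gamma}+\tfrac1\varepsilon+\tfrac1{\zeta^*}\Big)\right\rceil .$$ There are $\varepsilon_1>0$ with $\varepsilon_1\le C\,\varepsilon^2(1-\gamma)^4(\zeta^*)^2$ and an integer $T\le C\,\frac{d^4}{(1-\gamma)^6\varepsilon^2(\zeta^*)^2}$ (chosen without knowledge of the CMDP beyond $S,A,d,\gamma,\varepsilon,\delta,\zeta^*$) such that for every CMDP as above with Slater constant $\zeta^*$ and $b'_i:=b_i+\frac{\varepsilon(1-\gamma)\zeta^*}{20}\ge0$ for all $i$, and for every $N\ge N_0$: $T\ge1$ and, with probability at least $1-4\delta$ over the samples and the perturbation, the algorithm can be run with the parameters $N,b',\omega,U,\varepsilon_1,T$ and every run of it (whatever the tie-breaking) outputs a mixture policy with $$V_r^{\bar\pi_T}(\rho)\ge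 V_r^*(\rho)-\varepsilon,\qquad V_{c_i}^{\bar\pi_T}(\rho)\ge b_i\quad(1\le i\le d).$$ With $N=N_0$ samples per state-action pair the total number of samples is $|S||A|N_0=\tilde O\!\Big(\frac{d^3|S||A|\log(1/\delta)}{(1-\gamma)^5\varepsilon^2(\zeta^*)^2}\Big)$. -/

import Mathlib

noncomputable section

namespace StrictCMDP

/-- Stationary randomized policies `π : S → Δ_A`. -/
abbrev Policy (S A : Type*) [Fintype A] := S → stdSimplex ℝ A

section Values

variable {S A : Type*} [Fintype S] [Fintype A]

/-- The law of the state `s_t` when `s_0 ∼ ρ`, `a_t ∼ π(· | s_t)`, `s_{t+1} ∼ P(· | s_t, a_t)`. -/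
def stateLaw (P : S → A → S → ℝ) (π : Policy S A) (ρ : S → ℝ) : ℕ → S → ℝ
  | 0 => ρ
  | t + 1 => fun s' => ∑ s, ∑ a, stateLaw P π ρ t s * (π s).1 a * P s a s'

/-- The value `V_l^π(ρ) = ∑_t γ^t 𝔼[l(s_t, a_t)]` of the objective `l` under the policy `π`, in the
model with transition probabilities `P`, from the initial distribution `ρ`. -/
def value (P : S → A → S → ℝ) (γ : ℝ) (l : S → A → ℝ) (π : Policy S A) (ρ : S → ℝ) : ℝ :=
  ∑' t : ℕ, γ ^ t * ∑ s, ∑ a, stateLaw P π ρ t s * (π s).1 a * l s a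

/-- `π` is an optimal policy of the unconstrained MDP `(S, A, P, γ, l)`: it maximizes the value
from every initial state. -/
def IsOptimalPolicy [DecidableEq S] (P : S → A → S → ℝ) (γ : ℝ) (l : S → A → ℝ)
    (π : Policy S A) : Prop :=
  ∀ (s : S) (π' : Policy S A),
    value P γ l π' (Pi.single s 1) ≤ value P γ l π (Pi.single s 1)

/-- The value of the mixture of the policies `π 0, …, π (T - 1)`, which draws an index `t < T`
uniformly at random and then follows `π t` forever. -/
def mixtureValue (P : S → A → S → ℝ) (γ : ℝ) (l : S → A → ℝ) (T : ℕ) (π : ℕ → Policy S A)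
    (ρ : S → ℝ) : ℝ :=
  (∑ t ∈ Finset.range T, value P γ l (π t) ρ) / T

end Values

/-- A finite constrained MDP with `d` constraints and discount factor `γ`. -/
structure CMDP (S A : Type*) [Fintype S] [Fintype A] (d : ℕ) (γ : ℝ) where
  /-- transition probabilities `P(s' | s, a)` -/
  P : S → A → S → ℝ
  /-- reward -/
  r : S → A → ℝ
  /-- constraint rewards -/
  c : Fin d → S → A → ℝ
  /-- constraint thresholds -/
  b : Fin d → ℝ
  /-- initial distribution -/
  ρ : S → ℝ
  P_mem : ∀ s a, P s a ∈ stdSimplex ℝ S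
  r_mem : ∀ s a, r s a ∈ Set.Icc (0 : ℝ) 1
  c_mem : ∀ i s a, c i s a ∈ Set.Icc (0 : ℝ) 1
  ρ_mem : ρ ∈ stdSimplex ℝ S

namespace CMDP

variable {S A : Type*} [Fintype S] [Fintype A] {d : ℕ} {γ : ℝ}

/-- `π` satisfies every constraint `V_{c_i}^π(ρ) ≥ b_i` in the true model. -/
def Feasible (M : CMDP S A d γ) (π : Policy S A) : Prop :=
  ∀ i, M.b i ≤ value M.P γ (M.c i) π M.ρ

/-- The margin `min_i (V_{c_i}^π(ρ) - b_i)` of a policy (for `d ≥ 1`). -/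
def margin (M : CMDP S A d γ) (π : Policy S A) : ℝ :=
  ⨅ i, (value M.P γ (M.c i) π M.ρ - M.b i)

/-- `ζ` is the Slater constant: the largest margin of a feasible policy. -/
def IsSlaterConstant (M : CMDP S A d γ) (ζ : ℝ) : Prop :=
  IsGreatest {m | ∃ π : Policy S A, M.Feasible π ∧ m = M.margin π} ζ

/-- The mixture of `π 0, …, π (T - 1)` satisfies every constraint exactly, and its reward value is
at least `V_r^*(ρ) - ε`, where `V_r^*(ρ)` is the maximum over the feasible policies. -/
def StrictlySolvedBy (M : CMDP S A d γ) (ε : ℝ) (T : ℕ) (π : ℕ → Policy S A) : Prop :=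
  (∀ i, M.b i ≤ mixtureValue M.P γ (M.c i) T π M.ρ) ∧
    ∀ π' : Policy S A, M.Feasible π' →
      value M.P γ M.r π' M.ρ - ε ≤ mixtureValue M.P γ M.r T π M.ρ

end CMDP

section Algorithm

variable {S A : Type*} [Fintype S] [Fintype A]

/-- The random input of the algorithm: for every pair `(s, a)`, `N` next states drawn from the
generative model, and a perturbation `ξ(s, a)` of the reward. -/
abbrev Data (S A : Type*) (N : ℕ) := (S × A × Fin N → S) × (S × A → ℝ)

/-- The law of one call of the generative model at `(s, a)`. -/
def nextStateLaw [MeasurableSpace S] (P : S → A → S → ℝ) (s : S) (a : A) :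
    MeasureTheory.Measure S :=
  ∑ s', ENNReal.ofReal (P s a s') • MeasureTheory.Measure.dirac s'

/-- The law of the data: all samples and perturbations are independent, the samples at `(s, a)`
have law `P(· | s, a)`, and the perturbations are uniform on `[0, ω]`. -/
def dataLaw [MeasurableSpace S] (P : S → A → S → ℝ) (N : ℕ) (ω : ℝ) :
    MeasureTheory.Measure (Data S A N) :=
  (MeasureTheory.Measure.pi fun x : S × A × Fin N => nextStateLaw P x.1 x.2.1).prod
    (MeasureTheory.Measure.pi fun _ : S × A =>
      ProbabilityTheory.cond MeasureTheory.volume (Set.Icc (0 : ℝ) ω))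

/-- The empirical transition probabilities `N(s' | s, a) / N`. -/
def empirical [DecidableEq S] {N : ℕ} (D : Data S A N) (s : S) (a : A) (s' : S) : ℝ :=
  ((Finset.univ.filter fun j : Fin N => D.1 (s, a, j) = s').card : ℝ) / N

/-- The net `{0, ε₁, 2ε₁, …, U}`. -/
def net (ε₁ U : ℝ) : Set ℝ := {x | (∃ j : ℕ, x = j * ε₁) ∧ x ≤ U} ∪ {U}

/-- `y` is a point of `Λ` closest to `x` (a result of rounding `x` to `Λ`). -/
def IsRounding (Λ : Set ℝ) (x y : ℝ) : Prop := y ∈ Λ ∧ ∀ z ∈ Λ, |x - y| ≤ |x - z|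

/-- Projection of a real number to `[0, U]`. -/
def proj (U x : ℝ) : ℝ := max 0 (min U x)

/-- `lam 0, …, lam T` and `pol 0, …, pol (T - 1)` are the dual and primal iterates of a run of the
algorithm on the data `D`, with constraint right-hand sides `b'`, projection bound `U`, step size
`η`, net resolution `ε₁` and `T` iterations. The true transition probabilities are not used.
Ties between optimal policies, and between closest points of the net, are broken arbitrarily. -/
structure IsRun [DecidableEq S] {d : ℕ} {γ : ℝ} (M : CMDP S A d γ) {N : ℕ} (D : Data S A N)
    (b' : Fin d → ℝ) (U η ε₁ : ℝ) (T : ℕ)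
    (lam : ℕ → Fin d → ℝ) (pol : ℕ → Policy S A) : Prop where
  init : lam 0 = 0
  primal : ∀ t < T, IsOptimalPolicy (empirical D) γ
    (fun s a => (M.r s a + D.2 (s, a)) + ∑ i, lam t i * M.c i s a) (pol t)
  dual : ∀ t < T, ∀ i, IsRounding (net ε₁ U)
    (proj U (lam t i - η * (value (empirical D) γ (M.c i) (pol t) M.ρ - b' i))) (lam (t + 1) i)

end Algorithm

/-- The rate `d³ log(1/δ) / ((1-γ)⁵ ε² ζ²)` times the `k`-th power of a logarithm of the problem
parameters (not of `δ`). -/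
def sampleRate (k nS nA d : ℕ) (γ ε δ ζ : ℝ) : ℝ :=
  (d : ℝ) ^ 3 * Real.log (1 / δ) / ((1 - γ) ^ 5 * ε ^ 2 * ζ ^ 2) *
    Real.log (3 + nS + nA + d + 1 / (1 - γ) + 1 / ε + 1 / ζ) ^ k

end StrictCMDP

end

/-!
Write `H = 1 / (1 - γ)`, and let `β` be a log-probability divided by the number of samples per pair.
The proof combines a deterministic analysis of the algorithm on an accurate empirical model with
the accuracy of the empirical model for the few policies that the analysis evaluates.

**Accuracy for one policy.** If the rows of the empirical model obey Bernstein's inequality at scale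
`β` on the value function `V` of a policy and on `V ^ 2`, then the values of the policy in the two
models differ by at most `12 H √(β H)` (`abs_stateValue_sub_le`), whenever `β H ≤ 1`. This is sharp
in `H`: the one-step variances of `V` along a trajectory sum to `O(H²)`, since `V ^ 2` is a potential
for them. Measuring the variances under the true model and the trajectory under the empirical one
costs the Bernstein error of `V ^ 2`, which is at most half of the variance plus `O(H)`. Hence no
lower bound on the number of samples is needed beyond `β H ≤ 1`.

**Data-dependent policies.** For policies fixed in advance, Bernstein's inequality holds with high
probability. A primal iterate depends on all samples, but it is optimal, in the empirical model, for
the reward given by a dual variable in a finite net. For a fixed dual variable and a fixed pair `i = (s, a)`, let the process be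
killed when `i` is played, and let the reward of `i` be increased by the discounted value lost. The
optimal policy stays the same (`isOptimalPolicy_killRow`), while the new model no longer involves the
samples of `i`, except through that one number. As the perturbation of the reward of `i` is uniform,
the law of this number has a bounded density whatever the samples of `i`: the original perturbation is
a Lipschitz function of it (`volume_optimal_le`). So replacing it by an independent uniform number
costs a factor polynomial in the parameters (`pi_uniform_optimal_le`). After this replacement the
optimal policy is independent of the samples of `i`, and almost surely unique, because two policies
have equal values only for perturbations in a hyperplane (`ae_unique_optimal`). Bernstein's inequality
then applies conditionally (`measure_optimal_bad_le`). Uniqueness also disposes of the ties between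
optimal policies in the algorithm.

**Runs on an accurate model.** Rounded projected gradient descent has small regret
(`dual_regret_le`), and each primal iterate maximizes a Lagrangian, so a saddle-point inequality holds
against every mixture of policies (`saddle_le`). Compared with a mixture of the output and a Slater
policy in which the worst constraint is tight, it bounds the violation of the shifted constraints,
without any reference to optimal dual variables (`neg_le_sum_slack`). Compared with a mixture of a
nearly optimal feasible policy and a Slater policy, it bounds the loss of reward (`IsRun.strict`). The
shift of the constraints pays for the remaining violation and for the error of evaluation.
-/

noncomputable section

namespace StrictCMDP

open MeasureTheory

/-! ### Values of stationary policies -/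

section Values

variable {S A : Type*} [Fintype S] [Fintype A] {P : S → A → S → ℝ} {γ : ℝ}

/-- Nonnegative transition weights whose rows sum to at most one. The missing mass is killed, which
allows a row to be replaced by zero. -/
structure IsSubstochastic (P : S → A → S → ℝ) : Prop where
  nonneg : ∀ s a s', 0 ≤ P s a s'
  sum_le : ∀ s a, ∑ s', P s a s' ≤ 1

omit [Fintype A] in
lemma IsSubstochastic.of_mem (h : ∀ s a, P s a ∈ stdSimplex ℝ S) : IsSubstochastic P :=
  ⟨fun s a s' => (h s a).1 s', fun s a => (h s a).2.le⟩

omit [Fintype S] in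
lemma policy_nonneg (π : Policy S A) (s : S) (a : A) : 0 ≤ (π s).1 a := (π s).2.1 a

omit [Fintype S] in
lemma policy_sum (π : Policy S A) (s : S) : ∑ a, (π s).1 a = 1 := (π s).2.2

omit [Fintype S] in
/-- An average over the actions of a policy is at most any bound of the averaged quantity. -/
lemma policy_avg_le (π : Policy S A) (s : S) {q : A → ℝ} {K : ℝ} (h : ∀ a, q a ≤ K) :
    ∑ a, (π s).1 a * q a ≤ K :=
  calc ∑ a, (π s).1 a * q a ≤ ∑ a, (π s).1 a * K :=
        Finset.sum_le_sum fun a _ => mul_le_mul_of_nonneg_left (h a) (policy_nonneg π s a)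
    _ = K := by rw [← Finset.sum_mul, policy_sum, one_mul]

/-- The one-step lookahead `s ↦ ∑ a, π(a | s) (l(s, a) + γ ∑ s', P(s' | s, a) W(s'))`. -/
def backup (P : S → A → S → ℝ) (γ : ℝ) (l : S → A → ℝ) (π : Policy S A) (W : S → ℝ) (s : S) : ℝ :=
  ∑ a, (π s).1 a * (l s a + γ * ∑ s', P s a s' * W s')

lemma backup_mono (hP : IsSubstochastic P) (hγ : 0 ≤ γ) (l : S → A → ℝ) (π : Policy S A)
    {V W : S → ℝ} (h : ∀ s, V s ≤ W s) (s : S) : backup P γ l π V s ≤ backup P γ l π W s :=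
  Finset.sum_le_sum fun a _ => mul_le_mul_of_nonneg_left (add_le_add_right
    (mul_le_mul_of_nonneg_left (Finset.sum_le_sum fun s' _ =>
      mul_le_mul_of_nonneg_left (h s') (hP.nonneg s a s')) hγ) _) (policy_nonneg π s a)

/-- The maximum principle for the Bellman equation of a policy: a supersolution dominates every
subsolution. All comparisons of values below reduce to it. -/
lemma le_of_backup (hP : IsSubstochastic P) (hγ : 0 ≤ γ) (hγ1 : γ < 1) {l : S → A → ℝ}
    {π : Policy S A} {V W : S → ℝ} (hV : ∀ s, V s ≤ backup P γ l π V s)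
    (hW : ∀ s, backup P γ l π W s ≤ W s) (s : S) : V s ≤ W s := by
  obtain ⟨m, -, hm⟩ := Finset.exists_max_image Finset.univ (fun s => V s - W s) ⟨s, Finset.mem_univ s⟩
  by_contra! hs
  have hpos : 0 < V m - W m := by have := hm s (Finset.mem_univ s); linarith
  have h1 : backup P γ l π V m - backup P γ l π W m ≤ γ * (V m - W m) := by
    unfold backup
    rw [← Finset.sum_sub_distrib]
    have : ∀ a, (π m).1 a * (l m a + γ * ∑ s', P m a s' * V s')
        - (π m).1 a * (l m a + γ * ∑ s', P m a s' * W s')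
        = (π m).1 a * (γ * ∑ s', P m a s' * (V s' - W s')) := fun a => by
      simp only [mul_sub, Finset.sum_sub_distrib]; ring
    simp only [this]
    refine policy_avg_le π m fun a => mul_le_mul_of_nonneg_left ?_ hγ
    calc ∑ s', P m a s' * (V s' - W s') ≤ ∑ s', P m a s' * (V m - W m) :=
          Finset.sum_le_sum fun s' _ =>
            mul_le_mul_of_nonneg_left (hm s' (Finset.mem_univ s')) (hP.nonneg m a s')
      _ ≤ V m - W m := by
          rw [← Finset.sum_mul]
          exact mul_le_of_le_one_left hpos.le (hP.sum_le m a)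
  have := hV m
  have := hW m
  nlinarith

lemma stateLaw_succ' (P : S → A → S → ℝ) (π : Policy S A) (ρ : S → ℝ) (t : ℕ) :
    stateLaw P π ρ (t + 1) = stateLaw P π (stateLaw P π ρ 1) t := by
  induction t with
  | zero => rfl
  | succ t ih =>
    funext s'
    rw [stateLaw, ih]
    rfl

lemma sum_abs_stateLaw_le (hP : IsSubstochastic P) (π : Policy S A) (ρ : S → ℝ) (t : ℕ) :
    ∑ s, |stateLaw P π ρ t s| ≤ ∑ s, |ρ s| := by
  induction t with
  | zero => rfl
  | succ t ih =>
    refine le_trans ?_ ih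
    calc ∑ s', |stateLaw P π ρ (t + 1) s'|
        ≤ ∑ s', ∑ s, ∑ a, |stateLaw P π ρ t s| * ((π s).1 a * P s a s') := by
          refine Finset.sum_le_sum fun s' _ => ?_
          rw [stateLaw]
          refine (Finset.abs_sum_le_sum_abs _ _).trans (Finset.sum_le_sum fun s _ => ?_)
          refine (Finset.abs_sum_le_sum_abs _ _).trans (Finset.sum_le_sum fun a _ => ?_)
          rw [abs_mul, abs_mul, abs_of_nonneg (policy_nonneg π s a),
            abs_of_nonneg (hP.nonneg s a s'), mul_assoc]
      _ = ∑ s, |stateLaw P π ρ t s| * ∑ a, (π s).1 a * ∑ s', P s a s' := by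
          rw [Finset.sum_comm]
          refine Finset.sum_congr rfl fun s _ => ?_
          rw [Finset.sum_comm, Finset.mul_sum]
          simp only [Finset.mul_sum]
      _ ≤ ∑ s, |stateLaw P π ρ t s| := Finset.sum_le_sum fun s _ =>
          mul_le_of_le_one_right (abs_nonneg _) (policy_avg_le π s (hP.sum_le s))

lemma summable_value (hP : IsSubstochastic P) (hγ : 0 ≤ γ) (hγ1 : γ < 1) (l : S → A → ℝ)
    (π : Policy S A) (ρ : S → ℝ) :
    Summable fun t : ℕ => γ ^ t * ∑ s, ∑ a, stateLaw P π ρ t s * (π s).1 a * l s a := by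
  refine Summable.of_norm_bounded
    (g := fun t => γ ^ t * ((∑ s, |ρ s|) * ∑ s, ∑ a, |l s a|))
    ((summable_geometric_of_lt_one hγ hγ1).mul_right _) fun t => ?_
  rw [Real.norm_eq_abs, abs_mul, abs_of_nonneg (pow_nonneg hγ t)]
  refine mul_le_mul_of_nonneg_left ?_ (pow_nonneg hγ t)
  have hl : ∀ s, ∑ a, |l s a| ≤ ∑ s, ∑ a, |l s a| := fun s =>
    Finset.single_le_sum (f := fun s => ∑ a, |l s a|)
      (fun s _ => Finset.sum_nonneg fun a _ => abs_nonneg _) (Finset.mem_univ s)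
  have hl' : ∀ s a, |l s a| ≤ ∑ s, ∑ a, |l s a| := fun s a =>
    (Finset.single_le_sum (f := fun a => |l s a|) (fun a _ => abs_nonneg _)
      (Finset.mem_univ a)).trans (hl s)
  calc |∑ s, ∑ a, stateLaw P π ρ t s * (π s).1 a * l s a|
      ≤ ∑ s, |stateLaw P π ρ t s| * ∑ a, (π s).1 a * |l s a| := by
        refine (Finset.abs_sum_le_sum_abs _ _).trans (Finset.sum_le_sum fun s _ => ?_)
        refine (Finset.abs_sum_le_sum_abs _ _).trans ?_
        rw [Finset.mul_sum]
        refine Finset.sum_le_sum fun a _ => ?_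
        rw [abs_mul, abs_mul, abs_of_nonneg (policy_nonneg π s a), mul_assoc]
    _ ≤ ∑ s, |stateLaw P π ρ t s| * ∑ s, ∑ a, |l s a| := Finset.sum_le_sum fun s _ =>
        mul_le_mul_of_nonneg_left (policy_avg_le π s (hl' s)) (abs_nonneg _)
    _ ≤ _ := by
        rw [← Finset.sum_mul]
        exact mul_le_mul_of_nonneg_right (sum_abs_stateLaw_le hP π ρ t)
          (Finset.sum_nonneg fun s _ => Finset.sum_nonneg fun a _ => abs_nonneg _)

variable [DecidableEq S]

lemma stateLaw_eq_sum (P : S → A → S → ℝ) (π : Policy S A) (ρ : S → ℝ) (t : ℕ) (s : S) :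
    stateLaw P π ρ t s = ∑ s₀, ρ s₀ * stateLaw P π (Pi.single s₀ 1) t s := by
  induction t generalizing s with
  | zero => simp [stateLaw, Pi.single_apply]
  | succ t ih =>
    simp only [stateLaw, Finset.mul_sum]
    conv_rhs => rw [Finset.sum_comm]
    refine Finset.sum_congr rfl fun s₁ _ => ?_
    conv_rhs => rw [Finset.sum_comm]
    refine Finset.sum_congr rfl fun a _ => ?_
    rw [ih s₁, Finset.sum_mul, Finset.sum_mul]
    exact Finset.sum_congr rfl fun s₀ _ => by ring

/-- The value function `s ↦ V_l^π(s)` of a policy. -/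
def stateValue (P : S → A → S → ℝ) (γ : ℝ) (l : S → A → ℝ) (π : Policy S A) (s : S) : ℝ :=
  value P γ l π (Pi.single s 1)

lemma value_eq_sum (hP : IsSubstochastic P) (hγ : 0 ≤ γ) (hγ1 : γ < 1) (l : S → A → ℝ)
    (π : Policy S A) (ρ : S → ℝ) : value P γ l π ρ = ∑ s, ρ s * stateValue P γ l π s := by
  unfold stateValue value
  simp only [← tsum_mul_left]
  rw [← Summable.tsum_finsetSum fun s _ => (summable_value hP hγ hγ1 l π _).mul_left _]
  refine tsum_congr fun t => ?_
  have : ∀ s₀, ρ s₀ * (γ ^ t * ∑ s, ∑ a, stateLaw P π (Pi.single s₀ 1) t s * (π s).1 a * l s a)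
      = γ ^ t * ∑ s, ∑ a, ρ s₀ * stateLaw P π (Pi.single s₀ 1) t s * (π s).1 a * l s a := by
    intro s₀
    rw [mul_left_comm]
    simp only [Finset.mul_sum]
    exact Finset.sum_congr rfl fun s _ => Finset.sum_congr rfl fun a _ => by ring
  simp only [this]
  rw [← Finset.mul_sum]
  conv_rhs => rw [Finset.sum_comm]
  congr 1
  refine Finset.sum_congr rfl fun s _ => ?_
  conv_rhs => rw [Finset.sum_comm]
  refine Finset.sum_congr rfl fun a _ => ?_
  rw [stateLaw_eq_sum P π ρ t s, Finset.sum_mul, Finset.sum_mul]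

/-- The Bellman equation of a policy. -/
lemma backup_stateValue (hP : IsSubstochastic P) (hγ : 0 ≤ γ) (hγ1 : γ < 1) (l : S → A → ℝ)
    (π : Policy S A) (s : S) : backup P γ l π (stateValue P γ l π) s = stateValue P γ l π s := by
  have hstep : ∀ s', stateLaw P π (Pi.single s 1) 1 s' = ∑ a, (π s).1 a * P s a s' := by
    intro s'
    simp [stateLaw, Pi.single_apply]
  have htail : ∑' t : ℕ, γ ^ (t + 1) * ∑ s₁, ∑ a,
      stateLaw P π (Pi.single s 1) (t + 1) s₁ * (π s₁).1 a * l s₁ a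
      = γ * value P γ l π (stateLaw P π (Pi.single s 1) 1) := by
    unfold value
    rw [← tsum_mul_left]
    refine tsum_congr fun t => ?_
    rw [stateLaw_succ', pow_succ]
    ring
  have h0 : stateValue P γ l π s = ∑ a, (π s).1 a * l s a
      + γ * value P γ l π (stateLaw P π (Pi.single s 1) 1) := by
    rw [← htail, stateValue, value, (summable_value hP hγ hγ1 l π _).tsum_eq_zero_add]
    congr 1
    simp [stateLaw, Pi.single_apply]
  rw [h0, value_eq_sum hP hγ hγ1]
  unfold backup
  simp only [mul_add, Finset.sum_add_distrib, hstep, Finset.sum_mul]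
  rw [Finset.sum_comm, Finset.mul_sum]
  congr 1
  refine Finset.sum_congr rfl fun a _ => ?_
  simp only [Finset.mul_sum]
  exact Finset.sum_congr rfl fun s' _ => by ring

variable (hP : IsSubstochastic P) (hγ : 0 ≤ γ) (hγ1 : γ < 1)

include hP hγ hγ1

lemma stateValue_le_of_backup_le {l : S → A → ℝ} {π : Policy S A} {W : S → ℝ}
    (h : ∀ s, backup P γ l π W s ≤ W s) (s : S) : stateValue P γ l π s ≤ W s :=
  le_of_backup hP hγ hγ1 (fun s => (backup_stateValue hP hγ hγ1 l π s).ge) h s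

lemma le_stateValue_of_le_backup {l : S → A → ℝ} {π : Policy S A} {W : S → ℝ}
    (h : ∀ s, W s ≤ backup P γ l π W s) (s : S) : W s ≤ stateValue P γ l π s :=
  le_of_backup hP hγ hγ1 h (fun s => (backup_stateValue hP hγ hγ1 l π s).le) s

lemma eq_stateValue_of_backup {l : S → A → ℝ} {π : Policy S A} {W : S → ℝ}
    (h : ∀ s, backup P γ l π W s = W s) : W = stateValue P γ l π :=
  funext fun s => le_antisymm (le_stateValue_of_le_backup hP hγ hγ1 (fun s => (h s).ge) s)
    (stateValue_le_of_backup_le hP hγ hγ1 (fun s => (h s).le) s)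

lemma stateValue_mono {l l' : S → A → ℝ} (π : Policy S A) (h : ∀ s a, l s a ≤ l' s a) (s : S) :
    stateValue P γ l π s ≤ stateValue P γ l' π s := by
  refine stateValue_le_of_backup_le hP hγ hγ1 (fun s => ?_) s
  refine le_trans ?_ (backup_stateValue hP hγ hγ1 l' π s).le
  exact Finset.sum_le_sum fun a _ => mul_le_mul_of_nonneg_left
    (add_le_add_left (h s a) _) (policy_nonneg π s a)

lemma stateValue_add (l l' : S → A → ℝ) (π : Policy S A) (s : S) :
    stateValue P γ (fun s a => l s a + l' s a) π s
      = stateValue P γ l π s + stateValue P γ l' π s := by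
  refine (congrFun (eq_stateValue_of_backup hP hγ hγ1
    (W := fun s => stateValue P γ l π s + stateValue P γ l' π s) fun s => ?_) s).symm
  rw [← backup_stateValue hP hγ hγ1 l π s, ← backup_stateValue hP hγ hγ1 l' π s]
  simp only [backup]
  rw [← Finset.sum_add_distrib]
  refine Finset.sum_congr rfl fun a _ => ?_
  simp only [mul_add, Finset.sum_add_distrib]
  ring

lemma stateValue_mul (k : ℝ) (l : S → A → ℝ) (π : Policy S A) (s : S) :
    stateValue P γ (fun s a => k * l s a) π s = k * stateValue P γ l π s := by
  refine (congrFun (eq_stateValue_of_backup hP hγ hγ1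
    (W := fun s => k * stateValue P γ l π s) fun s => ?_) s).symm
  conv_rhs => rw [← backup_stateValue hP hγ hγ1 l π s]
  simp only [backup, Finset.mul_sum, mul_add]
  refine Finset.sum_congr rfl fun a _ => ?_
  congr 1
  · ring
  · exact Finset.sum_congr rfl fun s' _ => by ring

lemma stateValue_le_const {l : S → A → ℝ} (π : Policy S A) {B : ℝ} (hB : 0 ≤ B)
    (h : ∀ s a, l s a ≤ B) (s : S) : stateValue P γ l π s ≤ B / (1 - γ) := by
  have h1 : 0 < 1 - γ := by linarith
  refine stateValue_le_of_backup_le hP hγ hγ1 (W := fun _ => B / (1 - γ)) (fun s => ?_) s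
  refine policy_avg_le π s fun a => ?_
  rw [← Finset.sum_mul]
  have h2 : (∑ s', P s a s') * (B / (1 - γ)) ≤ B / (1 - γ) :=
    mul_le_of_le_one_left (div_nonneg hB h1.le) (hP.sum_le s a)
  calc l s a + γ * ((∑ s', P s a s') * (B / (1 - γ))) ≤ B + γ * (B / (1 - γ)) :=
        add_le_add (h s a) (mul_le_mul_of_nonneg_left h2 hγ)
    _ = B / (1 - γ) := by field_simp; ring

lemma stateValue_nonneg {l : S → A → ℝ} (π : Policy S A) (h : ∀ s a, 0 ≤ l s a) (s : S) :
    0 ≤ stateValue P γ l π s := by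
  refine le_stateValue_of_le_backup hP hγ hγ1 (W := fun _ => 0) (fun s => ?_) s
  simpa [backup] using Finset.sum_nonneg fun a _ => mul_nonneg (policy_nonneg π s a) (h s a)

lemma stateValue_neg (l : S → A → ℝ) (π : Policy S A) (s : S) :
    stateValue P γ (fun s a => -l s a) π s = -stateValue P γ l π s := by
  simpa using stateValue_mul hP hγ hγ1 (-1) l π s

lemma abs_stateValue_le {l : S → A → ℝ} (π : Policy S A) {B : ℝ} (hB : 0 ≤ B)
    (h : ∀ s a, |l s a| ≤ B) (s : S) : |stateValue P γ l π s| ≤ B / (1 - γ) := by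
  rw [abs_le']
  refine ⟨stateValue_le_const hP hγ hγ1 π hB (fun s a => (abs_le'.1 (h s a)).1) s, ?_⟩
  rw [← stateValue_neg hP hγ hγ1]
  exact stateValue_le_const hP hγ hγ1 π hB (fun s a => (abs_le'.1 (h s a)).2) s

lemma stateValue_sub (l l' : S → A → ℝ) (π : Policy S A) (s : S) :
    stateValue P γ (fun s a => l s a - l' s a) π s
      = stateValue P γ l π s - stateValue P γ l' π s := by
  simp only [sub_eq_add_neg]
  rw [stateValue_add hP hγ hγ1 l (fun s a => -l' s a) π s, stateValue_neg hP hγ hγ1]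

end Values

/-! ### Optimal policies -/

section Optimal

variable {S A : Type*} [Fintype S] [Fintype A] [DecidableEq S] [DecidableEq A]
  {P : S → A → S → ℝ} {γ : ℝ}

/-- The deterministic policy that plays `p s` in the state `s`. -/
def detPolicy (p : S → A) : Policy S A := fun s => ⟨Pi.single (p s) 1, single_mem_stdSimplex ℝ (p s)⟩

omit [Fintype S] [DecidableEq S] in
lemma sum_detPolicy (p : S → A) (s : S) (q : A → ℝ) :
    ∑ a, (detPolicy p s).1 a * q a = q (p s) := by
  simp [detPolicy, Pi.single_apply]

omit [DecidableEq S] in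
lemma backup_detPolicy (p : S → A) (l : S → A → ℝ) (W : S → ℝ) (s : S) :
    backup P γ l (detPolicy p) W s = l s (p s) + γ * ∑ s', P s (p s) s' * W s' :=
  sum_detPolicy p s _

variable (hP : IsSubstochastic P) (hγ : 0 ≤ γ) (hγ1 : γ < 1)

include hP hγ hγ1

/-- Policy improvement: switching to an action whose lookahead is strictly better than the current
value yields a policy that is at least as good everywhere, and better in that state. -/
lemma exists_improvement {l : S → A → ℝ} {π : Policy S A} {s₁ : S} {a₁ : A}
    (h : stateValue P γ l π s₁ < l s₁ a₁ + γ * ∑ s', P s₁ a₁ s' * stateValue P γ l π s') :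
    let π' : Policy S A := Function.update π s₁ ⟨Pi.single a₁ 1, single_mem_stdSimplex ℝ a₁⟩
    (∀ s, stateValue P γ l π s ≤ stateValue P γ l π' s) ∧
      stateValue P γ l π s₁ < stateValue P γ l π' s₁ := by
  intro π'
  have hb : ∀ W, backup P γ l π' W s₁ = l s₁ a₁ + γ * ∑ s', P s₁ a₁ s' * W s' := by
    intro W
    simp [backup, π', Pi.single_apply]
  have hle : ∀ s, stateValue P γ l π s ≤ stateValue P γ l π' s := by
    refine le_stateValue_of_le_backup hP hγ hγ1 fun s => ?_
    by_cases hs : s = s₁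
    · subst hs
      rw [hb]
      exact h.le
    · have : backup P γ l π' (stateValue P γ l π) s = backup P γ l π (stateValue P γ l π) s := by
        simp [backup, π', hs]
      rw [this, backup_stateValue hP hγ hγ1]
  refine ⟨hle, ?_⟩
  rw [← backup_stateValue hP hγ hγ1 l π' s₁]
  exact lt_of_lt_of_le (h.trans_le (hb _).ge) (backup_mono hP hγ l π' hle s₁)

omit [DecidableEq A] in
lemma isOptimalPolicy_of_le {l : S → A → ℝ} {π : Policy S A}
    (h : ∀ s a, l s a + γ * ∑ s', P s a s' * stateValue P γ l π s' ≤ stateValue P γ l π s) :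
    IsOptimalPolicy P γ l π := fun s _ =>
  stateValue_le_of_backup_le hP hγ hγ1 (fun s => policy_avg_le _ s (h s)) s

/-- A policy is optimal exactly when no one-step deviation improves it. -/
lemma isOptimalPolicy_iff {l : S → A → ℝ} {π : Policy S A} :
    IsOptimalPolicy P γ l π ↔
      ∀ s a, l s a + γ * ∑ s', P s a s' * stateValue P γ l π s' ≤ stateValue P γ l π s := by
  refine ⟨fun h s a => ?_, isOptimalPolicy_of_le hP hγ hγ1⟩
  by_contra! hlt
  exact absurd (h s _) (not_le.2 (exists_improvement hP hγ hγ1 hlt).2)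

lemma exists_isOptimalPolicy [Nonempty A] (l : S → A → ℝ) :
    ∃ p : S → A, IsOptimalPolicy P γ l (detPolicy p) := by
  obtain ⟨p, -, hp⟩ := Finset.exists_max_image (Finset.univ : Finset (S → A))
    (fun p => ∑ s, stateValue P γ l (detPolicy p) s) Finset.univ_nonempty
  refine ⟨p, isOptimalPolicy_of_le hP hγ hγ1 fun s a => ?_⟩
  by_contra! hlt
  obtain ⟨h1, h2⟩ := exists_improvement hP hγ hγ1 hlt
  have he : (Function.update (detPolicy p) s ⟨Pi.single a 1, single_mem_stdSimplex ℝ a⟩ :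
      Policy S A) = detPolicy (Function.update p s a) := by
    funext s'
    by_cases hs : s' = s
    · subst hs; simp [detPolicy]
    · simp [detPolicy, hs]
  simp only [he] at h1 h2
  exact absurd (hp (Function.update p s a) (Finset.mem_univ _))
    (not_le.2 (Finset.sum_lt_sum (fun s _ => h1 s) ⟨s, Finset.mem_univ s, h2⟩))

/-- Any deterministic selection from the actions played by an optimal policy is optimal. -/
lemma isOptimalPolicy_of_support {l : S → A → ℝ} {π : Policy S A} (h : IsOptimalPolicy P γ l π)
    {p : S → A} (hp : ∀ s, 0 < (π s).1 (p s)) : IsOptimalPolicy P γ l (detPolicy p) := by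
  have hle := (isOptimalPolicy_iff hP hγ hγ1).1 h
  have heq : ∀ s, l s (p s) + γ * ∑ s', P s (p s) s' * stateValue P γ l π s'
      = stateValue P γ l π s := by
    intro s
    refine le_antisymm (hle s (p s)) (not_lt.1 fun hlt => ?_)
    have h1 := backup_stateValue hP hγ hγ1 l π s
    have h2 : backup P γ l π (stateValue P γ l π) s < ∑ a, (π s).1 a * stateValue P γ l π s :=
      Finset.sum_lt_sum (fun a _ => mul_le_mul_of_nonneg_left (hle s a) (policy_nonneg π s a))
        ⟨p s, Finset.mem_univ _, mul_lt_mul_of_pos_left hlt (hp s)⟩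
    rw [← Finset.sum_mul, policy_sum, one_mul] at h2
    exact absurd h1 h2.ne
  have hval : stateValue P γ l π = stateValue P γ l (detPolicy p) :=
    eq_stateValue_of_backup hP hγ hγ1 fun s => by rw [backup_detPolicy]; exact heq s
  refine isOptimalPolicy_of_le hP hγ hγ1 ?_
  rwa [← hval]

/-- If only one deterministic policy is optimal, then there is no other optimal policy, randomized
policies included. -/
lemma eq_detPolicy_of_unique {l : S → A → ℝ}
    (hu : ∀ p p' : S → A, IsOptimalPolicy P γ l (detPolicy p) →
      IsOptimalPolicy P γ l (detPolicy p') → p = p')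
    {π : Policy S A} (h : IsOptimalPolicy P γ l π) :
    ∃ p, π = detPolicy p ∧ IsOptimalPolicy P γ l (detPolicy p) := by
  have hex : ∀ s, ∃ a, 0 < (π s).1 a := by
    intro s
    by_contra! hs
    have := policy_sum π s
    rw [Finset.sum_eq_zero fun a _ => le_antisymm (hs a) (policy_nonneg π s a)] at this
    exact zero_ne_one this
  choose p hp using hex
  have hopt := isOptimalPolicy_of_support hP hγ hγ1 h hp
  refine ⟨p, ?_, hopt⟩
  have hz : ∀ s a, a ≠ p s → (π s).1 a = 0 := by
    intro s a ha
    by_contra hne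
    have hpos : 0 < (π s).1 a := lt_of_le_of_ne (policy_nonneg π s a) (Ne.symm hne)
    have h2 := isOptimalPolicy_of_support hP hγ hγ1 h (p := Function.update p s a) fun s' => by
      by_cases hs : s' = s
      · subst hs; simpa using hpos
      · simpa [hs] using hp s'
    have := congrFun (hu _ _ hopt h2) s
    simp only [Function.update_self] at this
    exact ha this.symm
  funext s
  refine Subtype.ext (funext fun a => ?_)
  by_cases ha : a = p s
  · subst ha
    have := policy_sum π s
    rw [Finset.sum_eq_single (p s) (fun a _ ha => hz s a ha) (by simp)] at this
    simp [detPolicy, this]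
  · simp [detPolicy, hz s a ha, ha]

end Optimal

/-! ### Evaluation of a policy in an estimated model -/

section Evaluation

variable {S A : Type*} [Fintype S] [Fintype A]

/-- The variance of `f` under the weights `p`. -/
def rowVar (p f : S → ℝ) : ℝ := ∑ s, p s * f s ^ 2 - (∑ s, p s * f s) ^ 2

lemma sum_sub_sq {p : S → ℝ} (hp : ∑ s, p s = 1) (f : S → ℝ) (c : ℝ) :
    ∑ s, p s * (f s - c) ^ 2 = rowVar p f + (∑ s, p s * f s - c) ^ 2 := by
  have : ∀ s, p s * (f s - c) ^ 2 = p s * f s ^ 2 - 2 * c * (p s * f s) + c ^ 2 * p s :=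
    fun s => by ring
  simp only [this, Finset.sum_add_distrib, Finset.sum_sub_distrib, ← Finset.mul_sum, hp, rowVar]
  ring

lemma rowVar_nonneg {p : S → ℝ} (hp : p ∈ stdSimplex ℝ S) (f : S → ℝ) : 0 ≤ rowVar p f := by
  have := sum_sub_sq hp.2 f (∑ s, p s * f s)
  rw [sub_self, zero_pow two_ne_zero, add_zero] at this
  rw [← this]
  exact Finset.sum_nonneg fun s _ => mul_nonneg (hp.1 s) (sq_nonneg _)

/-- Squaring a function with values in `[0, H]` increases the variance at most by `4 H²`. -/
lemma rowVar_sq_le {p : S → ℝ} (hp : p ∈ stdSimplex ℝ S) {f : S → ℝ} {H : ℝ}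
    (hf : ∀ s, f s ∈ Set.Icc 0 H) : rowVar p (fun s => f s ^ 2) ≤ 4 * H ^ 2 * rowVar p f := by
  set m := ∑ s, p s * f s with hm
  have hm0 : 0 ≤ m := Finset.sum_nonneg fun s _ => mul_nonneg (hp.1 s) (hf s).1
  have hmH : m ≤ H := by
    calc m ≤ ∑ s, p s * H :=
          Finset.sum_le_sum fun s _ => mul_le_mul_of_nonneg_left (hf s).2 (hp.1 s)
      _ = H := by rw [← Finset.sum_mul, hp.2, one_mul]
  have h1 : rowVar p (fun s => f s ^ 2) ≤ ∑ s, p s * (f s ^ 2 - m ^ 2) ^ 2 := by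
    rw [sum_sub_sq hp.2]
    exact le_add_of_nonneg_right (sq_nonneg _)
  have h2 : ∑ s, p s * (f s - m) ^ 2 = rowVar p f := by
    rw [sum_sub_sq hp.2, ← hm, sub_self]
    ring
  rw [← h2, Finset.mul_sum]
  refine h1.trans (Finset.sum_le_sum fun s _ => ?_)
  have h3 : (f s + m) ^ 2 ≤ (2 * H) ^ 2 :=
    pow_le_pow_left₀ (add_nonneg (hf s).1 hm0) (by linarith [(hf s).2]) 2
  calc p s * (f s ^ 2 - m ^ 2) ^ 2 = p s * (f s - m) ^ 2 * (f s + m) ^ 2 := by ring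
    _ ≤ p s * (f s - m) ^ 2 * (2 * H) ^ 2 :=
        mul_le_mul_of_nonneg_left h3 (mul_nonneg (hp.1 s) (sq_nonneg _))
    _ = _ := by ring

/-- The weights `q` average `f`, a function of size `b`, as the weights `p` do, up to the error
of Bernstein's inequality at the scale `β` (a log-probability divided by a sample size). -/
def BernsteinClose (p q f : S → ℝ) (b β : ℝ) : Prop :=
  |∑ s, (q s - p s) * f s| ≤ 2 * √(β * rowVar p f) + 2 * b * β

/-- `2 √(x y) ≤ x / κ + κ y`. -/
lemma two_mul_sqrt_le {x y κ : ℝ} (hx : 0 ≤ x) (hy : 0 ≤ y) (hκ : 0 < κ) :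
    2 * √(y * x) ≤ x / κ + κ * y := by
  have h : y * x = (κ * y) * (x / κ) := by field_simp
  rw [h, Real.sqrt_mul (by positivity)]
  nlinarith [Real.sq_sqrt (show 0 ≤ κ * y by positivity),
    Real.sq_sqrt (show 0 ≤ x / κ by positivity), sq_nonneg (√(κ * y) - √(x / κ))]

omit [Fintype S] in
/-- Jensen's inequality for the square of an average over actions. -/
lemma sq_policy_avg_le (π : Policy S A) (s : S) (q : A → ℝ) :
    (∑ a, (π s).1 a * q a) ^ 2 ≤ ∑ a, (π s).1 a * q a ^ 2 :=
  sub_nonneg.1 (rowVar_nonneg (p := (π s).1) (π s).2 q)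

variable [DecidableEq S] {P Q : S → A → S → ℝ} {γ : ℝ}

/-- The simulation identity: the value functions in two models differ by the value, in the second
model, of the one-step discrepancies. -/
lemma stateValue_sub_model (hP : IsSubstochastic P) (hQ : IsSubstochastic Q) (hγ : 0 ≤ γ)
    (hγ1 : γ < 1) (l : S → A → ℝ) (π : Policy S A) (s : S) :
    stateValue Q γ l π s - stateValue P γ l π s
      = stateValue Q γ (fun s a => γ * ∑ s', (Q s a s' - P s a s') * stateValue P γ l π s') π s := by
  have h : stateValue P γ l π = stateValue Q γ (fun s a => l s a -
      γ * ∑ s', (Q s a s' - P s a s') * stateValue P γ l π s') π := by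
    refine eq_stateValue_of_backup hQ hγ hγ1 fun s => ?_
    rw [← backup_stateValue hP hγ hγ1 l π s]
    refine Finset.sum_congr rfl fun a _ => ?_
    simp only [sub_mul, Finset.sum_sub_distrib]
    ring
  have h2 := congrFun h s
  rw [stateValue_sub hQ hγ hγ1] at h2
  linarith

/-- If the rows of an estimated model are Bernstein-close to the true ones on the value function
`V` of a policy and on `V²`, then the policy has nearly the same value in both models.

The variances `v = γ² Var_P(V)` along a trajectory of the estimated model add up to `O(H²)`,
for `H = 1 / (1 - γ)`, by a telescoping argument with the potential `V²`. The change of model that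
telescoping requires costs at most `v / 2`, which is absorbed. -/
lemma abs_stateValue_sub_le (hP : ∀ s a, P s a ∈ stdSimplex ℝ S) (hQ : IsSubstochastic Q)
    (hγ : 0 ≤ γ) (hγ1 : γ < 1) {l : S → A → ℝ} (hl : ∀ s a, l s a ∈ Set.Icc (0 : ℝ) 1)
    {π : Policy S A} {H β : ℝ} (hH : H * (1 - γ) = 1) (hβ : 0 < β) (hβH : β * H ≤ 1)
    (h1 : ∀ s a, BernsteinClose (P s a) (Q s a) (stateValue P γ l π) H β)
    (h2 : ∀ s a, BernsteinClose (P s a) (Q s a) (fun s => stateValue P γ l π s ^ 2) (H ^ 2) β)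
    (s : S) : |stateValue Q γ l π s - stateValue P γ l π s| ≤ 12 * H * √(β * H) := by
  have hPs := IsSubstochastic.of_mem hP
  have hHpos : 0 < H := by
    by_contra! h
    nlinarith
  have hHdiv : ∀ B : ℝ, B / (1 - γ) = B * H := fun B => by
    rw [div_eq_iff (by linarith), mul_assoc, hH, mul_one]
  set V := stateValue P γ l π with hV
  have hV0 : ∀ s, 0 ≤ V s := stateValue_nonneg hPs hγ hγ1 π fun s a => (hl s a).1
  have hVH : ∀ s, V s ≤ H := fun s => by
    have := stateValue_le_const hPs hγ hγ1 π zero_le_one (fun s a => (hl s a).2) s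
    rwa [hHdiv, one_mul] at this
  set v : S → A → ℝ := fun s a => γ ^ 2 * rowVar (P s a) V with hv
  have hv0 : ∀ s a, 0 ≤ v s a := fun s a => mul_nonneg (sq_nonneg _) (rowVar_nonneg (hP s a) V)
  have hβH2 : H ^ 2 * β ≤ H := by nlinarith
  -- the one-step discrepancies of `V` and of `V²`
  have e1 : ∀ s a {κ : ℝ}, 0 < κ → |γ * ∑ s', (Q s a s' - P s a s') * V s'|
      ≤ v s a / κ + κ * β + 2 * H * β := by
    intro s a κ hκ
    rw [abs_mul, abs_of_nonneg hγ]
    have h3 : γ * √(β * rowVar (P s a) V) = √(β * v s a) := by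
      rw [hv, show β * (γ ^ 2 * rowVar (P s a) V) = γ ^ 2 * (β * rowVar (P s a) V) by ring,
        Real.sqrt_mul (sq_nonneg _), Real.sqrt_sq hγ]
    have h4 := mul_le_mul_of_nonneg_left (h1 s a) hγ
    have h5 := two_mul_sqrt_le (hv0 s a) hβ.le hκ
    have h6 : γ * (2 * H * β) ≤ 2 * H * β := mul_le_of_le_one_left (by positivity) hγ1.le
    nlinarith
  have e2 : ∀ s a, γ * ∑ s', P s a s' * V s' ^ 2
      ≤ γ * ∑ s', Q s a s' * V s' ^ 2 + v s a / 2 + 10 * H := by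
    intro s a
    have h3 : γ * √(β * rowVar (P s a) (fun s => V s ^ 2)) ≤ √((4 * H ^ 2 * β) * v s a) := by
      have : (4 * H ^ 2 * β) * v s a = γ ^ 2 * (β * (4 * H ^ 2 * rowVar (P s a) V)) := by
        rw [hv]; ring
      rw [this, Real.sqrt_mul (sq_nonneg _), Real.sqrt_sq hγ]
      exact mul_le_mul_of_nonneg_left (Real.sqrt_le_sqrt (mul_le_mul_of_nonneg_left
        (rowVar_sq_le (hP s a) fun s => ⟨hV0 s, hVH s⟩) hβ.le)) hγ
    have h4 := mul_le_mul_of_nonneg_left ((abs_le.1 (h2 s a)).1) hγ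
    have h5 := two_mul_sqrt_le (hv0 s a) (show 0 ≤ 4 * H ^ 2 * β by positivity) two_pos
    have h6 : γ * (2 * H ^ 2 * β) ≤ 2 * H ^ 2 * β := mul_le_of_le_one_left (by positivity) hγ1.le
    simp only [sub_mul, Finset.sum_sub_distrib] at h4
    nlinarith
  -- total variance along a trajectory of the estimated model
  have hX : ∀ s, stateValue Q γ v π s ≤ 24 * H ^ 2 - 2 * V s ^ 2 := by
    refine stateValue_le_of_backup_le hQ hγ hγ1 fun s => ?_
    set q : A → ℝ := fun a => l s a + γ * ∑ s', P s a s' * V s' with hq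
    have hVq : V s = ∑ a, (π s).1 a * q a := (backup_stateValue hPs hγ hγ1 l π s).symm
    have key : ∀ a, v s a + γ * ∑ s', Q s a s' * (24 * H ^ 2 - 2 * V s' ^ 2)
        ≤ 24 * H ^ 2 - 2 * q a ^ 2 := by
      intro a
      have hPV0 : 0 ≤ ∑ s', P s a s' * V s' :=
        Finset.sum_nonneg fun s' _ => mul_nonneg ((hP s a).1 s') (hV0 s')
      have hPVH : ∑ s', P s a s' * V s' ≤ H :=
        calc ∑ s', P s a s' * V s' ≤ ∑ s', P s a s' * H :=
              Finset.sum_le_sum fun s' _ => mul_le_mul_of_nonneg_left (hVH s') ((hP s a).1 s')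
          _ = H := by rw [← Finset.sum_mul, (hP s a).2, one_mul]
      have hPV2 : 0 ≤ ∑ s', P s a s' * V s' ^ 2 :=
        Finset.sum_nonneg fun s' _ => mul_nonneg ((hP s a).1 s') (sq_nonneg _)
      have hl0 := (hl s a).1
      have hl1 := (hl s a).2
      have hq0 : 0 ≤ q a := add_nonneg hl0 (mul_nonneg hγ hPV0)
      have hqH : q a ≤ H := by
        have : γ * ∑ s', P s a s' * V s' ≤ γ * H := mul_le_mul_of_nonneg_left hPVH hγ
        simp only [hq]
        linarith
      have hve : v s a = γ ^ 2 * ∑ s', P s a s' * V s' ^ 2 - (q a - l s a) ^ 2 := by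
        simp only [hv, hq, rowVar]; ring
      have hγ2 : γ ^ 2 * ∑ s', P s a s' * V s' ^ 2 ≤ γ * ∑ s', P s a s' * V s' ^ 2 :=
        mul_le_mul_of_nonneg_right (by nlinarith) hPV2
      have hlq : l s a * q a ≤ H := (mul_le_of_le_one_left hq0 hl1).trans hqH
      have hsum : γ * ∑ s', Q s a s' * (24 * H ^ 2 - 2 * V s' ^ 2)
          ≤ γ * (24 * H ^ 2) - 2 * (γ * ∑ s', Q s a s' * V s' ^ 2) := by
        have h3 : ∑ s', Q s a s' * (24 * H ^ 2 - 2 * V s' ^ 2)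
            = (∑ s', Q s a s') * (24 * H ^ 2) - 2 * ∑ s', Q s a s' * V s' ^ 2 := by
          rw [Finset.sum_mul, Finset.mul_sum, ← Finset.sum_sub_distrib]
          exact Finset.sum_congr rfl fun s' _ => by ring
        have h4 : (∑ s', Q s a s') * (24 * H ^ 2) ≤ 24 * H ^ 2 :=
          mul_le_of_le_one_left (by positivity) (hQ.sum_le s a)
        rw [h3]
        nlinarith
      have hHH : γ * (24 * H ^ 2) + 24 * H = 24 * H ^ 2 := by
        have : H = H ^ 2 * (1 - γ) := by rw [sq, mul_assoc, hH, mul_one]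
        nlinarith
      nlinarith [e2 s a, sq_nonneg (l s a)]
    calc backup Q γ v π (fun s => 24 * H ^ 2 - 2 * V s ^ 2) s
        ≤ ∑ a, (π s).1 a * (24 * H ^ 2 - 2 * q a ^ 2) :=
          Finset.sum_le_sum fun a _ => mul_le_mul_of_nonneg_left (key a) (policy_nonneg π s a)
      _ = 24 * H ^ 2 - 2 * ∑ a, (π s).1 a * q a ^ 2 := by
          simp only [mul_sub, Finset.sum_sub_distrib]
          rw [← Finset.sum_mul, policy_sum, one_mul, Finset.mul_sum]
          congr 1
          exact Finset.sum_congr rfl fun a _ => by ring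
      _ ≤ 24 * H ^ 2 - 2 * V s ^ 2 := by
          rw [hVq]
          linarith [sq_policy_avg_le π s q]
  rw [stateValue_sub_model hPs hQ hγ hγ1]
  set t := √(β * H) with ht
  have htpos : 0 < t := Real.sqrt_pos.2 (by positivity)
  have ht2 : t ^ 2 = β * H := Real.sq_sqrt (by positivity)
  have ht1 : t ≤ 1 := Real.sqrt_le_one.2 hβH
  -- `κ = 5 H / t` balances the two terms of the arithmetic-geometric mean inequality
  have hκ : 0 < 5 * H / t := by positivity
  have hup : ∀ s, stateValue Q γ (fun s a => v s a / (5 * H / t) + 5 * H / t * β + 2 * H * β) π s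
      ≤ 12 * H * t := by
    intro s
    have h3 : stateValue Q γ (fun s a => (5 * H / t)⁻¹ * v s a + (5 * H / t * β + 2 * H * β)) π s
        ≤ 12 * H * t := by
      rw [stateValue_add hQ hγ hγ1 (fun s a => (5 * H / t)⁻¹ * v s a), stateValue_mul hQ hγ hγ1]
      have h4 := stateValue_le_const hQ hγ hγ1 (l := fun _ _ => 5 * H / t * β + 2 * H * β) π
        (by positivity) (fun _ _ => le_rfl) s
      rw [hHdiv] at h4
      have h5 : stateValue Q γ v π s ≤ 24 * H ^ 2 := by linarith [hX s, sq_nonneg (V s)]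
      have h6 := mul_le_mul_of_nonneg_left h5 (inv_nonneg.2 hκ.le)
      have h7 : (5 * H / t)⁻¹ * (24 * H ^ 2) = 24 / 5 * H * t := by field_simp
      have h8 : (5 * H / t * β + 2 * H * β) * H = 5 * H * t + 2 * H * t ^ 2 := by
        rw [show (5 * H / t * β + 2 * H * β) * H = 5 * H / t * (β * H) + 2 * H * (β * H) by ring,
          ← ht2]
        field_simp
      have h9 : H * t ^ 2 ≤ H * t := by nlinarith
      rw [h7] at h6
      rw [h8] at h4
      have : 0 < H * t := by positivity
      linarith
    convert h3 using 3
    ext a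
    ring
  rw [abs_le']
  constructor
  · exact (stateValue_mono hQ hγ hγ1 π (fun s a => (abs_le'.1 (e1 s a hκ)).1) s).trans (hup s)
  · rw [← stateValue_neg hQ hγ hγ1]
    exact (stateValue_mono hQ hγ hγ1 π (fun s a => (abs_le'.1 (e1 s a hκ)).2) s).trans (hup s)

end Evaluation

/-! ### Resampling coordinates of a product measure -/

section Resampling

variable {ι : Type*} [Fintype ι] [DecidableEq ι] {α : ι → Type*} [∀ i, MeasurableSpace (α i)]

omit [Fintype ι] in
lemma measurable_merge (J : Finset ι) :
    Measurable fun (z : (∀ i, α i) × ∀ i, α i) i => if i ∈ J then z.2 i else z.1 i := by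
  refine measurable_pi_lambda _ fun i => ?_
  by_cases hi : i ∈ J
  · simp only [hi, if_true]
    exact (measurable_pi_apply i).comp measurable_snd
  · simp only [hi, if_false]
    exact (measurable_pi_apply i).comp measurable_fst

/-- Replacing the coordinates in `J` of a sample from one product measure by those of an
independent sample from another one gives a sample from a product measure. -/
lemma map_merge_prod_pi (μ ν : ∀ i, Measure (α i)) [∀ i, IsProbabilityMeasure (μ i)]
    [∀ i, IsProbabilityMeasure (ν i)] (J : Finset ι) :
    ((Measure.pi μ).prod (Measure.pi ν)).map (fun z i => if i ∈ J then z.2 i else z.1 i)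
      = Measure.pi fun i => if i ∈ J then ν i else μ i := by
  have : ∀ i, IsProbabilityMeasure (if i ∈ J then ν i else μ i) := fun i => by
    split_ifs <;> infer_instance
  refine (Measure.pi_eq fun s hs => ?_).symm
  rw [Measure.map_apply (measurable_merge J) (MeasurableSet.univ_pi hs)]
  have hpre : (fun (z : (∀ i, α i) × ∀ i, α i) i => if i ∈ J then z.2 i else z.1 i) ⁻¹'
      Set.univ.pi s = (Set.univ.pi fun i => if i ∈ J then Set.univ else s i) ×ˢ
        (Set.univ.pi fun i => if i ∈ J then s i else Set.univ) := by
    ext z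
    simp only [Set.mem_preimage, Set.mem_prod, Set.mem_univ_pi, ← forall_and]
    refine forall_congr' fun i => ?_
    by_cases hi : i ∈ J <;> simp [hi]
  rw [hpre, Measure.prod_prod, Measure.pi_pi, Measure.pi_pi, ← Finset.prod_mul_distrib]
  refine Finset.prod_congr rfl fun i _ => ?_
  by_cases hi : i ∈ J <;> simp [hi]

lemma pi_merge_apply (μ ν : ∀ i, Measure (α i)) [∀ i, IsProbabilityMeasure (μ i)]
    [∀ i, IsProbabilityMeasure (ν i)] (J : Finset ι) {E : Set (∀ i, α i)} (hE : MeasurableSet E) :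
    Measure.pi (fun i => if i ∈ J then ν i else μ i) E
      = ∫⁻ x, Measure.pi ν {y | (fun i => if i ∈ J then y i else x i) ∈ E} ∂Measure.pi μ := by
  rw [← map_merge_prod_pi μ ν J, Measure.map_apply (measurable_merge J) hE, Measure.prod_apply (measurable_merge J hE)]
  rfl

/-- Fubini's theorem for a single coordinate of a product measure. -/
lemma pi_update_apply (μ : ∀ i, Measure (α i)) [∀ i, IsProbabilityMeasure (μ i)]
    (i : ι) (κ : Measure (α i)) [IsProbabilityMeasure κ] {E : Set (∀ i, α i)}
    (hE : MeasurableSet E) :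
    Measure.pi (Function.update μ i κ) E
      = ∫⁻ x, κ {τ | Function.update x i τ ∈ E} ∂Measure.pi μ := by
  have hprob : ∀ j, IsProbabilityMeasure (Function.update μ i κ j) := fun j => by
    by_cases hj : j = i
    · subst hj; simpa using ‹IsProbabilityMeasure κ›
    · simpa [hj] using inferInstanceAs (IsProbabilityMeasure (μ j))
  have h := pi_merge_apply μ (Function.update μ i κ) {i} hE
  have he : (fun j => if j ∈ ({i} : Finset ι) then Function.update μ i κ j else μ j)
      = Function.update μ i κ := by
    funext j
    by_cases hj : j = i
    · subst hj; simp
    · simp [hj]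
  rw [he] at h
  rw [h]
  refine lintegral_congr fun x => ?_
  have hset : {y : ∀ i, α i | (fun j => if j ∈ ({i} : Finset ι) then y j else x j) ∈ E}
      = Function.eval i ⁻¹' {τ | Function.update x i τ ∈ E} := by
    ext y
    have : (fun j => if j ∈ ({i} : Finset ι) then y j else x j) = Function.update x i (y i) := by
      funext j
      by_cases hj : j = i
      · subst hj; simp
      · simp [hj]
    simp only [Set.mem_ofPred_eq, this, Set.mem_preimage, Function.eval]
  have hm : MeasurableSet {τ | Function.update x i τ ∈ E} := measurable_update x hE
  rw [hset, (measurePreserving_eval (Function.update μ i κ) i).measure_preimage hm.nullMeasurableSet]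
  simp

end Resampling

/-! ### Bernstein's inequality for empirical averages -/

section Bernstein

variable {S : Type*} [Fintype S] [MeasurableSpace S] [MeasurableSingletonClass S]

lemma integral_exp_le {μ : Measure S} [IsProbabilityMeasure μ] {g : S → ℝ} {b v θ : ℝ}
    (hg : ∀ s, |g s| ≤ b) (hmean : ∫ s, g s ∂μ = 0) (hvar : ∫ s, g s ^ 2 ∂μ ≤ v)
    (hθ : 0 ≤ θ) (hθb : θ * b ≤ 1) : ∫ s, Real.exp (θ * g s) ∂μ ≤ Real.exp (θ ^ 2 * v) := by
  have hint : ∀ f : S → ℝ, Integrable f μ := fun f => Integrable.of_finite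
  have hpt : ∀ s, Real.exp (θ * g s) ≤ 1 + θ * g s + θ ^ 2 * g s ^ 2 := by
    intro s
    have h1 : |θ * g s| ≤ 1 := by
      rw [abs_mul, abs_of_nonneg hθ]
      exact (mul_le_mul_of_nonneg_left (hg s) hθ).trans hθb
    have := (abs_le.1 (Real.abs_exp_sub_one_sub_id_le h1)).2
    nlinarith
  calc ∫ s, Real.exp (θ * g s) ∂μ ≤ ∫ s, (1 + θ * g s + θ ^ 2 * g s ^ 2) ∂μ :=
        integral_mono (hint _) (hint _) hpt
    _ = 1 + θ ^ 2 * ∫ s, g s ^ 2 ∂μ := by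
        rw [integral_add (hint _) (hint _), integral_add (hint _) (hint _), integral_const_mul,
          integral_const_mul, hmean]
        simp
    _ ≤ θ ^ 2 * v + 1 := by nlinarith [mul_le_mul_of_nonneg_left hvar (sq_nonneg θ)]
    _ ≤ Real.exp (θ ^ 2 * v) := Real.add_one_le_exp _

/-- One-sided Bernstein inequality for independent, centered variables of size at most `b` and
variance at most `v`. -/
lemma bernstein_upper {ι : Type*} [Fintype ι] (μ : ι → Measure S)
    [∀ i, IsProbabilityMeasure (μ i)] (J : Finset ι) {g : S → ℝ} {b v L : ℝ} (hb : 0 < b)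
    (hL : 0 < L) (hg : ∀ s, |g s| ≤ b) (hmean : ∀ i ∈ J, ∫ s, g s ∂μ i = 0)
    (hvar : ∀ i ∈ J, ∫ s, g s ^ 2 ∂μ i ≤ v) :
    (Measure.pi μ).real {x | 2 * √((J.card : ℝ) * L * v) + 2 * b * L ≤ ∑ i ∈ J, g (x i)}
      ≤ Real.exp (-L) := by
  classical
  have hmgf : ∀ θ, 0 ≤ θ → θ * b ≤ 1 →
      ProbabilityTheory.mgf (fun x : ι → S => ∑ i ∈ J, g (x i)) (Measure.pi μ) θ
        ≤ Real.exp (J.card * (θ ^ 2 * v)) := by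
    intro θ hθ hθb
    have h1 : ∀ x : ι → S, Real.exp (θ * ∑ i ∈ J, g (x i))
        = ∏ i, (if i ∈ J then Real.exp (θ * g (x i)) else 1) := by
      intro x
      rw [Finset.mul_sum, Real.exp_sum, Finset.prod_ite_mem, Finset.univ_inter]
    rw [ProbabilityTheory.mgf]
    simp only [h1]
    rw [integral_fintype_prod_eq_prod (fun i s => if i ∈ J then Real.exp (θ * g s) else 1)]
    calc ∏ i, ∫ s, (if i ∈ J then Real.exp (θ * g s) else 1) ∂μ i
        ≤ ∏ i, if i ∈ J then Real.exp (θ ^ 2 * v) else 1 := by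
          refine Finset.prod_le_prod (fun i _ => ?_) fun i _ => ?_
          · refine integral_nonneg fun s => ?_
            by_cases hi : i ∈ J <;> simp [hi, Real.exp_nonneg]
          · by_cases hi : i ∈ J
            · simpa [hi] using integral_exp_le hg (hmean i hi) (hvar i hi) hθ hθb
            · simp [hi]
      _ = Real.exp (J.card * (θ ^ 2 * v)) := by
          rw [Finset.prod_ite_mem, Finset.univ_inter, Finset.prod_const, ← Real.exp_nat_mul]
  set n : ℝ := (J.card : ℝ) with hn
  have hn0 : 0 ≤ n := Nat.cast_nonneg _
  set ε := 2 * √(n * L * v) + 2 * b * L with hε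
  -- the exponent `-θ ε + n θ² v` is at most `-L` for `θ = min (1 / b) √(L / (n v))`
  obtain ⟨θ, hθ, hθb, hexp⟩ : ∃ θ, 0 ≤ θ ∧ θ * b ≤ 1 ∧ -θ * ε + n * (θ ^ 2 * v) ≤ -L := by
    by_cases hcase : n * v ≤ b ^ 2 * L
    · refine ⟨1 / b, by positivity, by field_simp; rfl, ?_⟩
      have h1 : 1 / b * ε = 2 / b * √(n * L * v) + 2 * L := by rw [hε]; field_simp
      have h2 : n * ((1 / b) ^ 2 * v) ≤ L := by
        rw [show n * ((1 / b) ^ 2 * v) = n * v / b ^ 2 by field_simp, div_le_iff₀ (by positivity)]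
        linarith
      have h3 : 0 ≤ 2 / b * √(n * L * v) := by positivity
      nlinarith
    · push Not at hcase
      have hnv : 0 < n * v := lt_of_le_of_lt (by positivity) hcase
      set θ := √(L / (n * v)) with hθ
      have hθ2 : θ ^ 2 = L / (n * v) := Real.sq_sqrt (by positivity)
      have hθ0 : 0 ≤ θ := Real.sqrt_nonneg _
      refine ⟨θ, hθ0, ?_, ?_⟩
      · rw [← abs_of_nonneg (show 0 ≤ θ * b by positivity), ← sq_le_one_iff_abs_le_one, mul_pow,
          hθ2, div_mul_eq_mul_div, div_le_one hnv]
        linarith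
      · have h1 : θ * √(n * L * v) = L := by
          rw [hθ, ← Real.sqrt_mul (by positivity),
            show L / (n * v) * (n * L * v) = L ^ 2 * ((n * v) / (n * v)) by ring,
            div_self hnv.ne', mul_one, Real.sqrt_sq hL.le]
        have h2 : n * (θ ^ 2 * v) = L := by
          rw [hθ2, show n * (L / (n * v) * v) = L * ((n * v) / (n * v)) by ring,
            div_self hnv.ne', mul_one]
        have h3 : 0 ≤ θ * (2 * b * L) := by positivity
        rw [h2, hε]
        nlinarith
  calc (Measure.pi μ).real {x | ε ≤ ∑ i ∈ J, g (x i)}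
      ≤ Real.exp (-θ * ε) * ProbabilityTheory.mgf (fun x : ι → S => ∑ i ∈ J, g (x i))
          (Measure.pi μ) θ :=
        ProbabilityTheory.measure_ge_le_exp_mul_mgf ε hθ Integrable.of_finite
    _ ≤ Real.exp (-θ * ε) * Real.exp (n * (θ ^ 2 * v)) :=
        mul_le_mul_of_nonneg_left (hmgf θ hθ hθb) (Real.exp_nonneg _)
    _ ≤ Real.exp (-L) := by
        rw [← Real.exp_add]
        exact Real.exp_le_exp.2 hexp

variable {A : Type*}

omit [MeasurableSingletonClass S] in
lemma isProbabilityMeasure_nextStateLaw {P : S → A → S → ℝ} {s : S} {a : A}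
    (hP : P s a ∈ stdSimplex ℝ S) : IsProbabilityMeasure (nextStateLaw P s a) := by
  refine ⟨?_⟩
  rw [nextStateLaw, Measure.finsetSum_apply]
  simp only [Measure.smul_apply, measure_univ, smul_eq_mul, mul_one]
  rw [← ENNReal.ofReal_sum_of_nonneg fun s' _ => hP.1 s', hP.2, ENNReal.ofReal_one]

lemma integral_nextStateLaw {P : S → A → S → ℝ} {s : S} {a : A} (hP : P s a ∈ stdSimplex ℝ S)
    (f : S → ℝ) : ∫ s', f s' ∂nextStateLaw P s a = ∑ s', P s a s' * f s' := by
  rw [nextStateLaw, integral_finsetSum_measure]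
  · refine Finset.sum_congr rfl fun s' _ => ?_
    rw [integral_smul_measure, integral_dirac, ENNReal.toReal_ofReal (hP.1 s'), smul_eq_mul]
  · exact fun s' _ => (integrable_dirac (by simp)).smul_measure ENNReal.ofReal_ne_top

variable [Fintype A] [DecidableEq S] {N : ℕ}

/-- The law of all the samples of the generative model. -/
def sampleLaw (P : S → A → S → ℝ) (N : ℕ) : Measure (S × A × Fin N → S) :=
  Measure.pi fun x => nextStateLaw P x.1 x.2.1

/-- The empirical model, as a function of the samples alone. -/
def sampleModel (x : S × A × Fin N → S) : S → A → S → ℝ := empirical (x, fun _ => 0)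

omit [Fintype S] [MeasurableSpace S] [MeasurableSingletonClass S] [Fintype A] in
lemma sampleModel_nonneg (x : S × A × Fin N → S) (s : S) (a : A) (s' : S) :
    0 ≤ sampleModel x s a s' := by
  unfold sampleModel empirical
  positivity

omit [MeasurableSpace S] [MeasurableSingletonClass S] [Fintype A] in
lemma sum_sampleModel_mul (x : S × A × Fin N → S) (s : S) (a : A) (f : S → ℝ) :
    ∑ s', sampleModel x s a s' * f s' = (∑ j, f (x (s, a, j))) / N := by
  have : ∀ s', sampleModel x s a s' * f s'
      = (∑ j : Fin N, if x (s, a, j) = s' then f s' else 0) / N := by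
    intro s'
    rw [← Finset.sum_filter, Finset.sum_const, nsmul_eq_mul, sampleModel, empirical]
    ring
  simp only [this]
  rw [← Finset.sum_div, Finset.sum_comm]
  simp

omit [MeasurableSpace S] [MeasurableSingletonClass S] [Fintype A] in
lemma sampleModel_mem (hN : 0 < N) (x : S × A × Fin N → S) (s : S) (a : A) :
    sampleModel x s a ∈ stdSimplex ℝ S := by
  refine ⟨sampleModel_nonneg x s a, ?_⟩
  have h := sum_sampleModel_mul x s a fun _ => 1
  have hN' : (N : ℝ) ≠ 0 := by positivity
  simpa [hN'] using h

/-- Bernstein's inequality for the rows of the empirical model. -/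
lemma sampleLaw_not_bernsteinClose_le {P : S → A → S → ℝ}
    (hP : ∀ s a, P s a ∈ stdSimplex ℝ S) (hN : 0 < N) (s : S) (a : A) {f : S → ℝ} {b L : ℝ}
    (hb : 0 < b) (hL : 0 < L) (hf : ∀ s, f s ∈ Set.Icc 0 b) :
    sampleLaw P N {x | ¬ BernsteinClose (P s a) (sampleModel x s a) f b (L / N)}
      ≤ ENNReal.ofReal (2 * Real.exp (-L)) := by
  classical
  have hprob : ∀ x : S × A × Fin N, IsProbabilityMeasure (nextStateLaw P x.1 x.2.1) :=
    fun x => isProbabilityMeasure_nextStateLaw (hP _ _)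
  set m := ∑ s', P s a s' * f s' with hm
  have hm0 : 0 ≤ m := Finset.sum_nonneg fun s' _ => mul_nonneg ((hP s a).1 s') (hf s').1
  have hmb : m ≤ b := by
    calc m ≤ ∑ s', P s a s' * b :=
          Finset.sum_le_sum fun s' _ => mul_le_mul_of_nonneg_left (hf s').2 ((hP s a).1 s')
      _ = b := by rw [← Finset.sum_mul, (hP s a).2, one_mul]
  set J : Finset (S × A × Fin N) := Finset.univ.map ⟨fun j => (s, a, j), fun i j h => by simpa using h⟩
    with hJ
  have hJmem : ∀ i ∈ J, i.1 = s ∧ i.2.1 = a := by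
    intro i hi
    obtain ⟨j, -, rfl⟩ := Finset.mem_map.1 hi
    exact ⟨rfl, rfl⟩
  have hsum : ∀ (g : S → ℝ) (x : S × A × Fin N → S), ∑ i ∈ J, g (x i) = ∑ j, g (x (s, a, j)) :=
    fun g x => by rw [hJ, Finset.sum_map]; rfl
  have hcard : (J.card : ℝ) = N := by rw [hJ, Finset.card_map, Finset.card_univ, Fintype.card_fin]
  have hrow : ∑ s', P s a s' * (f s' - m) ^ 2 = rowVar (P s a) f := by
    rw [sum_sub_sq (hP s a).2, ← hm, sub_self]; ring
  have hmean0 : ∑ s', P s a s' * (f s' - m) = 0 := by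
    simp only [mul_sub, Finset.sum_sub_distrib, ← Finset.sum_mul, (hP s a).2, ← hm]; ring
  have hbd : ∀ (σ : ℝ), |σ| = 1 → ∀ s', |σ * (f s' - m)| ≤ b := by
    intro σ hσ s'
    rw [abs_mul, hσ, one_mul, abs_le]
    constructor <;> linarith [(hf s').1, (hf s').2]
  have hside : ∀ (σ : ℝ), |σ| = 1 → (sampleLaw P N).real
      {x | 2 * √(N * L * rowVar (P s a) f) + 2 * b * L ≤ ∑ j, σ * (f (x (s, a, j)) - m)}
        ≤ Real.exp (-L) := by
    intro σ hσ
    have h := bernstein_upper (fun x : S × A × Fin N => nextStateLaw P x.1 x.2.1) J hb hL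
      (hbd σ hσ)
      (fun i hi => by
        obtain ⟨h1, h2⟩ := hJmem i hi
        rw [h1, h2, integral_const_mul, integral_nextStateLaw (hP s a), hmean0, mul_zero])
      (fun i hi => by
        obtain ⟨h1, h2⟩ := hJmem i hi
        have : ∀ s', (σ * (f s' - m)) ^ 2 = (f s' - m) ^ 2 := fun s' => by
          rw [mul_pow, ← sq_abs σ, hσ]; ring
        simp only [h1, h2, this]
        rw [integral_nextStateLaw (hP s a), hrow])
    rw [hcard] at h
    simp only [hsum (fun s' => σ * (f s' - m))] at h
    exact h
  have hprobS : IsProbabilityMeasure (sampleLaw P N) :=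
    inferInstanceAs (IsProbabilityMeasure (Measure.pi _))
  have hsub : {x : S × A × Fin N → S | ¬ BernsteinClose (P s a) (sampleModel x s a) f b (L / N)} ⊆
      {x | 2 * √(N * L * rowVar (P s a) f) + 2 * b * L ≤ ∑ j, 1 * (f (x (s, a, j)) - m)} ∪
      {x | 2 * √(N * L * rowVar (P s a) f) + 2 * b * L ≤ ∑ j, -1 * (f (x (s, a, j)) - m)} := by
    intro x hx
    have hN' : (0 : ℝ) < N := by exact_mod_cast hN
    simp only [Set.mem_ofPred_eq, BernsteinClose, not_le] at hx
    have h1 : ∑ s', (sampleModel x s a s' - P s a s') * f s'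
        = (∑ j, (f (x (s, a, j)) - m)) / N := by
      simp only [sub_mul, Finset.sum_sub_distrib]
      rw [sum_sampleModel_mul, ← hm]
      simp
      field_simp
    have h2 : √(L / N * rowVar (P s a) f) = √(N * L * rowVar (P s a) f) / N := by
      rw [show L / N * rowVar (P s a) f = N * L * rowVar (P s a) f / N ^ 2 by field_simp,
        Real.sqrt_div' _ (by positivity), Real.sqrt_sq hN'.le]
    rw [h1, h2, abs_div, abs_of_pos hN', lt_div_iff₀ hN'] at hx
    have h3 : (2 * (√(N * L * rowVar (P s a) f) / N) + 2 * b * (L / N)) * N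
        = 2 * √(N * L * rowVar (P s a) f) + 2 * b * L := by field_simp
    rw [h3] at hx
    simp only [Set.mem_union, Set.mem_ofPred_eq, one_mul, neg_mul, Finset.sum_neg_distrib]
    rcases lt_abs.1 hx with h | h
    · exact Or.inl h.le
    · exact Or.inr h.le
  refine (measure_mono hsub).trans ((measure_union_le _ _).trans ?_)
  rw [two_mul (Real.exp _), ENNReal.ofReal_add (Real.exp_nonneg _) (Real.exp_nonneg _)]
  exact add_le_add
    (ENNReal.le_ofReal_iff_toReal_le (measure_ne_top _ _) (Real.exp_nonneg _) |>.2
      (hside 1 (by simp)))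
    (ENNReal.le_ofReal_iff_toReal_le (measure_ne_top _ _) (Real.exp_nonneg _) |>.2
      (hside (-1) (by simp)))

end Bernstein

/-! ### Perturbed rewards have a unique optimal policy -/

section Perturbation

variable {S A : Type*} [Fintype S] [Fintype A] [DecidableEq S] [DecidableEq A]
  {P : S → A → S → ℝ} {γ : ℝ}

/-- The reward `l` perturbed by `ξ`. -/
def perturb (l : S → A → ℝ) (ξ : S × A → ℝ) : S → A → ℝ := fun s a => l s a + ξ (s, a)

variable (hP : IsSubstochastic P) (hγ : 0 ≤ γ) (hγ1 : γ < 1)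

include hP hγ hγ1

omit [DecidableEq A] in
lemma continuous_stateValue_perturb (l : S → A → ℝ) (π : Policy S A) (s : S) :
    Continuous fun ξ => stateValue P γ (perturb l ξ) π s := by
  let F : (S × A → ℝ) →ₗ[ℝ] ℝ :=
    { toFun := fun ξ => stateValue P γ (fun s a => ξ (s, a)) π s
      map_add' := fun ξ ξ' =>
        stateValue_add hP hγ hγ1 (fun s a => ξ (s, a)) (fun s a => ξ' (s, a)) π s
      map_smul' := fun k ξ => stateValue_mul hP hγ hγ1 k (fun s a => ξ (s, a)) π s }
  have h : (fun ξ => stateValue P γ (perturb l ξ) π s)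
      = fun ξ => stateValue P γ l π s + F ξ := by
    funext ξ
    exact stateValue_add hP hγ hγ1 l (fun s a => ξ (s, a)) π s
  rw [h]
  exact continuous_const.add F.continuous_of_finiteDimensional

omit [DecidableEq A] in
lemma isClosed_setOf_isOptimalPolicy (l : S → A → ℝ) (π : Policy S A) :
    IsClosed {ξ | IsOptimalPolicy P γ (perturb l ξ) π} := by
  have h : {ξ | IsOptimalPolicy P γ (perturb l ξ) π} = ⋂ (s : S) (π' : Policy S A),
      {ξ | stateValue P γ (perturb l ξ) π' s ≤ stateValue P γ (perturb l ξ) π s} := by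
    ext ξ
    simp [IsOptimalPolicy, stateValue]
  rw [h]
  exact isClosed_iInter fun s => isClosed_iInter fun π' => isClosed_le
    (continuous_stateValue_perturb hP hγ hγ1 l π' s) (continuous_stateValue_perturb hP hγ hγ1 l π s)

/-- Two deterministic policies that differ in the state `s` almost surely have different values in
`s`: the perturbation of `(s, p s)` enters the value of `p` with a coefficient at least one, and
not at all that of `p'`. -/
lemma measure_stateValue_eq_zero (κ : S × A → Measure ℝ) [∀ i, IsProbabilityMeasure (κ i)]
    [∀ i, NullSingletonClass (κ i)] (l : S → A → ℝ) {p p' : S → A} {s : S} (hne : p s ≠ p' s) :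
    Measure.pi κ {ξ | stateValue P γ (perturb l ξ) (detPolicy p) s
      = stateValue P γ (perturb l ξ) (detPolicy p') s} = 0 := by
  set e : S → A → ℝ := fun s' a => if (s', a) = (s, p s) then 1 else 0 with he
  have he0 : ∀ s' a, 0 ≤ e s' a := fun s' a => by simp only [he]; split_ifs <;> norm_num
  have h1 : 1 ≤ stateValue P γ e (detPolicy p) s := by
    rw [← backup_stateValue hP hγ hγ1, backup_detPolicy]
    have : 0 ≤ γ * ∑ s', P s (p s) s' * stateValue P γ e (detPolicy p) s' :=
      mul_nonneg hγ (Finset.sum_nonneg fun s' _ => mul_nonneg (hP.nonneg _ _ _)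
        (stateValue_nonneg hP hγ hγ1 _ he0 s'))
    simpa [he] using this
  have h0 : stateValue P γ e (detPolicy p') s = 0 := by
    have := eq_stateValue_of_backup hP hγ hγ1 (l := e) (π := detPolicy p') (W := fun _ => 0)
      fun s' => by
        have : (s', p' s') ≠ (s, p s) := fun h => by
          obtain ⟨rfl, h2⟩ := Prod.mk.inj h
          exact hne h2.symm
        simp [backup_detPolicy, he, this, -Prod.mk.injEq]
    rw [← this]
  have hclosed : IsClosed {ξ | stateValue P γ (perturb l ξ) (detPolicy p) s
      = stateValue P γ (perturb l ξ) (detPolicy p') s} :=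
    isClosed_eq (continuous_stateValue_perturb hP hγ hγ1 l _ s)
      (continuous_stateValue_perturb hP hγ hγ1 l _ s)
  have hfub := pi_update_apply κ (s, p s) (κ (s, p s)) hclosed.measurableSet
  rw [Function.update_eq_self] at hfub
  rw [hfub]
  refine (lintegral_congr fun ξ => ?_).trans lintegral_zero
  refine Set.Subsingleton.measure_zero (fun τ hτ τ' hτ' => ?_) _
  have hdec : ∀ π, stateValue P γ (perturb l (Function.update ξ (s, p s) τ')) π s
      = stateValue P γ (perturb l (Function.update ξ (s, p s) τ)) π s
        + (τ' - τ) * stateValue P γ e π s := by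
    intro π
    rw [← stateValue_mul hP hγ hγ1, ← stateValue_add hP hγ hγ1]
    congr 1
    funext s' a
    by_cases h : (s', a) = (s, p s)
    · simp only [perturb, he, h, if_true, Function.update_self, mul_one]
      ring
    · simp [perturb, he, h, -Prod.mk.injEq]
  simp only [Set.mem_ofPred_eq] at hτ hτ'
  rw [hdec, hdec, h0, hτ] at hτ'
  have : (τ' - τ) * stateValue P γ e (detPolicy p) s = 0 := by linarith
  rcases mul_eq_zero.1 this with h | h
  · linarith
  · linarith

/-- Under an atomless perturbation of the reward, almost surely at most one deterministic policy is
optimal. -/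
lemma ae_unique_optimal (κ : S × A → Measure ℝ) [∀ i, IsProbabilityMeasure (κ i)]
    [∀ i, NullSingletonClass (κ i)] (l : S → A → ℝ) :
    ∀ᵐ ξ ∂Measure.pi κ, ∀ p p' : S → A, IsOptimalPolicy P γ (perturb l ξ) (detPolicy p) →
      IsOptimalPolicy P γ (perturb l ξ) (detPolicy p') → p = p' := by
  have h : ∀ p p' : S → A, ∀ s, ∀ᵐ ξ ∂Measure.pi κ, p s ≠ p' s →
      stateValue P γ (perturb l ξ) (detPolicy p) s
        ≠ stateValue P γ (perturb l ξ) (detPolicy p') s := by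
    intro p p' s
    by_cases hne : p s = p' s
    · simp [hne]
    · rw [ae_iff]
      convert measure_stateValue_eq_zero hP hγ hγ1 κ l hne using 2
      ext ξ
      simp [hne]
  simp only [← ae_all_iff] at h
  filter_upwards [h] with ξ hξ p p' hp hp'
  funext s
  by_contra hne
  exact hξ p p' s hne (le_antisymm (hp' s _) (hp s _))

end Perturbation

/-! ### Decoupling an optimal policy from one row of the model -/

section LeaveOneOut

variable {S A : Type*} [Fintype S] [Fintype A] [DecidableEq S] [DecidableEq A]
  {P : S → A → S → ℝ} {γ : ℝ}

/-- The model in which the process is killed when the pair `i` is played. -/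
def killRow (P : S → A → S → ℝ) (i : S × A) : S → A → S → ℝ :=
  fun s a s' => if (s, a) = i then 0 else P s a s'

omit [Fintype A] in
lemma IsSubstochastic.killRow (hP : IsSubstochastic P) (i : S × A) :
    IsSubstochastic (killRow P i) := by
  refine ⟨fun s a s' => ?_, fun s a => ?_⟩
  · unfold StrictCMDP.killRow
    split_ifs
    · exact le_rfl
    · exact hP.nonneg s a s'
  · unfold StrictCMDP.killRow
    split_ifs
    · simp
    · exact hP.sum_le s a

/-- The optimal value function. -/
def optValue (P : S → A → S → ℝ) (γ : ℝ) (l : S → A → ℝ) (s : S) : ℝ :=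
  ⨆ p : S → A, stateValue P γ l (detPolicy p) s

section

variable (hP : IsSubstochastic P) (hγ : 0 ≤ γ) (hγ1 : γ < 1)

include hP hγ hγ1

lemma optValue_eq [Nonempty A] {l : S → A → ℝ} {π : Policy S A} (h : IsOptimalPolicy P γ l π)
    (s : S) : optValue P γ l s = stateValue P γ l π s := by
  obtain ⟨p, hp⟩ := exists_isOptimalPolicy hP hγ hγ1 l
  refine le_antisymm (ciSup_le fun p => h s _) ?_
  exact (hp s π).trans (le_ciSup (f := fun p => stateValue P γ l (detPolicy p) s)
    (Set.finite_range _).bddAbove p)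

lemma abs_optValue_sub_le [Nonempty A] {l l' : S → A → ℝ} {c : ℝ} (hc : 0 ≤ c)
    (h : ∀ s a, |l s a - l' s a| ≤ c) (s : S) :
    |optValue P γ l s - optValue P γ l' s| ≤ c / (1 - γ) := by
  have key : ∀ {l l' : S → A → ℝ}, (∀ s a, |l s a - l' s a| ≤ c) →
      optValue P γ l s ≤ optValue P γ l' s + c / (1 - γ) := by
    intro l l' h
    refine ciSup_le fun p => ?_
    have h1 := abs_stateValue_le hP hγ hγ1 (l := fun s a => l s a - l' s a) (detPolicy p) hc h s
    rw [stateValue_sub hP hγ hγ1] at h1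
    have h2 := le_ciSup (f := fun p => stateValue P γ l' (detPolicy p) s)
      (Set.finite_range _).bddAbove p
    have := (abs_le.1 h1).2
    unfold optValue
    linarith
  rw [abs_le']
  have h1 := key h
  have h2 := key (l := l') (l' := l) fun s a => by rw [abs_sub_comm]; exact h s a
  constructor <;> linarith

/-- An optimal policy remains optimal when the pair `i` is made to end the process and to pay what
continuing after it was worth. In the new model the samples of the row `i` have been replaced by a
single real number. -/
lemma isOptimalPolicy_killRow {l : S → A → ℝ} {ξ : S × A → ℝ} {i : S × A} {τ : ℝ}
    {π : Policy S A} (h : IsOptimalPolicy P γ (perturb l (Function.update ξ i τ)) π) :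
    let V := stateValue P γ (perturb l (Function.update ξ i τ)) π
    let τ' := τ + γ * ∑ s', P i.1 i.2 s' * V s'
    IsOptimalPolicy (killRow P i) γ (perturb l (Function.update ξ i τ')) π ∧
      stateValue (killRow P i) γ (perturb l (Function.update ξ i τ')) π = V := by
  intro V τ'
  have hQ : ∀ s a, perturb l (Function.update ξ i τ') s a + γ * ∑ s', killRow P i s a s' * V s'
      = perturb l (Function.update ξ i τ) s a + γ * ∑ s', P s a s' * V s' := by
    intro s a
    by_cases hi : (s, a) = i
    · subst hi
      simp only [perturb, killRow, Function.update_self, if_true, zero_mul, Finset.sum_const_zero,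
        mul_zero, τ']
      ring
    · simp [perturb, killRow, hi]
  have hV : V = stateValue (killRow P i) γ (perturb l (Function.update ξ i τ')) π := by
    refine eq_stateValue_of_backup (hP.killRow i) hγ hγ1 fun s => ?_
    refine Eq.trans ?_ (backup_stateValue hP hγ hγ1 (perturb l (Function.update ξ i τ)) π s)
    exact Finset.sum_congr rfl fun a _ => by rw [hQ]
  refine ⟨isOptimalPolicy_of_le (hP.killRow i) hγ hγ1 ?_, hV.symm⟩
  rw [← hV]
  intro s a
  rw [hQ]
  exact (isOptimalPolicy_iff hP hγ hγ1).1 h s a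

/-- The set of perturbations of the pair `i` for which some policy of a family is optimal is a
Lipschitz image of the corresponding set in the model killed at `i`. -/
lemma volume_optimal_le [Nonempty A] {l : S → A → ℝ} {B ω H : ℝ} (hB : 0 ≤ B)
    (hl : ∀ s a, |l s a| ≤ B) (hω : 0 ≤ ω) (hH : H = (B + ω) / (1 - γ)) (i : S × A)
    {ξ : S × A → ℝ} (hξ : ∀ j, j ≠ i → ξ j ∈ Set.Icc 0 ω) (Z : Set (S → A)) :
    volume (Set.Icc 0 ω ∩ {τ | ∃ p ∈ Z,
        IsOptimalPolicy P γ (perturb l (Function.update ξ i τ)) (detPolicy p)})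
      ≤ ENNReal.ofReal (1 / (1 - γ)) * volume (Set.Icc (-H) H ∩ {τ | ∃ p ∈ Z,
        IsOptimalPolicy (killRow P i) γ (perturb l (Function.update ξ i τ)) (detPolicy p)}) := by
  have h1γ : 0 < 1 - γ := by linarith
  have hK := hP.killRow i
  set g : ℝ → ℝ := fun τ => τ - γ * ∑ s', P i.1 i.2 s' *
    optValue (killRow P i) γ (perturb l (Function.update ξ i τ)) s' with hg
  have hlip : LipschitzWith (Real.toNNReal (1 / (1 - γ))) g := by
    refine LipschitzWith.of_dist_le_mul fun τ τ' => ?_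
    rw [Real.coe_toNNReal _ (by positivity), Real.dist_eq, Real.dist_eq]
    have hpt : ∀ s', |optValue (killRow P i) γ (perturb l (Function.update ξ i τ)) s'
        - optValue (killRow P i) γ (perturb l (Function.update ξ i τ')) s'|
        ≤ |τ - τ'| / (1 - γ) := by
      refine abs_optValue_sub_le hK hγ hγ1 (abs_nonneg _) fun s a => ?_
      by_cases hi : (s, a) = i
      · simp [perturb, hi]
      · simp [perturb, hi]
    have hsum : |∑ s', P i.1 i.2 s' *
          optValue (killRow P i) γ (perturb l (Function.update ξ i τ)) s'
        - ∑ s', P i.1 i.2 s' * optValue (killRow P i) γ (perturb l (Function.update ξ i τ')) s'|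
        ≤ |τ - τ'| / (1 - γ) := by
      rw [← Finset.sum_sub_distrib]
      calc _ ≤ ∑ s', P i.1 i.2 s' * (|τ - τ'| / (1 - γ)) := by
            refine (Finset.abs_sum_le_sum_abs _ _).trans (Finset.sum_le_sum fun s' _ => ?_)
            rw [← mul_sub, abs_mul, abs_of_nonneg (hP.nonneg _ _ _)]
            exact mul_le_mul_of_nonneg_left (hpt s') (hP.nonneg _ _ _)
        _ ≤ _ := by
            rw [← Finset.sum_mul]
            exact mul_le_of_le_one_left (by positivity) (hP.sum_le _ _)
    calc |g τ - g τ'| ≤ |τ - τ'| + γ * (|τ - τ'| / (1 - γ)) := by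
          have : g τ - g τ' = (τ - τ') - γ * (∑ s', P i.1 i.2 s' *
              optValue (killRow P i) γ (perturb l (Function.update ξ i τ)) s'
              - ∑ s', P i.1 i.2 s' *
                optValue (killRow P i) γ (perturb l (Function.update ξ i τ')) s') := by
            simp only [hg]; ring
          rw [this]
          refine (abs_sub _ _).trans (add_le_add_right ?_ _)
          rw [abs_mul, abs_of_nonneg hγ]
          exact mul_le_mul_of_nonneg_left hsum hγ
      _ = 1 / (1 - γ) * |τ - τ'| := by field_simp; ring
  have hsub : Set.Icc 0 ω ∩ {τ | ∃ p ∈ Z,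
      IsOptimalPolicy P γ (perturb l (Function.update ξ i τ)) (detPolicy p)} ⊆
      g '' (Set.Icc (-H) H ∩ {τ | ∃ p ∈ Z,
        IsOptimalPolicy (killRow P i) γ (perturb l (Function.update ξ i τ)) (detPolicy p)}) := by
    rintro τ ⟨hτ, p, hpZ, hp⟩
    obtain ⟨h1, h2⟩ := isOptimalPolicy_killRow hP hγ hγ1 hp
    set V := stateValue P γ (perturb l (Function.update ξ i τ)) (detPolicy p) with hV
    set τ' := τ + γ * ∑ s', P i.1 i.2 s' * V s' with hτ'
    refine ⟨τ', ⟨?_, p, hpZ, h1⟩, ?_⟩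
    · have hr : ∀ s a, |perturb l (Function.update ξ i τ) s a| ≤ B + ω := by
        intro s a
        refine (abs_add_le _ _).trans (add_le_add (hl s a) ?_)
        by_cases hi : (s, a) = i
        · rw [hi, Function.update_self, abs_of_nonneg hτ.1]
          exact hτ.2
        · rw [Function.update_of_ne hi, abs_of_nonneg (hξ _ hi).1]
          exact (hξ _ hi).2
      have hVb : ∀ s', |V s'| ≤ H := fun s' => by
        rw [hH]
        exact abs_stateValue_le hP hγ hγ1 _ (by positivity) hr s'
      have hH0 : 0 ≤ H := by rw [hH]; positivity
      have hPV : |∑ s', P i.1 i.2 s' * V s'| ≤ H := by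
        calc _ ≤ ∑ s', P i.1 i.2 s' * H := by
              refine (Finset.abs_sum_le_sum_abs _ _).trans (Finset.sum_le_sum fun s' _ => ?_)
              rw [abs_mul, abs_of_nonneg (hP.nonneg _ _ _)]
              exact mul_le_mul_of_nonneg_left (hVb s') (hP.nonneg _ _ _)
          _ ≤ H := by
              rw [← Finset.sum_mul]
              exact mul_le_of_le_one_left hH0 (hP.sum_le _ _)
      have hωH : ω + γ * H ≤ H := by
        have : H * (1 - γ) = B + ω := by rw [hH]; field_simp
        linarith
      have h3 := mul_le_mul_of_nonneg_left (abs_le.1 hPV).1 hγ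
      have h4 := mul_le_mul_of_nonneg_left (abs_le.1 hPV).2 hγ
      constructor
      · rw [hτ']; linarith [hτ.1]
      · rw [hτ']; linarith [hτ.2]
    · simp only [hg]
      have : ∀ s', optValue (killRow P i) γ (perturb l (Function.update ξ i τ')) s' = V s' :=
        fun s' => by rw [optValue_eq hK hγ hγ1 h1, h2]
      simp only [this]
      rw [hτ']
      ring
  refine (measure_mono hsub).trans ?_
  have h := hlip.hausdorffMeasure_image_le (d := 1) zero_le_one (Set.Icc (-H) H ∩ {τ | ∃ p ∈ Z,
    IsOptimalPolicy (killRow P i) γ (perturb l (Function.update ξ i τ)) (detPolicy p)})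
  rw [hausdorffMeasure_real, ENNReal.rpow_one] at h
  exact h

end

/-- The uniform distribution on `[a, b]`. -/
def uniform (a b : ℝ) : Measure ℝ := ProbabilityTheory.cond volume (Set.Icc a b)

lemma uniform_apply (a b : ℝ) (E : Set ℝ) :
    uniform a b E = (ENNReal.ofReal (b - a))⁻¹ * volume (Set.Icc a b ∩ E) := by
  rw [uniform, ProbabilityTheory.cond_apply measurableSet_Icc, Real.volume_Icc]

lemma isProbabilityMeasure_uniform {a b : ℝ} (h : a < b) : IsProbabilityMeasure (uniform a b) :=
  ProbabilityTheory.cond_isProbabilityMeasure_of_finite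
    (by rw [Real.volume_Icc]; simpa using h) (by rw [Real.volume_Icc]; exact ENNReal.ofReal_ne_top)

instance nullSingletonClass_uniform (a b : ℝ) : NullSingletonClass (uniform a b) :=
  ⟨fun x => ProbabilityTheory.cond_absolutelyContinuous (measure_singleton x)⟩

/-- Passing to the model killed at the pair `i`, with a perturbation of `i` that is uniform on a
larger interval, costs a factor polynomial in the parameters. -/
lemma pi_uniform_optimal_le [Nonempty A] (hP : IsSubstochastic P) (hγ : 0 ≤ γ) (hγ1 : γ < 1)
    {l : S → A → ℝ} {B ω H : ℝ} (hB : 0 ≤ B) (hl : ∀ s a, |l s a| ≤ B) (hω : 0 < ω)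
    (hH : H = (B + ω) / (1 - γ)) (i : S × A) (Z : Set (S → A)) :
    Measure.pi (fun _ : S × A => uniform 0 ω) {ξ | (∀ j, ξ j ∈ Set.Icc 0 ω) ∧ ∃ p ∈ Z,
        IsOptimalPolicy P γ (perturb l ξ) (detPolicy p)}
      ≤ ENNReal.ofReal (2 * H / (ω * (1 - γ))) *
        Measure.pi (Function.update (fun _ : S × A => uniform 0 ω) i (uniform (-H) H))
          {ξ | ∃ p ∈ Z, IsOptimalPolicy (killRow P i) γ (perturb l ξ) (detPolicy p)} := by
  have h1γ : 0 < 1 - γ := by linarith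
  have hH0 : 0 < H := by rw [hH]; positivity
  have := isProbabilityMeasure_uniform hω
  have := isProbabilityMeasure_uniform (show -H < H by linarith)
  have hE : ∀ {P : S → A → S → ℝ}, IsSubstochastic P → MeasurableSet {ξ | ∃ p ∈ Z,
      IsOptimalPolicy P γ (perturb l ξ) (detPolicy p)} := by
    intro P hP
    have : {ξ | ∃ p ∈ Z, IsOptimalPolicy P γ (perturb l ξ) (detPolicy p)}
        = ⋃ p ∈ Z, {ξ | IsOptimalPolicy P γ (perturb l ξ) (detPolicy p)} := by
      ext ξ; simp
    rw [this]
    exact (Set.toFinite Z).measurableSet_biUnion fun p _ =>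
      (isClosed_setOf_isOptimalPolicy hP hγ hγ1 l _).measurableSet
  have hE' : MeasurableSet {ξ : S × A → ℝ | (∀ j, ξ j ∈ Set.Icc 0 ω) ∧ ∃ p ∈ Z,
      IsOptimalPolicy P γ (perturb l ξ) (detPolicy p)} := by
    have h : {ξ : S × A → ℝ | ∀ j, ξ j ∈ Set.Icc 0 ω} = Set.univ.pi fun _ => Set.Icc 0 ω := by
      ext ξ
      simp only [Set.mem_ofPred_eq, Set.mem_univ_pi]
    exact (h ▸ MeasurableSet.univ_pi fun _ => measurableSet_Icc).inter (hE hP)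
  have h1 := pi_update_apply (fun _ : S × A => uniform 0 ω) i (uniform 0 ω) hE'
  rw [Function.update_eq_self i (fun _ : S × A => uniform 0 ω)] at h1
  rw [h1, pi_update_apply (fun _ : S × A => uniform 0 ω) i (uniform (-H) H) (hE (hP.killRow i)),
    ← lintegral_const_mul' _ _ ENNReal.ofReal_ne_top]
  refine lintegral_mono fun ξ => ?_
  by_cases hξ : ∀ j, j ≠ i → ξ j ∈ Set.Icc 0 ω
  · have h2 := volume_optimal_le hP hγ hγ1 hB hl hω.le hH i hξ Z
    have h3 : uniform 0 ω {τ | Function.update ξ i τ ∈ {ξ : S × A → ℝ |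
        (∀ j, ξ j ∈ Set.Icc 0 ω) ∧ ∃ p ∈ Z, IsOptimalPolicy P γ (perturb l ξ) (detPolicy p)}}
        ≤ (ENNReal.ofReal ω)⁻¹ * volume (Set.Icc 0 ω ∩ {τ | ∃ p ∈ Z,
          IsOptimalPolicy P γ (perturb l (Function.update ξ i τ)) (detPolicy p)}) := by
      rw [uniform_apply, sub_zero]
      refine mul_le_mul_right (measure_mono ?_) _
      exact fun τ hτ => ⟨hτ.1, hτ.2.2⟩
    refine h3.trans ((mul_le_mul_right h2 _).trans (le_of_eq ?_))
    rw [uniform_apply, ← ENNReal.ofReal_inv_of_pos hω, ← ENNReal.ofReal_inv_of_pos (by linarith),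
      ← mul_assoc, ← mul_assoc, ← ENNReal.ofReal_mul (by positivity),
      ← ENNReal.ofReal_mul (by positivity)]
    congr 2
    field_simp
    ring
  · have h3 : {τ | Function.update ξ i τ ∈ {ξ : S × A → ℝ | (∀ j, ξ j ∈ Set.Icc 0 ω) ∧ ∃ p ∈ Z,
        IsOptimalPolicy P γ (perturb l ξ) (detPolicy p)}} = ∅ := by
      rw [Set.eq_empty_iff_forall_notMem]
      rintro τ ⟨hτ, -⟩
      refine hξ fun j hj => ?_
      simpa [hj] using hτ j
    rw [h3, measure_empty]
    exact zero_le

variable [MeasurableSpace S] [MeasurableSingletonClass S] {N : ℕ}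

/-- An event that concerns only the samples of the pair `i` has the same probability bound for the
data-dependent optimal policy as for a fixed policy, up to a polynomial factor.

Killing the pair `i` makes the optimal policy independent of those samples, and almost surely
unique. -/
lemma measure_optimal_bad_le [Nonempty A] {P : S → A → S → ℝ}
    (hP : ∀ s a, P s a ∈ stdSimplex ℝ S) (hN : 0 < N) (hγ : 0 ≤ γ) (hγ1 : γ < 1)
    {l : S → A → ℝ} {B ω H : ℝ} (hB : 0 ≤ B) (hl : ∀ s a, |l s a| ≤ B) (hω : 0 < ω)
    (hH : H = (B + ω) / (1 - γ)) (i : S × A) (Bad : (S × A × Fin N → S) → (S → A) → Prop)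
    (hBad : ∀ x y p, (∀ j, x (i.1, i.2, j) = y (i.1, i.2, j)) → Bad x p → Bad y p)
    {q : ENNReal} (hq : ∀ p, sampleLaw P N {x | Bad x p} ≤ q) :
    (sampleLaw P N).prod (Measure.pi fun _ : S × A => uniform 0 ω)
        {z | (∀ j, z.2 j ∈ Set.Icc 0 ω) ∧ ∃ p ∈ {p | Bad z.1 p},
          IsOptimalPolicy (sampleModel z.1) γ (perturb l z.2) (detPolicy p)}
      ≤ ENNReal.ofReal (2 * H / (ω * (1 - γ))) * q := by
  have h1γ : 0 < 1 - γ := by linarith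
  have hH0 : 0 < H := by rw [hH]; positivity
  have hprob0 : ∀ x : S × A × Fin N, IsProbabilityMeasure (nextStateLaw P x.1 x.2.1) :=
    fun x => isProbabilityMeasure_nextStateLaw (hP _ _)
  have hprobS : IsProbabilityMeasure (sampleLaw P N) :=
    inferInstanceAs (IsProbabilityMeasure (Measure.pi _))
  have := isProbabilityMeasure_uniform hω
  have := isProbabilityMeasure_uniform (show -H < H by linarith)
  set K := ENNReal.ofReal (2 * H / (ω * (1 - γ)))
  set κ : S × A → Measure ℝ := Function.update (fun _ : S × A => uniform 0 ω) i (uniform (-H) H)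
    with hκ
  have hκp : ∀ j, IsProbabilityMeasure (κ j) := fun j => by
    by_cases hj : j = i
    · subst hj; simpa [hκ]
    · simpa [hκ, hj]
  have hκa : ∀ j, NullSingletonClass (κ j) := fun j => by
    by_cases hj : j = i
    · subst hj; simpa [hκ] using nullSingletonClass_uniform _ _
    · simpa [hκ, hj] using nullSingletonClass_uniform _ _
  have hsm : ∀ x : S × A × Fin N → S, IsSubstochastic (sampleModel x) :=
    fun x => IsSubstochastic.of_mem (sampleModel_mem hN x)
  set E : (S × A × Fin N → S) → Set (S × A → ℝ) := fun x => {ξ | (∀ j, ξ j ∈ Set.Icc 0 ω) ∧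
    ∃ p ∈ {p | Bad x p}, IsOptimalPolicy (sampleModel x) γ (perturb l ξ) (detPolicy p)} with hE
  set E' : (S × A × Fin N → S) → Set (S × A → ℝ) := fun x => {ξ |
    ∃ p ∈ {p | Bad x p},
      IsOptimalPolicy (killRow (sampleModel x) i) γ (perturb l ξ) (detPolicy p)} with hE'
  have hE'meas : ∀ x, MeasurableSet (E' x) := by
    intro x
    have : E' x = ⋃ p ∈ {p | Bad x p},
        {ξ | IsOptimalPolicy (killRow (sampleModel x) i) γ (perturb l ξ) (detPolicy p)} := by
      ext ξ; simp [hE']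
    rw [this]
    exact (Set.toFinite _).measurableSet_biUnion fun p _ =>
      (isClosed_setOf_isOptimalPolicy ((hsm x).killRow i) hγ hγ1 l _).measurableSet
  -- for almost every perturbation, the killed models have a unique optimal policy
  have hae : ∀ᵐ ξ ∂Measure.pi κ, sampleLaw P N {x | ξ ∈ E' x} ≤ q := by
    have huniq := ae_all_iff.2 fun x : S × A × Fin N → S =>
      ae_unique_optimal ((hsm x).killRow i) hγ hγ1 κ l
    filter_upwards [huniq] with ξ hξ
    have hmerge := pi_merge_apply (fun x : S × A × Fin N => nextStateLaw P x.1 x.2.1)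
      (fun x => nextStateLaw P x.1 x.2.1) (Finset.univ.filter fun x => (x.1, x.2.1) = i)
      (E := {x | ξ ∈ E' x}) (Set.toFinite _).measurableSet
    simp only [ite_self] at hmerge
    rw [sampleLaw, hmerge]
    refine (lintegral_mono (g := fun _ => q) fun x => ?_).trans (by simp)
    have hrow : ∀ y : S × A × Fin N → S, killRow (sampleModel fun k => if k ∈ Finset.univ.filter
        (fun x : S × A × Fin N => (x.1, x.2.1) = i) then y k else x k) i
        = killRow (sampleModel x) i := by
      intro y
      funext s a s'
      by_cases hi : (s, a) = i
      · simp [killRow, hi]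
      · simp [killRow, hi, sampleModel, empirical]
    have hbad : ∀ (y : S × A × Fin N → S) p, Bad (fun k => if k ∈ Finset.univ.filter
        (fun x : S × A × Fin N => (x.1, x.2.1) = i) then y k else x k) p → Bad y p := by
      intro y p
      exact hBad _ _ p fun j => by simp
    by_cases hex : ∃ p, IsOptimalPolicy (killRow (sampleModel x) i) γ (perturb l ξ) (detPolicy p)
    · obtain ⟨p, hp⟩ := hex
      refine (measure_mono fun y hy => ?_).trans (hq p)
      obtain ⟨p', hp'b, hp'⟩ := hy
      rw [hrow] at hp'
      have := hξ x _ _ hp hp'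
      subst this
      exact hbad y p hp'b
    · push Not at hex
      refine (measure_mono (t := ∅) fun y hy => ?_).trans (by simp)
      obtain ⟨p', hp'b, hp'⟩ := hy
      rw [hrow] at hp'
      exact hex p' hp'
  have hsub : {z : (S × A × Fin N → S) × (S × A → ℝ) | (∀ j, z.2 j ∈ Set.Icc 0 ω) ∧
      ∃ p ∈ {p | Bad z.1 p}, IsOptimalPolicy (sampleModel z.1) γ (perturb l z.2) (detPolicy p)}
      ⊆ ⋃ x, {x} ×ˢ E x := by
    intro z hz
    exact Set.mem_iUnion.2 ⟨z.1, rfl, hz⟩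
  calc _ ≤ ∑ x, (sampleLaw P N).prod (Measure.pi fun _ : S × A => uniform 0 ω) ({x} ×ˢ E x) :=
        (measure_mono hsub).trans (measure_iUnion_fintype_le _ _)
    _ ≤ ∑ x, K * (Measure.pi κ (E' x) * sampleLaw P N {x}) := by
        refine Finset.sum_le_sum fun x _ => ?_
        rw [Measure.prod_prod, mul_comm, ← mul_assoc]
        gcongr
        exact pi_uniform_optimal_le (hsm x) hγ hγ1 hB hl hω hH i _
    _ = K * ∫⁻ ξ, sampleLaw P N {x | ξ ∈ E' x} ∂Measure.pi κ := by
        rw [← Finset.mul_sum]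
        congr 1
        have h2 : ∀ ξ, sampleLaw P N {x | ξ ∈ E' x}
            = ∑ x, (E' x).indicator 1 ξ * sampleLaw P N {x} := by
          intro ξ
          rw [← lintegral_indicator_one (Set.toFinite _).measurableSet, lintegral_fintype]
          rfl
        simp only [h2]
        rw [lintegral_finsetSum _ fun x _ =>
          (measurable_one.indicator (hE'meas x)).mul_const _]
        refine Finset.sum_congr rfl fun x _ => ?_
        rw [lintegral_mul_const _ (measurable_one.indicator (hE'meas x)),
          lintegral_indicator_one (hE'meas x)]
    _ ≤ K * ∫⁻ _, q ∂Measure.pi κ := by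
        exact mul_le_mul_right (lintegral_mono_ae hae) _
    _ = K * q := by simp

end LeaveOneOut

/-! ### The dual iterates -/

section Dual

/-- The elements of `net ε₁ U`, as a finite set. -/
def netFinset (ε₁ U : ℝ) : Finset ℝ :=
  (Finset.range (⌊U / ε₁⌋₊ + 1)).image (fun j : ℕ => (j : ℝ) * ε₁) ∪ {U}

lemma coe_netFinset {ε₁ U : ℝ} (hε : 0 < ε₁) (hU : 0 ≤ U) : (netFinset ε₁ U : Set ℝ) = net ε₁ U := by
  ext x
  simp only [netFinset, net, Finset.coe_union, Finset.coe_image, Finset.coe_singleton,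
    Set.mem_union, Set.mem_image, Finset.coe_range, Set.mem_Iio, Set.mem_singleton_iff,
    Set.mem_ofPred_eq]
  refine or_congr ⟨?_, ?_⟩ Iff.rfl
  · rintro ⟨j, hj, rfl⟩
    refine ⟨⟨j, rfl⟩, ?_⟩
    rw [← le_div_iff₀ hε]
    exact (Nat.le_floor_iff (by positivity)).1 (Nat.lt_succ_iff.1 hj)
  · rintro ⟨⟨j, rfl⟩, hj⟩
    exact ⟨j, Nat.lt_succ_iff.2 (Nat.le_floor ((le_div_iff₀ hε).2 hj)), rfl⟩

lemma card_netFinset_le {ε₁ U : ℝ} (hε : 0 < ε₁) (hU : 0 ≤ U) :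
    ((netFinset ε₁ U).card : ℝ) ≤ U / ε₁ + 2 := by
  have h1 : (netFinset ε₁ U).card ≤ ⌊U / ε₁⌋₊ + 1 + 1 :=
    (Finset.card_union_le _ _).trans
      (add_le_add (Finset.card_image_le.trans (Finset.card_range _).le) (Finset.card_singleton _).le)
  have h2 : ((netFinset ε₁ U).card : ℝ) ≤ (⌊U / ε₁⌋₊ : ℝ) + 1 + 1 := by exact_mod_cast h1
  have h3 := Nat.floor_le (show 0 ≤ U / ε₁ by positivity)
  linarith

lemma mem_Icc_of_mem_net {ε₁ U x : ℝ} (hε : 0 < ε₁) (hU : 0 ≤ U) (h : x ∈ net ε₁ U) :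
    x ∈ Set.Icc 0 U := by
  rcases h with ⟨⟨j, rfl⟩, hj⟩ | rfl
  · exact ⟨by positivity, hj⟩
  · exact ⟨hU, le_rfl⟩

lemma zero_mem_net {ε₁ U : ℝ} (hU : 0 ≤ U) : (0 : ℝ) ∈ net ε₁ U :=
  Or.inl ⟨⟨0, by simp⟩, hU⟩

lemma exists_isRounding {ε₁ U : ℝ} (hε : 0 < ε₁) (hU : 0 ≤ U) (x : ℝ) :
    ∃ y, IsRounding (net ε₁ U) x y := by
  rw [← coe_netFinset hε hU]
  obtain ⟨y, hy, hmin⟩ := Finset.exists_min_image (netFinset ε₁ U) (fun y => |x - y|)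
    ⟨U, by simp [netFinset]⟩
  exact ⟨y, hy, hmin⟩

lemma abs_sub_le_of_isRounding {ε₁ U x y : ℝ} (hε : 0 < ε₁) (hx : x ∈ Set.Icc 0 U)
    (h : IsRounding (net ε₁ U) x y) : |x - y| ≤ ε₁ := by
  have h1 := Nat.floor_le (show 0 ≤ x / ε₁ from div_nonneg hx.1 hε.le)
  have h2 := Nat.lt_floor_add_one (x / ε₁)
  rw [le_div_iff₀ hε] at h1
  rw [div_lt_iff₀ hε] at h2
  refine (h.2 (⌊x / ε₁⌋₊ * ε₁) (Or.inl ⟨⟨_, rfl⟩, h1.trans hx.2⟩)).trans ?_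
  rw [abs_le]
  constructor <;> linarith

lemma proj_mem {U : ℝ} (hU : 0 ≤ U) (x : ℝ) : proj U x ∈ Set.Icc 0 U :=
  ⟨le_max_left _ _, max_le hU (min_le_left _ _)⟩

lemma abs_proj_sub_le {U x y : ℝ} (hy : y ∈ Set.Icc 0 U) : |proj U x - y| ≤ |x - y| := by
  have hy' : proj U y = y := by rw [proj, min_eq_right hy.2, max_eq_right hy.1]
  conv_lhs => rw [← hy']
  have h1 := abs_max_sub_max_le_max 0 (min U x) 0 (min U y)
  have h2 := abs_min_sub_min_le_max U x U y
  rw [sub_self, abs_zero, max_eq_right (abs_nonneg (min U x - min U y))] at h1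
  rw [sub_self, abs_zero, max_eq_right (abs_nonneg (x - y))] at h2
  exact h1.trans h2

/-- The regret of rounded projected gradient descent in one coordinate. -/
lemma dual_regret_le {lam G : ℕ → ℝ} {T : ℕ} {U η ε₁ K x : ℝ} (hε : 0 < ε₁) (hεU : ε₁ ≤ U)
    (hη : 0 < η) (h0 : lam 0 = 0) (hG : ∀ t < T, |G t| ≤ K)
    (hstep : ∀ t < T, IsRounding (net ε₁ U) (proj U (lam t - η * G t)) (lam (t + 1)))
    (hx : x ∈ Set.Icc 0 U) :
    ∑ t ∈ Finset.range T, (lam t - x) * G t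
      ≤ (U ^ 2 + T * (η ^ 2 * K ^ 2 + 3 * ε₁ * U)) / (2 * η) := by
  have hU : 0 ≤ U := hε.le.trans hεU
  have key : ∀ n ≤ T, 2 * η * ∑ t ∈ Finset.range n, (lam t - x) * G t + (lam n - x) ^ 2
      ≤ U ^ 2 + n * (η ^ 2 * K ^ 2 + 3 * ε₁ * U) := by
    intro n
    induction n with
    | zero =>
      intro _
      simp only [Finset.range_zero, Finset.sum_empty, h0, Nat.cast_zero]
      nlinarith [hx.1, hx.2]
    | succ n ih =>
      intro hn
      have hnT : n < T := hn
      have ih := ih hnT.le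
      set z := proj U (lam n - η * G n) with hz
      have hzU := proj_mem hU (lam n - η * G n)
      have h1 := abs_le.1 (abs_sub_le_of_isRounding hε hzU (hstep n hnT))
      have h2 : (z - x) ^ 2 ≤ (lam n - η * G n - x) ^ 2 := sq_le_sq.2 (abs_proj_sub_le hx)
      have h3 : (G n) ^ 2 ≤ K ^ 2 := by
        rw [← sq_abs]
        exact pow_le_pow_left₀ (abs_nonneg _) (hG n hnT) 2
      have h4 : (lam (n + 1) - x) ^ 2 ≤ (z - x) ^ 2 + 3 * ε₁ * U := by
        have ha : |lam (n + 1) - z| ≤ ε₁ := by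
          rw [abs_sub_comm]
          exact abs_sub_le_of_isRounding hε hzU (hstep n hnT)
        have hb : |z - x| ≤ U := by
          rw [abs_le]
          constructor <;> linarith [hzU.1, hzU.2, hx.1, hx.2]
        have hc : (lam (n + 1) - z) * (z - x) ≤ ε₁ * U := by
          refine (le_abs_self _).trans ?_
          rw [abs_mul]
          exact mul_le_mul ha hb (abs_nonneg _) hε.le
        have hd : (lam (n + 1) - z) ^ 2 ≤ ε₁ * U := by
          rw [← sq_abs]
          nlinarith [abs_nonneg (lam (n + 1) - z)]
        nlinarith
      rw [Finset.sum_range_succ]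
      push_cast
      nlinarith [mul_le_mul_of_nonneg_left h3 (sq_nonneg η)]
  rw [le_div_iff₀ (by positivity)]
  nlinarith [key T le_rfl, sq_nonneg (lam T - x)]

end Dual

/-! ### Primal-dual analysis -/

section Saddle

variable {d T : ℕ} {lam G : ℕ → Fin d → ℝ} {R : ℕ → ℝ} {e : ℝ}

/-- The saddle-point inequality: a comparator with reward `r` and constraint slacks `g ≥ 0` that
does no better than the primal iterates on each Lagrangian bounds the Lagrangian of the averaged
iterates at any dual point `x` against which the dual iterates have small regret. -/
lemma saddle_le {r : ℝ} {g x : Fin d → ℝ} (hlam : ∀ t < T, ∀ j, 0 ≤ lam t j) (hg : ∀ j, 0 ≤ g j)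
    (hopt : ∀ t < T, r + ∑ j, lam t j * g j ≤ R t + ∑ j, lam t j * G t j)
    (hreg : ∑ t ∈ Finset.range T, ∑ j, (lam t j - x j) * G t j ≤ T * e) :
    T * r ≤ ∑ t ∈ Finset.range T, R t + ∑ j, x j * ∑ t ∈ Finset.range T, G t j + T * e := by
  have h1 : ∑ t ∈ Finset.range T, r
      ≤ ∑ t ∈ Finset.range T, (R t + ∑ j, lam t j * G t j) := by
    refine Finset.sum_le_sum fun t ht => ?_
    have ht := Finset.mem_range.1 ht
    have := Finset.sum_nonneg fun j (_ : j ∈ Finset.univ) => mul_nonneg (hlam t ht j) (hg j)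
    linarith [hopt t ht]
  have h2 : ∑ j, x j * ∑ t ∈ Finset.range T, G t j
      = ∑ t ∈ Finset.range T, ∑ j, x j * G t j := by
    simp only [Finset.mul_sum]
    exact Finset.sum_comm
  simp only [sub_mul, Finset.sum_sub_distrib] at hreg
  rw [Finset.sum_const, Finset.card_range, nsmul_eq_mul, Finset.sum_add_distrib] at h1
  rw [h2]
  linarith

/-- The averaged iterates nearly satisfy the constraints.

The comparator is the mixture of the averaged iterates themselves with a Slater point in which the
worst constraint has slack exactly zero, so that no bound on optimal dual variables is needed. -/
lemma neg_le_sum_slack {U σ K rc : ℝ} {gc : Fin d → ℝ} (hT : 0 < T) (hσ : 0 < σ)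
    (hU : U * σ = 2 * K) (hUpos : 0 < U) (hlam : ∀ t < T, ∀ j, 0 ≤ lam t j)
    (hR : ∀ t < T, R t ≤ K) (hrc : 0 ≤ rc) (hgc : ∀ j, σ ≤ gc j)
    (hoptc : ∀ t < T, rc + ∑ j, lam t j * gc j ≤ R t + ∑ j, lam t j * G t j)
    (hopt : ∀ t < T, ∀ u < T, R u + ∑ j, lam t j * G u j ≤ R t + ∑ j, lam t j * G t j)
    (hreg : ∀ x : Fin d → ℝ, (∀ j, x j ∈ Set.Icc 0 U) →
      ∑ t ∈ Finset.range T, ∑ j, (lam t j - x j) * G t j ≤ T * e) (he : 0 ≤ e) (j : Fin d) :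
    -(2 * e / U) ≤ (∑ t ∈ Finset.range T, G t j) / T := by
  classical
  have hT' : (0 : ℝ) < T := by exact_mod_cast hT
  set Gm : Fin d → ℝ := fun j => (∑ t ∈ Finset.range T, G t j) / T with hGm
  set Rm : ℝ := (∑ t ∈ Finset.range T, R t) / T with hRm
  obtain ⟨i, -, hi⟩ := Finset.exists_min_image Finset.univ Gm ⟨j, Finset.mem_univ j⟩
  refine le_trans ?_ (hi j (Finset.mem_univ j))
  set v := -Gm i with hv
  rw [neg_le_iff_add_nonneg]
  by_contra! hneg
  have he0 : 0 ≤ 2 * e / U := by positivity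
  have hvpos : 0 < v := by linarith
  set β := v / (v + σ) with hβ
  have hβ0 : 0 ≤ β := by positivity
  have hβ1 : β ≤ 1 := by rw [hβ, div_le_one (by positivity)]; linarith
  have hβσ : β * σ ≤ v := by
    rw [hβ, div_mul_eq_mul_div, div_le_iff₀ (by positivity)]
    nlinarith
  have hRsum : ∑ t ∈ Finset.range T, R t = T * Rm := by rw [hRm]; field_simp
  have hGsum : ∀ j, ∑ t ∈ Finset.range T, G t j = T * Gm j := fun j => by
    simp only [hGm]; field_simp
  have hRmK : Rm ≤ K := by
    rw [hRm, div_le_iff₀ hT']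
    calc ∑ t ∈ Finset.range T, R t ≤ ∑ t ∈ Finset.range T, K :=
          Finset.sum_le_sum fun t ht => hR t (Finset.mem_range.1 ht)
      _ = K * T := by simp [mul_comm]
  have hmix : ∀ t < T, Rm + ∑ j, lam t j * Gm j ≤ R t + ∑ j, lam t j * G t j := by
    intro t ht
    have h1 : ∑ u ∈ Finset.range T, (R u + ∑ j, lam t j * G u j)
        ≤ ∑ u ∈ Finset.range T, (R t + ∑ j, lam t j * G t j) :=
      Finset.sum_le_sum fun u hu => hopt t ht u (Finset.mem_range.1 hu)
    rw [Finset.sum_const, Finset.card_range, nsmul_eq_mul, Finset.sum_add_distrib, hRsum,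
      Finset.sum_comm] at h1
    simp only [← Finset.mul_sum, hGsum] at h1
    have h2 : ∑ j, lam t j * (T * Gm j) = T * ∑ j, lam t j * Gm j := by
      rw [Finset.mul_sum]
      exact Finset.sum_congr rfl fun j _ => by ring
    rw [h2, ← mul_add] at h1
    exact le_of_mul_le_mul_left h1 hT'
  have h := saddle_le (r := (1 - β) * Rm + β * rc) (g := fun j => (1 - β) * Gm j + β * gc j)
    (x := Pi.single i U) (G := G) (R := R) (e := e) hlam (fun j => ?_) (fun t ht => ?_) (hreg _ ?_)
  · have h1 : ∑ j, (Pi.single i U : Fin d → ℝ) j * ∑ t ∈ Finset.range T, G t j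
        = U * (T * Gm i) := by
      simp [Pi.single_apply, hGsum]
    rw [h1, hRsum] at h
    have h2 : (1 - β) * Rm + β * rc ≤ Rm + U * Gm i + e := by
      refine le_of_mul_le_mul_left (h.trans (le_of_eq ?_)) hT'
      ring
    have h3 : U * v ≤ β * K + e := by
      have : β * Rm ≤ β * K := mul_le_mul_of_nonneg_left hRmK hβ0
      have : 0 ≤ β * rc := by positivity
      have : U * v = -(U * Gm i) := by rw [hv]; ring
      linarith
    have h4 : β * K ≤ U * v / 2 := by
      have : β * K = U * (β * σ) / 2 := by linear_combination (-β / 2) * hU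
      rw [this]
      have := mul_le_mul_of_nonneg_left hβσ hUpos.le
      linarith
    have h5 : v ≤ 2 * e / U := by
      rw [le_div_iff₀ hUpos]
      linarith
    linarith
  · have h1 := hi j (Finset.mem_univ j)
    have h2 : (1 - β) * v = β * σ := by rw [hβ]; field_simp; ring
    have h3 := mul_le_mul_of_nonneg_left h1 (sub_nonneg.2 hβ1)
    have h4 := mul_le_mul_of_nonneg_left (hgc j) hβ0
    have h5 : (1 - β) * Gm i = -((1 - β) * v) := by rw [hv]; ring
    linarith
  · have h1 := mul_le_mul_of_nonneg_left (hmix t ht) (sub_nonneg.2 hβ1)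
    have h2 := mul_le_mul_of_nonneg_left (hoptc t ht) hβ0
    have h3 : ∑ j, lam t j * ((1 - β) * Gm j + β * gc j)
        = (1 - β) * ∑ j, lam t j * Gm j + β * ∑ j, lam t j * gc j := by
      rw [Finset.mul_sum, Finset.mul_sum, ← Finset.sum_add_distrib]
      exact Finset.sum_congr rfl fun j _ => by ring
    rw [h3]
    linarith
  · intro k
    by_cases hk : k = i
    · subst hk; simp [hUpos.le]
    · simp [hk, hUpos.le]

end Saddle

/-! ### Runs of the algorithm -/

section Value

variable {S A : Type*} [Fintype S] [Fintype A] [DecidableEq S] {P : S → A → S → ℝ} {γ : ℝ}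
  (hP : IsSubstochastic P) (hγ : 0 ≤ γ) (hγ1 : γ < 1)

include hP hγ hγ1

lemma value_lagrangian {d : ℕ} (r : S → A → ℝ) (c : Fin d → S → A → ℝ) (x : Fin d → ℝ)
    (π : Policy S A) (ρ : S → ℝ) :
    value P γ (fun s a => r s a + ∑ i, x i * c i s a) π ρ
      = value P γ r π ρ + ∑ i, x i * value P γ (c i) π ρ := by
  have hsum : ∀ (J : Finset (Fin d)) s, stateValue P γ (fun s a => ∑ i ∈ J, x i * c i s a) π s
      = ∑ i ∈ J, x i * stateValue P γ (c i) π s := by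
    intro J s
    induction J using Finset.induction_on with
    | empty => simpa using stateValue_mul hP hγ hγ1 0 (fun _ _ => 0) π s
    | insert i J hi ih =>
      simp only [Finset.sum_insert hi]
      rw [stateValue_add hP hγ hγ1 (fun s a => x i * c i s a), ih, stateValue_mul hP hγ hγ1]
  simp only [value_eq_sum hP hγ hγ1]
  simp only [stateValue_add hP hγ hγ1 r, hsum, mul_add, Finset.sum_add_distrib, Finset.mul_sum]
  congr 1
  rw [Finset.sum_comm]
  exact Finset.sum_congr rfl fun i _ => Finset.sum_congr rfl fun s _ => by ring

lemma value_mono {l l' : S → A → ℝ} (π : Policy S A) {ρ : S → ℝ} (hρ : ∀ s, 0 ≤ ρ s)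
    (h : ∀ s a, l s a ≤ l' s a) : value P γ l π ρ ≤ value P γ l' π ρ := by
  rw [value_eq_sum hP hγ hγ1, value_eq_sum hP hγ hγ1]
  exact Finset.sum_le_sum fun s _ =>
    mul_le_mul_of_nonneg_left (stateValue_mono hP hγ hγ1 π h s) (hρ s)

lemma value_nonneg {l : S → A → ℝ} (π : Policy S A) {ρ : S → ℝ} (hρ : ∀ s, 0 ≤ ρ s)
    (h : ∀ s a, 0 ≤ l s a) : 0 ≤ value P γ l π ρ := by
  rw [value_eq_sum hP hγ hγ1]
  exact Finset.sum_nonneg fun s _ => mul_nonneg (hρ s) (stateValue_nonneg hP hγ hγ1 π h s)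

lemma value_le_const {l : S → A → ℝ} (π : Policy S A) {ρ : S → ℝ} (hρ : ρ ∈ stdSimplex ℝ S)
    {B : ℝ} (hB : 0 ≤ B) (h : ∀ s a, l s a ≤ B) : value P γ l π ρ ≤ B / (1 - γ) := by
  rw [value_eq_sum hP hγ hγ1]
  calc _ ≤ ∑ s, ρ s * (B / (1 - γ)) := Finset.sum_le_sum fun s _ =>
        mul_le_mul_of_nonneg_left (stateValue_le_const hP hγ hγ1 π hB h s) (hρ.1 s)
    _ = _ := by rw [← Finset.sum_mul, hρ.2, one_mul]

lemma abs_value_sub_le {Q : S → A → S → ℝ} (hQ : IsSubstochastic Q) {l : S → A → ℝ}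
    {π : Policy S A} {ρ : S → ℝ} (hρ : ρ ∈ stdSimplex ℝ S) {c : ℝ}
    (h : ∀ s, |stateValue Q γ l π s - stateValue P γ l π s| ≤ c) :
    |value Q γ l π ρ - value P γ l π ρ| ≤ c := by
  rw [value_eq_sum hP hγ hγ1, value_eq_sum hQ hγ hγ1, ← Finset.sum_sub_distrib]
  calc _ ≤ ∑ s, ρ s * c := by
        refine (Finset.abs_sum_le_sum_abs _ _).trans (Finset.sum_le_sum fun s _ => ?_)
        rw [← mul_sub, abs_mul, abs_of_nonneg (hρ.1 s)]
        exact mul_le_mul_of_nonneg_left (h s) (hρ.1 s)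
    _ = c := by rw [← Finset.sum_mul, hρ.2, one_mul]

lemma IsOptimalPolicy.value_le {l : S → A → ℝ} {π : Policy S A} (h : IsOptimalPolicy P γ l π)
    (π' : Policy S A) {ρ : S → ℝ} (hρ : ∀ s, 0 ≤ ρ s) : value P γ l π' ρ ≤ value P γ l π ρ := by
  rw [value_eq_sum hP hγ hγ1, value_eq_sum hP hγ hγ1]
  exact Finset.sum_le_sum fun s _ => mul_le_mul_of_nonneg_left (h s π') (hρ s)

end Value

section Run

variable {S A : Type*} [Fintype S] [Fintype A] [DecidableEq S] {d : ℕ} {γ : ℝ}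

lemma exists_isRun [Nonempty A] (hγ : 0 ≤ γ) (hγ1 : γ < 1) (M : CMDP S A d γ) {N : ℕ}
    (D : Data S A N) (hQ : IsSubstochastic (empirical D)) (b' : Fin d → ℝ) {U ε₁ : ℝ} (η : ℝ)
    (hε : 0 < ε₁) (hU : 0 ≤ U) (T : ℕ) : ∃ lam pol, IsRun M D b' U η ε₁ T lam pol := by
  classical
  choose p hp using fun x : Fin d → ℝ => exists_isOptimalPolicy hQ hγ hγ1
    fun s a => (M.r s a + D.2 (s, a)) + ∑ i, x i * M.c i s a
  choose rd hrd using exists_isRounding hε hU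
  let next : (Fin d → ℝ) → Fin d → ℝ := fun x i =>
    rd (proj U (x i - η * (value (empirical D) γ (M.c i) (detPolicy (p x)) M.ρ - b' i)))
  let lam : ℕ → Fin d → ℝ := fun t => next^[t] 0
  have hlam : ∀ t, lam (t + 1) = next (lam t) := fun t => Function.iterate_succ_apply' next t 0
  refine ⟨lam, fun t => detPolicy (p (lam t)), rfl, fun t _ => hp (lam t), fun t _ i => ?_⟩
  rw [hlam]
  exact hrd _

lemma IsRun.lam_mem_net {M : CMDP S A d γ} {N : ℕ} {D : Data S A N} {b' : Fin d → ℝ}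
    {U η ε₁ : ℝ} {T : ℕ} {lam : ℕ → Fin d → ℝ} {pol : ℕ → Policy S A}
    (h : IsRun M D b' U η ε₁ T lam pol) (hU : 0 ≤ U) {t : ℕ} (ht : t ≤ T) (i : Fin d) :
    lam t i ∈ net ε₁ U := by
  cases t with
  | zero => rw [h.init]; exact zero_mem_net hU
  | succ t => exact (h.dual t ht i).1

/-- A run on an accurate empirical model solves the constrained MDP. The inaccuracy `err` has to be
half of the shift of the constraints, and it is required only for the policies of the run, for a
Slater policy `πc` and for a feasible policy `πo`, the comparator. -/
lemma IsRun.strict {M : CMDP S A d γ} {N : ℕ} {D : Data S A N} {b' : Fin d → ℝ}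
    {ε ζ ω U ε₁ err : ℝ} {T : ℕ} {lam : ℕ → Fin d → ℝ} {pol : ℕ → Policy S A}
    (hγ : 0 ≤ γ) (hγ1 : γ < 1) (hε : 0 < ε) (hεγ : ε * (1 - γ) ≤ 1) (hζ : 0 < ζ)
    (hζγ : ζ * (1 - γ) ≤ 20 / 19)
    (hω : ω = ε * (1 - γ) / 10) (hU : U = 4 * (1 + ω) / (ζ * (1 - γ))) (hT : 0 < T)
    (hε₁ : 0 < ε₁) (hε₁U : ε₁ ≤ U)
    (herr : err = ε * (1 - γ) * ζ / 40) (hb' : ∀ i, b' i = M.b i + ε * (1 - γ) * ζ / 20)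
    (hb'0 : ∀ i, 0 ≤ b' i) (hQ : IsSubstochastic (empirical D))
    (hξ : ∀ j, D.2 j ∈ Set.Icc 0 ω)
    (hrun : IsRun M D b' U (U * (1 - γ) / √(T : ℝ)) ε₁ T lam pol)
    (hopt : d * (U / ((1 - γ) * √(T : ℝ)) + 3 * ε₁ * √(T : ℝ) / (2 * (1 - γ))) ≤ ε / 20)
    {πc πo : Policy S A}
    (hπc : ∀ i, ζ ≤ value M.P γ (M.c i) πc M.ρ - M.b i) (hπo : M.Feasible πo)
    (hclose : ∀ π, (π = πc ∨ π = πo ∨ ∃ t < T, π = pol t) → ∀ l, (l = M.r ∨ ∃ i, l = M.c i) →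
      |value (empirical D) γ l π M.ρ - value M.P γ l π M.ρ| ≤ err) :
    (∀ i, M.b i ≤ mixtureValue M.P γ (M.c i) T pol M.ρ) ∧
      value M.P γ M.r πo M.ρ - ε / 2 ≤ mixtureValue M.P γ M.r T pol M.ρ := by
  have h1γ : 0 < 1 - γ := by linarith
  have hω0 : 0 < ω := by rw [hω]; positivity
  have hUpos : 0 < U := by rw [hU]; positivity
  have hT' : (0 : ℝ) < T := by exact_mod_cast hT
  have hPs := IsSubstochastic.of_mem M.P_mem
  have hρ := M.ρ_mem
  set Q := empirical D with hQdef
  set η := U * (1 - γ) / √(T : ℝ) with hη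
  have hsT : 0 < √(T : ℝ) := Real.sqrt_pos.2 hT'
  have hηpos : 0 < η := by rw [hη]; positivity
  set rp : S → A → ℝ := fun s a => M.r s a + D.2 (s, a) with hrp
  set R : ℕ → ℝ := fun t => value Q γ rp (pol t) M.ρ with hR
  set G : ℕ → Fin d → ℝ := fun t i => value Q γ (M.c i) (pol t) M.ρ - b' i with hG
  have hlamU : ∀ t ≤ T, ∀ i, lam t i ∈ Set.Icc 0 U := fun t ht i =>
    mem_Icc_of_mem_net hε₁ hUpos.le (hrun.lam_mem_net hUpos.le ht i)
  have hrp0 : ∀ s a, M.r s a ≤ rp s a := fun s a => le_add_of_nonneg_right (hξ _).1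
  have hrp1 : ∀ s a, rp s a ≤ 1 + ω := fun s a => add_le_add (M.r_mem s a).2 (hξ _).2
  have hΔ : 0 < ε * (1 - γ) * ζ := by positivity
  have hΔζ : ε * (1 - γ) * ζ ≤ ζ := mul_le_of_le_one_left hζ.le hεγ
  -- the Lagrangian of each primal iterate dominates that of any other policy
  have hlag : ∀ t < T, ∀ π : Policy S A, value Q γ rp π M.ρ
      + ∑ i, lam t i * (value Q γ (M.c i) π M.ρ - b' i) ≤ R t + ∑ i, lam t i * G t i := by
    intro t ht π
    have h := (hrun.primal t ht).value_le hQ hγ hγ1 π hρ.1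
    rw [value_lagrangian hQ hγ hγ1 rp, value_lagrangian hQ hγ hγ1 rp] at h
    simp only [hG, hR, mul_sub, Finset.sum_sub_distrib]
    linarith
  have hGK : ∀ t < T, ∀ i, |G t i| ≤ 1 / (1 - γ) := by
    intro t _ i
    have h1 := value_nonneg hQ hγ hγ1 (pol t) hρ.1 fun s a => (M.c_mem i s a).1
    have h2 := value_le_const hQ hγ hγ1 (pol t) hρ zero_le_one fun s a => (M.c_mem i s a).2
    have h3 := value_le_const hPs hγ hγ1 πc hρ zero_le_one fun s a => (M.c_mem i s a).2
    have h4 := hπc i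
    have h5 := hb' i
    have h6 := hb'0 i
    rw [abs_le]
    constructor <;> simp only [hG] <;> linarith
  set e := d * (U / ((1 - γ) * √(T : ℝ)) + 3 * ε₁ * √(T : ℝ) / (2 * (1 - γ))) with he
  have he0 : 0 ≤ e := by rw [he]; positivity
  have hreg : ∀ x : Fin d → ℝ, (∀ j, x j ∈ Set.Icc 0 U) →
      ∑ t ∈ Finset.range T, ∑ j, (lam t j - x j) * G t j ≤ T * e := by
    intro x hx
    rw [Finset.sum_comm]
    have h1 : ∀ j, ∑ t ∈ Finset.range T, (lam t j - x j) * G t j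
        ≤ T * (U / ((1 - γ) * √(T : ℝ)) + 3 * ε₁ * √(T : ℝ) / (2 * (1 - γ))) := by
      intro j
      refine (dual_regret_le (lam := fun t => lam t j) (G := fun t => G t j) hε₁ hε₁U hηpos
        (by rw [hrun.init]; rfl) (fun t ht => hGK t ht j) (fun t ht => hrun.dual t ht j)
        (hx j)).trans (le_of_eq ?_)
      have hTs : (T : ℝ) = √(T : ℝ) ^ 2 := (Real.sq_sqrt hT'.le).symm
      rw [hη]
      generalize √(T : ℝ) = w at *
      rw [hTs]
      field_simp
      ring
    calc _ ≤ ∑ j : Fin d, T * (U / ((1 - γ) * √(T : ℝ)) + 3 * ε₁ * √(T : ℝ) / (2 * (1 - γ))) :=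
          Finset.sum_le_sum fun j _ => h1 j
      _ = T * e := by
          rw [Finset.sum_const, Finset.card_univ, Fintype.card_fin, nsmul_eq_mul, he]
          ring
  have hgc : ∀ i, ζ / 2 ≤ value Q γ (M.c i) πc M.ρ - b' i := by
    intro i
    have h1 := (abs_le.1 (hclose πc (Or.inl rfl) _ (Or.inr ⟨i, rfl⟩))).1
    have h2 := hπc i
    rw [hb' i]
    linarith
  have hrc : 0 ≤ value Q γ rp πc M.ρ :=
    value_nonneg hQ hγ hγ1 πc hρ.1 fun s a => (M.r_mem s a).1.trans (hrp0 s a)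
  have hUσ : U * (ζ / 2) = 2 * ((1 + ω) / (1 - γ)) := by rw [hU]; field_simp; norm_num
  have hcon := neg_le_sum_slack (lam := lam) (G := G) (R := R) (e := e) hT (half_pos hζ)
    hUσ hUpos (fun t ht j => (hlamU t ht.le j).1)
    (fun t _ => value_le_const hQ hγ hγ1 (pol t) hρ (by linarith) hrp1) hrc hgc
    (fun t ht => hlag t ht πc) (fun t ht u _ => hlag t ht (pol u)) hreg he0
  -- transferring averages of values from the empirical to the true model
  have havg : ∀ l, (l = M.r ∨ ∃ i, l = M.c i) →
      (∑ t ∈ Finset.range T, value Q γ l (pol t) M.ρ) / T - err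
        ≤ mixtureValue M.P γ l T pol M.ρ := by
    intro l hl
    rw [mixtureValue, sub_le_iff_le_add, div_add' _ _ _ hT'.ne']
    refine div_le_div_of_nonneg_right ?_ hT'.le
    have : err * T = ∑ t ∈ Finset.range T, err := by simp [mul_comm]
    rw [this, ← Finset.sum_add_distrib]
    refine Finset.sum_le_sum fun t ht => ?_
    have := (abs_le.1 (hclose (pol t) (Or.inr (Or.inr ⟨t, Finset.mem_range.1 ht, rfl⟩)) l hl)).2
    linarith
  constructor
  · intro i
    have h1 := hcon i
    have h2 := havg _ (Or.inr ⟨i, rfl⟩)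
    have h3 : (∑ t ∈ Finset.range T, G t i) / T
        = (∑ t ∈ Finset.range T, value Q γ (M.c i) (pol t) M.ρ) / T - b' i := by
      simp only [hG, Finset.sum_sub_distrib, Finset.sum_const, Finset.card_range, nsmul_eq_mul]
      field_simp
    have h4 : 2 * e / U ≤ err := by
      rw [div_le_iff₀ hUpos]
      have : err * U = ε * (1 + ω) / 10 := by rw [herr, hU]; field_simp; norm_num
      rw [this]
      nlinarith
    rw [h3, hb' i] at h1
    linarith
  · -- `α` makes up for the shift of the constraints and for the error of the comparator
    set α := 3 * (ε * (1 - γ)) / 40 with hα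
    have hα0 : 0 ≤ α := by rw [hα]; positivity
    have hα1 : α ≤ 1 := by rw [hα]; linarith
    have h := saddle_le (lam := lam) (G := G) (R := R) (e := e) (x := 0)
      (r := (1 - α) * value Q γ rp πo M.ρ + α * value Q γ rp πc M.ρ)
      (g := fun i => (1 - α) * (value Q γ (M.c i) πo M.ρ - b' i)
        + α * (value Q γ (M.c i) πc M.ρ - b' i))
      (fun t ht j => (hlamU t ht.le j).1) (fun i => ?_) (fun t ht => ?_)
      (hreg 0 fun _ => ⟨le_rfl, hUpos.le⟩)
    · simp only [Pi.zero_apply, zero_mul, Finset.sum_const_zero, add_zero] at h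
      have h1 := havg _ (Or.inl rfl)
      have h2 : (∑ t ∈ Finset.range T, R t) / T - ω / (1 - γ)
          ≤ (∑ t ∈ Finset.range T, value Q γ M.r (pol t) M.ρ) / T := by
        rw [sub_le_iff_le_add, div_add' _ _ _ hT'.ne']
        refine div_le_div_of_nonneg_right ?_ hT'.le
        have : ω / (1 - γ) * T = ∑ t ∈ Finset.range T, ω / (1 - γ) := by simp [mul_comm]
        rw [this, ← Finset.sum_add_distrib]
        refine Finset.sum_le_sum fun t _ => ?_
        have h3 := value_lagrangian hQ hγ hγ1 M.r (fun (_ : Fin 1) s a => D.2 (s, a)) 1 (pol t) M.ρ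
        simp only [Pi.one_apply, one_mul, Finset.univ_unique, Finset.sum_singleton] at h3
        have h4 := value_le_const hQ hγ hγ1 (l := fun s a => D.2 (s, a)) (pol t) hρ hω0.le
          fun s a => (hξ (s, a)).2
        simp only [hR, hrp]
        linarith
      have h3 : (1 - α) * value Q γ rp πo M.ρ + α * value Q γ rp πc M.ρ
          ≤ (∑ t ∈ Finset.range T, R t) / T + e := by
        rw [div_add' _ _ _ hT'.ne', le_div_iff₀ hT']
        linarith
      have h4 := value_mono hQ hγ hγ1 πo hρ.1 hrp0
      have h5 := (abs_le.1 (hclose πo (Or.inr (Or.inl rfl)) _ (Or.inl rfl))).1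
      have h6 := value_le_const hQ hγ hγ1 πo hρ zero_le_one fun s a => (M.r_mem s a).2
      have h7 : ω / (1 - γ) = ε / 10 := by rw [hω]; field_simp
      have h8 : α * (1 / (1 - γ)) = 3 * ε / 40 := by rw [hα]; field_simp
      have h9 := mul_le_mul_of_nonneg_left h4 (sub_nonneg.2 hα1)
      have h10 := mul_le_mul_of_nonneg_left h6 hα0
      have h11 : 0 ≤ α * value Q γ rp πc M.ρ := mul_nonneg hα0 hrc
      have h12 : err ≤ ε / 38 := by
        have : err = ε * (ζ * (1 - γ)) / 40 := by rw [herr]; ring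
        rw [this]
        nlinarith
      linarith
    · have h1 := (abs_le.1 (hclose πo (Or.inr (Or.inl rfl)) _ (Or.inr ⟨i, rfl⟩))).1
      have h2 := (abs_le.1 (hclose πc (Or.inl rfl) _ (Or.inr ⟨i, rfl⟩))).1
      have h3 := hπo i
      have h4 := hπc i
      rw [hb' i]
      have h5 : -(3 * (ε * (1 - γ) * ζ) / 40)
          ≤ value Q γ (M.c i) πo M.ρ - (M.b i + ε * (1 - γ) * ζ / 20) := by linarith
      have h6 : ζ - 3 * (ε * (1 - γ) * ζ) / 40
          ≤ value Q γ (M.c i) πc M.ρ - (M.b i + ε * (1 - γ) * ζ / 20) := by linarith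
      have h7 := mul_le_mul_of_nonneg_left h5 (sub_nonneg.2 hα1)
      have h8 := mul_le_mul_of_nonneg_left h6 hα0
      have h9 : α * ζ = 3 * (ε * (1 - γ) * ζ) / 40 := by rw [hα]; ring
      nlinarith
    · have h1 := mul_le_mul_of_nonneg_left (hlag t ht πo) (sub_nonneg.2 hα1)
      have h2 := mul_le_mul_of_nonneg_left (hlag t ht πc) hα0
      have h3 : ∑ i, lam t i * ((1 - α) * (value Q γ (M.c i) πo M.ρ - b' i)
            + α * (value Q γ (M.c i) πc M.ρ - b' i))
          = (1 - α) * ∑ i, lam t i * (value Q γ (M.c i) πo M.ρ - b' i)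
            + α * ∑ i, lam t i * (value Q γ (M.c i) πc M.ρ - b' i) := by
        rw [Finset.mul_sum, Finset.mul_sum, ← Finset.sum_add_distrib]
        exact Finset.sum_congr rfl fun j _ => by ring
      rw [h3]
      linarith

end Run

/-! ### The failure probability -/

section Failure

variable {S A : Type*} [Fintype S] [Fintype A] [DecidableEq S] {d : ℕ} {γ : ℝ}

/-- The objectives of a constrained MDP: the reward, and the constraint rewards. -/
def CMDP.objective (M : CMDP S A d γ) (o : Option (Fin d)) : S → A → ℝ := o.elim M.r M.c

omit [DecidableEq S] in
lemma CMDP.objective_mem (M : CMDP S A d γ) (o : Option (Fin d)) (s : S) (a : A) :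
    M.objective o s a ∈ Set.Icc (0 : ℝ) 1 := by
  cases o
  · exact M.r_mem s a
  · exact M.c_mem _ s a

/-- The row `i` of the empirical model averages the true value functions of the policy `π`, or
their squares, less accurately than Bernstein's inequality at the scale `β` promises. -/
def CMDP.RowBad (M : CMDP S A d γ) {N : ℕ} (β : ℝ) (i : S × A) (x : S × A × Fin N → S)
    (π : Policy S A) : Prop :=
  ∃ o, ¬ BernsteinClose (M.P i.1 i.2) (sampleModel x i.1 i.2)
      (stateValue M.P γ (M.objective o) π) (1 / (1 - γ)) β ∨
    ¬ BernsteinClose (M.P i.1 i.2) (sampleModel x i.1 i.2)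
      (fun s => stateValue M.P γ (M.objective o) π s ^ 2) ((1 / (1 - γ)) ^ 2) β

lemma CMDP.abs_value_sub_le_of_not_rowBad (hγ : 0 ≤ γ) (hγ1 : γ < 1) (M : CMDP S A d γ) {N : ℕ}
    (hN : 0 < N) {β : ℝ} (hβ : 0 < β) (hβγ : β * (1 / (1 - γ)) ≤ 1) {x : S × A × Fin N → S}
    {π : Policy S A} (h : ∀ i, ¬ M.RowBad β i x π) (o : Option (Fin d)) :
    |value (sampleModel x) γ (M.objective o) π M.ρ - value M.P γ (M.objective o) π M.ρ|
      ≤ 12 * (1 / (1 - γ)) * √(β * (1 / (1 - γ))) := by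
  have h1γ : 1 - γ ≠ 0 := by linarith
  have hQ := IsSubstochastic.of_mem (sampleModel_mem hN x)
  simp only [CMDP.RowBad, not_exists, not_or, not_not] at h
  refine abs_value_sub_le (IsSubstochastic.of_mem M.P_mem) hγ hγ1 hQ M.ρ_mem fun s => ?_
  exact abs_stateValue_sub_le M.P_mem hQ hγ hγ1 (M.objective_mem o)
    (one_div_mul_cancel h1γ) hβ hβγ (fun s a => (h (s, a) o).1) (fun s a => (h (s, a) o).2) s

variable [MeasurableSpace S] [MeasurableSingletonClass S]

lemma CMDP.sampleLaw_rowBad_le (hγ : 0 ≤ γ) (hγ1 : γ < 1) (M : CMDP S A d γ) {N : ℕ}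
    (hN : 0 < N) {L : ℝ} (hL : 0 < L) (i : S × A) (π : Policy S A) :
    sampleLaw M.P N {x | M.RowBad (L / N) i x π}
      ≤ ENNReal.ofReal (4 * (d + 1) * Real.exp (-L)) := by
  have h1γ : 0 < 1 - γ := by linarith
  have hPs := IsSubstochastic.of_mem M.P_mem
  have hV : ∀ o s, stateValue M.P γ (M.objective o) π s ∈ Set.Icc 0 (1 / (1 - γ)) := fun o s =>
    ⟨stateValue_nonneg hPs hγ hγ1 π (fun s a => (M.objective_mem o s a).1) s,
      stateValue_le_const hPs hγ hγ1 π zero_le_one (fun s a => (M.objective_mem o s a).2) s⟩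
  have hsub : {x : S × A × Fin N → S | M.RowBad (L / N) i x π} ⊆ ⋃ o,
      ({x | ¬ BernsteinClose (M.P i.1 i.2) (sampleModel x i.1 i.2)
        (stateValue M.P γ (M.objective o) π) (1 / (1 - γ)) (L / N)} ∪
      {x | ¬ BernsteinClose (M.P i.1 i.2) (sampleModel x i.1 i.2)
        (fun s => stateValue M.P γ (M.objective o) π s ^ 2) ((1 / (1 - γ)) ^ 2) (L / N)}) := by
    rintro x ⟨o, ho⟩
    exact Set.mem_iUnion.2 ⟨o, ho⟩
  calc _ ≤ ∑ _ : Option (Fin d), (ENNReal.ofReal (2 * Real.exp (-L))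
          + ENNReal.ofReal (2 * Real.exp (-L))) := by
        refine (measure_mono hsub).trans ((measure_iUnion_fintype_le _ _).trans ?_)
        refine Finset.sum_le_sum fun o _ => (measure_union_le _ _).trans (add_le_add ?_ ?_)
        · exact sampleLaw_not_bernsteinClose_le M.P_mem hN i.1 i.2 (by positivity) hL (hV o)
        · refine sampleLaw_not_bernsteinClose_le M.P_mem hN i.1 i.2 (by positivity) hL fun s => ?_
          exact ⟨sq_nonneg _, pow_le_pow_left₀ (hV o s).1 (hV o s).2 2⟩
    _ = ENNReal.ofReal (4 * (d + 1) * Real.exp (-L)) := by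
        rw [Finset.sum_const, Finset.card_univ, Fintype.card_option, Fintype.card_fin,
          ← ENNReal.ofReal_add (by positivity) (by positivity), nsmul_eq_mul,
          ← ENNReal.ofReal_natCast, ← ENNReal.ofReal_mul (by positivity)]
        congr 1
        push_cast
        ring

omit [DecidableEq S] [MeasurableSingletonClass S] in
lemma isProbabilityMeasure_sampleLaw {P : S → A → S → ℝ} (hP : ∀ s a, P s a ∈ stdSimplex ℝ S)
    (N : ℕ) : IsProbabilityMeasure (sampleLaw P N) := by
  have : ∀ x : S × A × Fin N, IsProbabilityMeasure (nextStateLaw P x.1 x.2.1) :=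
    fun x => isProbabilityMeasure_nextStateLaw (hP _ _)
  exact inferInstanceAs (IsProbabilityMeasure (Measure.pi _))

omit [MeasurableSingletonClass S] [DecidableEq S] in
lemma dataLaw_eq (P : S → A → S → ℝ) (N : ℕ) (ω : ℝ) :
    dataLaw P N ω = (sampleLaw P N).prod (Measure.pi fun _ : S × A => uniform 0 ω) := rfl

omit [DecidableEq S] [MeasurableSingletonClass S] in
lemma isProbabilityMeasure_dataLaw {P : S → A → S → ℝ} (hP : ∀ s a, P s a ∈ stdSimplex ℝ S)
    (N : ℕ) {ω : ℝ} (hω : 0 < ω) : IsProbabilityMeasure (dataLaw P N ω) := by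
  have := isProbabilityMeasure_sampleLaw hP N
  have := isProbabilityMeasure_uniform hω
  rw [dataLaw_eq]
  infer_instance

omit [DecidableEq S] [MeasurableSingletonClass S] in
/-- A property of the perturbations that holds almost surely for each fixed sample holds almost
surely for the data. -/
lemma dataLaw_not_eq_zero {P : S → A → S → ℝ} (hP : ∀ s a, P s a ∈ stdSimplex ℝ S) {N : ℕ} {ω : ℝ}
    (hω : 0 < ω) {p : (S × A × Fin N → S) → (S × A → ℝ) → Prop}
    (h : ∀ x, ∀ᵐ ξ ∂Measure.pi fun _ : S × A => uniform 0 ω, p x ξ) :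
    dataLaw P N ω {D | ¬ p D.1 D.2} = 0 := by
  classical
  have := isProbabilityMeasure_sampleLaw hP N
  have := isProbabilityMeasure_uniform hω
  refine measure_mono_null (t := ⋃ x, {x} ×ˢ {ξ | ¬ p x ξ}) (fun D hD =>
    Set.mem_iUnion.2 ⟨D.1, rfl, hD⟩) (measure_iUnion_null fun x => ?_)
  rw [dataLaw_eq, Measure.prod_prod, ae_iff.1 (h x), mul_zero]

/-- The probability that some run fails is at most a union bound over the rows and over the dual
iterates that a run can visit. -/
lemma dataLaw_failure_le [Nonempty A] {M : CMDP S A d γ} {N T : ℕ} {b' : Fin d → ℝ}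
    {ε ζ ω U ε₁ L : ℝ} (hγ : 0 ≤ γ) (hγ1 : γ < 1) (hε : 0 < ε) (hεγ : ε * (1 - γ) ≤ 1)
    (hζ : 0 < ζ) (hζγ : ζ * (1 - γ) ≤ 20 / 19)
    (hω : ω = ε * (1 - γ) / 10) (hU : U = 4 * (1 + ω) / (ζ * (1 - γ))) (hT : 0 < T) (hN : 0 < N)
    (hε₁ : 0 < ε₁) (hε₁U : ε₁ ≤ U) (hb' : ∀ i, b' i = M.b i + ε * (1 - γ) * ζ / 20)
    (hb'0 : ∀ i, 0 ≤ b' i)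
    (hopt : d * (U / ((1 - γ) * √(T : ℝ)) + 3 * ε₁ * √(T : ℝ) / (2 * (1 - γ))) ≤ ε / 20)
    (hL : 0 < L) (hβ : L / N * (1 / (1 - γ)) ≤ 1)
    (herr : 12 * (1 / (1 - γ)) * √(L / N * (1 / (1 - γ))) ≤ ε * (1 - γ) * ζ / 40)
    {πc πo : Policy S A}
    (hπc : ∀ i, ζ ≤ value M.P γ (M.c i) πc M.ρ - M.b i) (hπo : M.Feasible πo)
    (hπo_max : ∀ π, M.Feasible π → value M.P γ M.r π M.ρ ≤ value M.P γ M.r πo M.ρ + ε / 2) :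
    dataLaw M.P N ω
      {D | ¬ ((∃ lam pol, IsRun M D b' U (U * (1 - γ) / √(T : ℝ)) ε₁ T lam pol) ∧
        ∀ lam pol, IsRun M D b' U (U * (1 - γ) / √(T : ℝ)) ε₁ T lam pol →
          M.StrictlySolvedBy ε T pol)}
      ≤ ENNReal.ofReal (((U / ε₁ + 2) ^ d * (2 * ((1 + d * U + ω) / (1 - γ)) / (ω * (1 - γ))) + 2)
          * (Fintype.card S * Fintype.card A) * (4 * (d + 1) * Real.exp (-L))) := by
  classical
  have h1γ : 0 < 1 - γ := by linarith
  have hω0 : 0 < ω := by rw [hω]; positivity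
  have hU0 : 0 < U := by rw [hU]; positivity
  have hprobS := isProbabilityMeasure_sampleLaw M.P_mem N
  have hprobU := isProbabilityMeasure_uniform hω0
  set β := L / N with hβdef
  have hβ0 : 0 < β := by positivity
  set q := ENNReal.ofReal (4 * (d + 1) * Real.exp (-L)) with hq
  set K : ℝ := 2 * ((1 + d * U + ω) / (1 - γ)) / (ω * (1 - γ)) with hK
  have hK0 : 0 ≤ K := by rw [hK]; positivity
  set W : Finset (Fin d → ℝ) := Fintype.piFinset fun _ => netFinset ε₁ U with hW
  set lag : (Fin d → ℝ) → S → A → ℝ := fun y s a => M.r s a + ∑ i, y i * M.c i s a with hlag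
  have hsm : ∀ x : S × A × Fin N → S, IsSubstochastic (sampleModel x) :=
    fun x => IsSubstochastic.of_mem (sampleModel_mem hN x)
  have hWmem : ∀ y, y ∈ W ↔ ∀ i, y i ∈ net ε₁ U := fun y => by
    rw [hW, Fintype.mem_piFinset]
    simp only [← coe_netFinset hε₁ hU0.le, Finset.mem_coe]
  have hlagB : ∀ y ∈ W, ∀ s a, |lag y s a| ≤ 1 + d * U := by
    intro y hy s a
    have hy' := fun i => mem_Icc_of_mem_net hε₁ hU0.le ((hWmem y).1 hy i)
    have h0 : 0 ≤ ∑ i, y i * M.c i s a :=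
      Finset.sum_nonneg fun i _ => mul_nonneg (hy' i).1 (M.c_mem i s a).1
    have h1 : ∑ i, y i * M.c i s a ≤ d * U := by
      calc _ ≤ ∑ _ : Fin d, U := Finset.sum_le_sum fun i _ =>
            (mul_le_of_le_one_right (hy' i).1 (M.c_mem i s a).2).trans (hy' i).2
        _ = d * U := by simp
    rw [abs_of_nonneg (add_nonneg (M.r_mem s a).1 h0)]
    exact add_le_add (M.r_mem s a).2 h1
  -- the exceptional events
  set B₁ : Set (Data S A N) := {D | ¬ ∀ j, D.2 j ∈ Set.Icc 0 ω} with hB₁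
  set B₂ : Set (Data S A N) := {D | ¬ ∀ y ∈ W, ∀ p p' : S → A,
    IsOptimalPolicy (sampleModel D.1) γ (perturb (lag y) D.2) (detPolicy p) →
    IsOptimalPolicy (sampleModel D.1) γ (perturb (lag y) D.2) (detPolicy p') → p = p'} with hB₂
  set B₃ : (Fin d → ℝ) → S × A → Set (Data S A N) := fun y i => {D | (∀ j, D.2 j ∈ Set.Icc 0 ω) ∧
    ∃ p ∈ {p : S → A | M.RowBad β i D.1 (detPolicy p)},
      IsOptimalPolicy (sampleModel D.1) γ (perturb (lag y) D.2) (detPolicy p)} with hB₃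
  set B₄ : Policy S A → S × A → Set (Data S A N) := fun π i => {D | M.RowBad β i D.1 π} with hB₄
  have hB₁0 : dataLaw M.P N ω B₁ = 0 := by
    refine dataLaw_not_eq_zero M.P_mem hω0 (p := fun _ ξ => ∀ j, ξ j ∈ Set.Icc 0 ω) fun _ => ?_
    refine ae_all_iff.2 fun j => ?_
    have h1 : ∀ᵐ τ ∂uniform 0 ω, τ ∈ Set.Icc 0 ω :=
      ProbabilityTheory.ae_cond_mem measurableSet_Icc
    exact (Measure.tendsto_eval_ae_ae (μ := fun _ : S × A => uniform 0 ω) (i := j)).eventually h1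
  have hB₂0 : dataLaw M.P N ω B₂ = 0 := by
    refine dataLaw_not_eq_zero M.P_mem hω0 (p := fun x ξ => ∀ y ∈ W, ∀ p p' : S → A,
      IsOptimalPolicy (sampleModel x) γ (perturb (lag y) ξ) (detPolicy p) →
      IsOptimalPolicy (sampleModel x) γ (perturb (lag y) ξ) (detPolicy p') → p = p') fun x => ?_
    exact (Filter.eventually_all_finset W).2 fun y _ =>
      ae_unique_optimal (hsm x) hγ hγ1 (fun _ => uniform 0 ω) (lag y)
  have hB₃q : ∀ y ∈ W, ∀ i, dataLaw M.P N ω (B₃ y i) ≤ ENNReal.ofReal K * q := by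
    intro y hy i
    refine measure_optimal_bad_le M.P_mem hN hγ hγ1 (B := 1 + d * U) (by positivity) (hlagB y hy)
      hω0 rfl i (fun x p => M.RowBad β i x (detPolicy p)) (fun x y p hxy hx => ?_)
      fun p => M.sampleLaw_rowBad_le hγ hγ1 hN hL i (detPolicy p)
    have : sampleModel x i.1 i.2 = sampleModel y i.1 i.2 := by
      funext s'
      simp only [sampleModel, empirical, hxy]
    simpa only [CMDP.RowBad, this] using hx
  have hB₄q : ∀ π i, dataLaw M.P N ω (B₄ π i) ≤ q := by
    intro π i
    have h1 : B₄ π i = {x | M.RowBad β i x π} ×ˢ Set.univ := by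
      ext D; simp [hB₄]
    rw [h1, dataLaw_eq, Measure.prod_prod, measure_univ, mul_one]
    exact M.sampleLaw_rowBad_le hγ hγ1 hN hL i π
  -- outside of them every run succeeds
  have hsub : {D | ¬ ((∃ lam pol, IsRun M D b' U (U * (1 - γ) / √(T : ℝ)) ε₁ T lam pol) ∧
      ∀ lam pol, IsRun M D b' U (U * (1 - γ) / √(T : ℝ)) ε₁ T lam pol →
        M.StrictlySolvedBy ε T pol)}
      ⊆ B₁ ∪ B₂ ∪ (⋃ y ∈ W, ⋃ i, B₃ y i) ∪ ((⋃ i, B₄ πc i) ∪ ⋃ i, B₄ πo i) := by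
    intro D hD
    by_contra hgood
    simp only [Set.mem_union, not_or, Set.mem_iUnion, not_exists] at hgood
    obtain ⟨⟨⟨g1, g2⟩, g3⟩, g4, g5⟩ := hgood
    rw [hB₁, Set.mem_ofPred_eq, not_not] at g1
    rw [hB₂, Set.mem_ofPred_eq, not_not] at g2
    refine hD ⟨exists_isRun hγ hγ1 M D (hsm D.1) b' _ hε₁ hU0.le T, fun lam pol hrun => ?_⟩
    have hpol : ∀ t < T, ∀ i, ¬ M.RowBad β i D.1 (pol t) := by
      intro t ht i hbad
      have hy : lam t ∈ W := (hWmem _).2 fun j => hrun.lam_mem_net hU0.le ht.le j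
      have ho : IsOptimalPolicy (sampleModel D.1) γ (perturb (lag (lam t)) D.2) (pol t) := by
        have h1 := hrun.primal t ht
        have h2 : (fun s a => (M.r s a + D.2 (s, a)) + ∑ i, lam t i * M.c i s a)
            = perturb (lag (lam t)) D.2 := by
          funext s a
          simp only [perturb, hlag]
          ring
        rw [h2] at h1
        exact h1
      obtain ⟨p, hp, hpo⟩ := eq_detPolicy_of_unique (hsm D.1) hγ hγ1 (g2 _ hy) ho
      rw [hp] at hbad
      exact g3 _ hy i ⟨g1, p, hbad, hpo⟩
    have hQD : IsSubstochastic (empirical D) := hsm D.1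
    have hres := hrun.strict hγ hγ1 hε hεγ hζ hζγ hω hU hT hε₁ hε₁U rfl hb' hb'0 hQD g1 hopt
      hπc hπo (fun π hπ l hl => ?_)
    · exact ⟨hres.1, fun π hπ => by linarith [hres.2, hπo_max π hπ]⟩
    · have hnb : ∀ i, ¬ M.RowBad β i D.1 π := by
        rcases hπ with rfl | rfl | ⟨t, ht, rfl⟩
        · exact g4
        · exact g5
        · exact hpol t ht
      have hc := fun o => (M.abs_value_sub_le_of_not_rowBad hγ hγ1 hN hβ0 hβ hnb o).trans herr
      rcases hl with rfl | ⟨i, rfl⟩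
      · exact hc none
      · exact hc (some i)
  have hcardW : (W.card : ℝ) ≤ (U / ε₁ + 2) ^ d := by
    rw [hW, Fintype.card_piFinset, Finset.prod_const, Finset.card_univ, Fintype.card_fin]
    push_cast
    exact pow_le_pow_left₀ (Nat.cast_nonneg _) (card_netFinset_le hε₁ hU0.le) d
  have hrows : ∀ (B : S × A → Set (Data S A N)) (c : ENNReal),
      (∀ i, dataLaw M.P N ω (B i) ≤ c) →
      dataLaw M.P N ω (⋃ i, B i) ≤ (Fintype.card (S × A) : ENNReal) * c := by
    intro B c h
    refine (measure_iUnion_fintype_le _ _).trans ((Finset.sum_le_sum fun i _ => h i).trans ?_)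
    rw [Finset.sum_const, Finset.card_univ, nsmul_eq_mul]
  have hnSA : (Fintype.card (S × A) : ENNReal)
      = ENNReal.ofReal (Fintype.card S * Fintype.card A) := by
    rw [Fintype.card_prod, ← ENNReal.ofReal_natCast]
    push_cast
    rfl
  have hbig : dataLaw M.P N ω (⋃ y ∈ W, ⋃ i, B₃ y i)
      ≤ (W.card : ENNReal) * ((Fintype.card (S × A) : ENNReal) * (ENNReal.ofReal K * q)) := by
    refine (measure_biUnion_finset_le W _).trans
      ((Finset.sum_le_sum fun y hy => hrows _ _ (hB₃q y hy)).trans ?_)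
    rw [Finset.sum_const, nsmul_eq_mul]
  calc _ ≤ 0 + 0 + (W.card : ENNReal) * ((Fintype.card (S × A) : ENNReal) * (ENNReal.ofReal K * q))
        + ((Fintype.card (S × A) : ENNReal) * q + (Fintype.card (S × A) : ENNReal) * q) := by
        refine (measure_mono hsub).trans ((measure_union_le _ _).trans (add_le_add
          ((measure_union_le _ _).trans (add_le_add ((measure_union_le _ _).trans ?_) hbig))
          ((measure_union_le _ _).trans (add_le_add (hrows _ _ (hB₄q πc)) (hrows _ _ (hB₄q πo))))))
        rw [hB₁0, hB₂0]
    _ = ENNReal.ofReal ((W.card * K + 2) * (Fintype.card S * Fintype.card A)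
          * (4 * (d + 1) * Real.exp (-L))) := by
        rw [hnSA, hq, ← ENNReal.ofReal_natCast W.card, zero_add, zero_add,
          ← ENNReal.ofReal_mul hK0, ← ENNReal.ofReal_mul (by positivity),
          ← ENNReal.ofReal_mul (by positivity), ← ENNReal.ofReal_mul (by positivity),
          ← ENNReal.ofReal_add (by positivity) (by positivity),
          ← ENNReal.ofReal_add (by positivity) (by positivity)]
        congr 1
        ring
    _ ≤ _ := by
        refine ENNReal.ofReal_le_ofReal ?_
        gcongr

end Failure

/-! ### The choice of the parameters -/

section Budget

/-- The number of iterations and the resolution of the net keep the regret below `ε / 20`. -/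
lemma regret_budget {d : ℕ} {g ε ζ ω U ε₁ : ℝ} {T : ℕ} (hd : 1 ≤ d) (hg : 0 < g) (hg1 : g ≤ 1)
    (hε : 0 < ε) (hεg : ε * g ≤ 1) (hζ : 0 < ζ) (hζg : ζ * g ≤ 20 / 19) (hω : ω = ε * g / 10)
    (hU : U = 4 * (1 + ω) / (ζ * g))
    (hT : T = ⌊(10 : ℝ) ^ 8 * ((d : ℝ) ^ 4 / (g ^ 6 * ε ^ 2 * ζ ^ 2))⌋₊)
    (hε₁ : ε₁ = 1 / 10 ^ 6 * (ε ^ 2 * g ^ 5 * ζ ^ 2 / (d : ℝ) ^ 3)) :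
    0 < T ∧ ε₁ ≤ U ∧
      d * (U / (g * √(T : ℝ)) + 3 * ε₁ * √(T : ℝ) / (2 * g)) ≤ ε / 20 := by
  have hd' : (1 : ℝ) ≤ d := by exact_mod_cast hd
  have hd0 : (0 : ℝ) < d := by linarith
  have hω1 : ω ≤ 1 / 10 := by rw [hω]; linarith
  have hω0 : 0 < ω := by rw [hω]; positivity
  set w : ℝ := (d : ℝ) ^ 2 / (g ^ 3 * ε * ζ) with hw
  have hw0 : 0 < w := by positivity
  have hx : (d : ℝ) ^ 4 / (g ^ 6 * ε ^ 2 * ζ ^ 2) = w ^ 2 := by rw [hw]; field_simp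
  have hden : g ^ 3 * ε * ζ ≤ 20 / 19 := by
    have h1 : (ε * g) * (ζ * g) ≤ 1 * (20 / 19) := mul_le_mul hεg hζg (by positivity) zero_le_one
    calc g ^ 3 * ε * ζ = g * ((ε * g) * (ζ * g)) := by ring
      _ ≤ 1 * (1 * (20 / 19)) := mul_le_mul hg1 h1 (by positivity) zero_le_one
      _ = 20 / 19 := by norm_num
  have hw1 : 19 / 20 ≤ w := by
    rw [hw, le_div_iff₀ (by positivity)]
    nlinarith
  rw [hx] at hT
  have hTle : (T : ℝ) ≤ (10 ^ 4 * w) ^ 2 := by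
    rw [hT]
    exact (Nat.floor_le (by positivity)).trans (by ring_nf; rfl)
  have hTge : (9000 * w) ^ 2 ≤ (T : ℝ) := by
    have := Nat.lt_floor_add_one ((10 : ℝ) ^ 8 * w ^ 2)
    rw [← hT] at this
    nlinarith
  have hTpos : (0 : ℝ) < T := lt_of_lt_of_le (by positivity) hTge
  have hs1 : √(T : ℝ) ≤ 10 ^ 4 * w := (Real.sqrt_le_left (by positivity)).2 hTle
  have hs2 : 9000 * w ≤ √(T : ℝ) := Real.le_sqrt_of_sq_le hTge
  refine ⟨by exact_mod_cast hTpos, ?_, ?_⟩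
  · have h1 : ε₁ * (ζ * g) ≤ 4 * (1 + ω) := by
      have h2 : ε₁ * (ζ * g) = 1 / 10 ^ 6 * ((ε * g) ^ 2 * (ζ * g) ^ 3 * g / (d : ℝ) ^ 3) := by
        rw [hε₁]; ring
      have h3 : (ε * g) ^ 2 * (ζ * g) ^ 3 * g / (d : ℝ) ^ 3 ≤ 1 ^ 2 * (20 / 19) ^ 3 * 1 / 1 ^ 3 := by
        gcongr
      rw [h2]
      norm_num at h3
      linarith
    rw [hU, le_div_iff₀ (by positivity)]
    exact h1
  · have h1 : d * (U / (g * √(T : ℝ))) ≤ ε / 40 := by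
      rw [← mul_div_assoc, div_le_iff₀ (by positivity)]
      have h2 : ε / 40 * (g * (9000 * w)) ≤ ε / 40 * (g * √(T : ℝ)) := by gcongr
      refine le_trans ?_ h2
      have h3 : ε / 40 * (g * (9000 * w)) = d * (225 * d / (g * (ζ * g))) := by
        rw [hw]; field_simp; norm_num
      rw [h3, hU]
      refine mul_le_mul_of_nonneg_left ?_ hd0.le
      rw [div_le_div_iff₀ (by positivity) (by positivity)]
      have h4 : 4 * (1 + ω) * g ≤ 225 * d := by nlinarith
      calc 4 * (1 + ω) * (g * (ζ * g)) = (4 * (1 + ω) * g) * (ζ * g) := by ring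
        _ ≤ 225 * d * (ζ * g) := by gcongr
    have h2 : d * (3 * ε₁ * √(T : ℝ) / (2 * g)) ≤ ε / 40 := by
      calc d * (3 * ε₁ * √(T : ℝ) / (2 * g)) ≤ d * (3 * ε₁ * (10 ^ 4 * w) / (2 * g)) := by
            have : 0 ≤ ε₁ := by rw [hε₁]; positivity
            gcongr
        _ = 3 / 200 * ε * (ζ * g) := by rw [hε₁, hw]; field_simp; norm_num
        _ ≤ ε / 40 := by nlinarith
    rw [mul_add]
    linarith

/-- The number of samples keeps the error of evaluating a policy below half of the shift of the
constraints. -/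
lemma evaluation_budget {d N : ℕ} {g ε ζ ℓ x : ℝ} (hd : 1 ≤ d) (hg : 0 < g)
    (hε : 0 < ε) (hεg : ε * g ≤ 1) (hζ : 0 < ζ) (hζg : ζ * g ≤ 20 / 19) (hℓ : 0 < ℓ) (hx : 0 < x)
    (hN : (10 : ℝ) ^ 8 * ((d : ℝ) ^ 3 * ℓ / (g ^ 5 * ε ^ 2 * ζ ^ 2) * x) ≤ N) :
    38 * d * ℓ * x / N * (1 / g) ≤ 1 ∧
      12 * (1 / g) * √(38 * d * ℓ * x / N * (1 / g)) ≤ ε * g * ζ / 40 := by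
  have hd' : (1 : ℝ) ≤ d := by exact_mod_cast hd
  have hd0 : (0 : ℝ) < d := by linarith
  have hN0 : (0 : ℝ) < N := lt_of_lt_of_le (by positivity) hN
  have hz : g ^ 2 * ε * ζ ≤ 20 / 19 := by
    calc g ^ 2 * ε * ζ = (ε * g) * (ζ * g) := by ring
      _ ≤ 1 * (20 / 19) := mul_le_mul hεg hζg (by positivity) zero_le_one
      _ = 20 / 19 := one_mul _
  have hkey : 38 * d * ℓ * x / N * (1 / g) ≤ (1 / 10 ^ 3 * (g ^ 2 * ε * ζ)) ^ 2 := by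
    rw [div_mul_div_comm, mul_one, div_le_iff₀ (by positivity)]
    calc 38 * d * ℓ * x ≤ 100 * (d : ℝ) ^ 3 * ℓ * x := by
          have : (d : ℝ) ≤ (d : ℝ) ^ 3 := le_self_pow₀ hd' (by norm_num)
          gcongr
          norm_num
      _ = (1 / 10 ^ 3 * (g ^ 2 * ε * ζ)) ^ 2 *
          ((10 : ℝ) ^ 8 * ((d : ℝ) ^ 3 * ℓ / (g ^ 5 * ε ^ 2 * ζ ^ 2) * x) * g) := by
          field_simp; norm_num
      _ ≤ _ := by gcongr
  constructor
  · refine hkey.trans ?_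
    have : (1 / 10 ^ 3 * (g ^ 2 * ε * ζ)) ^ 2 ≤ (1 / 10 ^ 3 * (20 / 19)) ^ 2 := by gcongr
    exact this.trans (by norm_num)
  · have h1 : √(38 * d * ℓ * x / N * (1 / g)) ≤ 1 / 10 ^ 3 * (g ^ 2 * ε * ζ) :=
      (Real.sqrt_le_left (by positivity)).2 hkey
    calc _ ≤ 12 * (1 / g) * (1 / 10 ^ 3 * (g ^ 2 * ε * ζ)) := by gcongr
      _ = 12 / 10 ^ 3 * (ε * g * ζ) := by field_simp
      _ ≤ ε * g * ζ / 40 := by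
          have : 0 < ε * g * ζ := by positivity
          linarith

/-- The union bound in the failure probability is absorbed by the logarithmic factor of the number
of samples: the number of events is at most `X ^ (37 d)` for the sum `X` of the parameters. -/
lemma failure_budget {d nS nA : ℕ} {g ε ζ δ ω U ε₁ X : ℝ} (hd : 1 ≤ d) (hg : 0 < g)
    (hε : 0 < ε) (hεg : ε * g ≤ 1) (hζ : 0 < ζ) (hδ : 0 < δ) (hδ1 : δ < 1 / 4)
    (hω : ω = ε * g / 10) (hU : U = 4 * (1 + ω) / (ζ * g))
    (hε₁ : ε₁ = 1 / 10 ^ 6 * (ε ^ 2 * g ^ 5 * ζ ^ 2 / (d : ℝ) ^ 3))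
    (hX7 : 7 ≤ X) (hSX : (nS : ℝ) ≤ X) (hAX : (nA : ℝ) ≤ X) (hdX : (d : ℝ) + 1 ≤ X)
    (hgX : 1 / g ≤ X) (hεX : 1 / ε ≤ X) (hζX : 1 / ζ ≤ X) :
    ((U / ε₁ + 2) ^ d * (2 * ((1 + d * U + ω) / g) / (ω * g)) + 2) * (nS * nA)
      * (4 * (d + 1) * Real.exp (-(38 * d * Real.log (1 / δ) * Real.log X))) ≤ 4 * δ := by
  have hd' : (1 : ℝ) ≤ d := by exact_mod_cast hd
  have hX0 : 0 < X := by linarith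
  have hω1 : ω ≤ 1 / 10 := by rw [hω]; linarith
  have hω0 : 0 < ω := by rw [hω]; positivity
  have hdX' : (d : ℝ) ≤ X := by linarith
  have hU0 : 0 < U := by rw [hU]; positivity
  have hε₁0 : 0 < ε₁ := by rw [hε₁]; positivity
  have hUX : U ≤ 5 * X ^ 2 := by
    calc U = 4 * (1 + ω) * ((1 / ζ) * (1 / g)) := by rw [hU]; field_simp
      _ ≤ 4 * (1 + 1 / 10) * (X * X) := by gcongr
      _ ≤ 5 * X ^ 2 := by nlinarith
  have hpow : ∀ n : ℕ, (7 : ℝ) ^ n ≤ X ^ n := fun n => pow_le_pow_left₀ (by norm_num) hX7 n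
  have hnet : U / ε₁ + 2 ≤ X ^ 23 := by
    have h1 : U / ε₁ ≤ 7 ^ 8 * X ^ 14 := by
      calc U / ε₁ = U * (10 ^ 6 * ((d : ℝ) ^ 3 * (1 / ε) ^ 2 * (1 / g) ^ 5 * (1 / ζ) ^ 2)) := by
            rw [hε₁]; field_simp
        _ ≤ (5 * X ^ 2) * (10 ^ 6 * (X ^ 3 * X ^ 2 * X ^ 5 * X ^ 2)) := by gcongr
        _ = 5 * 10 ^ 6 * X ^ 14 := by ring
        _ ≤ 7 ^ 8 * X ^ 14 := by gcongr; norm_num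
    have h2 : (7 : ℝ) ^ 8 * X ^ 14 ≤ X ^ 22 := by
      calc (7 : ℝ) ^ 8 * X ^ 14 ≤ X ^ 8 * X ^ 14 := by gcongr
        _ = X ^ 22 := by ring
    have h3 : 7 * X ^ 22 ≤ X ^ 23 := by
      calc 7 * X ^ 22 ≤ X * X ^ 22 := by gcongr
        _ = X ^ 23 := by ring
    have h4 : 1 ≤ X ^ 22 := one_le_pow₀ (by linarith)
    linarith
  have hK : 2 * ((1 + d * U + ω) / g) / (ω * g) ≤ X ^ 10 := by
    have h1 : 1 + d * U + ω ≤ 6 * X ^ 3 := by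
      have h2 : d * U ≤ X * (5 * X ^ 2) := by gcongr
      have h3 : 2 ≤ X ^ 3 := by linarith [hpow 3]
      linarith
    calc 2 * ((1 + d * U + ω) / g) / (ω * g)
        = 2 * (1 + d * U + ω) * (10 * ((1 / ε) * (1 / g) ^ 3)) := by rw [hω]; field_simp
      _ ≤ 2 * (6 * X ^ 3) * (10 * (X * X ^ 3)) := by gcongr
      _ = 120 * X ^ 7 := by ring
      _ ≤ 7 ^ 3 * X ^ 7 := by gcongr; norm_num
      _ ≤ X ^ 3 * X ^ 7 := by gcongr
      _ = X ^ 10 := by ring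
  have hK0 : 0 ≤ 2 * ((1 + d * U + ω) / g) / (ω * g) := by positivity
  have hcount : (U / ε₁ + 2) ^ d * (2 * ((1 + d * U + ω) / g) / (ω * g)) + 2
      ≤ X ^ (23 * d + 11) := by
    have h1 : (U / ε₁ + 2) ^ d * (2 * ((1 + d * U + ω) / g) / (ω * g))
        ≤ (X ^ 23) ^ d * X ^ 10 := by gcongr
    have h2 : (X ^ 23) ^ d * X ^ 10 = X ^ (23 * d + 10) := by rw [← pow_mul, ← pow_add]
    have h3 : 1 ≤ X ^ (23 * d + 10) := one_le_pow₀ (by linarith)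
    have h4 : X ^ (23 * d + 11) = X * X ^ (23 * d + 10) := by ring
    rw [h4]
    nlinarith
  set ℓ := Real.log (1 / δ) with hℓ
  set x := Real.log X with hx
  have hexp1 : Real.exp 1 < 3 := by linarith [Real.exp_one_lt_d9]
  have hℓ1 : 1 ≤ ℓ := by
    rw [hℓ, Real.le_log_iff_exp_le (by positivity)]
    have : 4 < 1 / δ := by rw [lt_div_iff₀ hδ]; linarith
    linarith
  have hx1 : 1 ≤ x := by
    rw [hx, Real.le_log_iff_exp_le hX0]
    linarith
  have hfinal : X ^ (37 * d) * Real.exp (-(38 * d * ℓ * x)) ≤ δ := by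
    have h1 : X ^ (37 * d) = Real.exp (37 * d * x) := by
      rw [hx, ← Real.exp_log hX0, ← Real.exp_nat_mul, Real.log_exp]
      push_cast
      rfl
    have h2 : δ = Real.exp (-ℓ) := by
      rw [hℓ, one_div, Real.log_inv, neg_neg, Real.exp_log hδ]
    rw [h1, ← Real.exp_add]
    refine (Real.exp_le_exp.2 ?_).trans h2.ge
    have h3 : 37 * d * x ≤ 37 * d * x * ℓ := le_mul_of_one_le_right (by positivity) hℓ1
    have h4 : ℓ ≤ d * x * ℓ :=
      le_mul_of_one_le_left (by linarith) (one_le_mul_of_one_le_of_one_le hd' hx1)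
    linarith
  calc _ ≤ X ^ (23 * d + 11) * (X * X) * (4 * X * Real.exp (-(38 * d * ℓ * x))) := by gcongr
    _ = 4 * (X ^ (23 * d + 14) * Real.exp (-(38 * d * ℓ * x))) := by ring
    _ ≤ 4 * (X ^ (37 * d) * Real.exp (-(38 * d * ℓ * x))) := by
        have : X ^ (23 * d + 14) ≤ X ^ (37 * d) := pow_le_pow_right₀ (by linarith) (by omega)
        gcongr
    _ ≤ 4 * δ := by linarith

end Budget

/-! ### Policies for comparison -/

section Feasibility

variable {S A : Type*} [Fintype S] [Fintype A] [DecidableEq S] {d : ℕ} {γ : ℝ}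

omit [DecidableEq S] in
omit [DecidableEq S] in
/-- A policy that attains the Slater constant satisfies every constraint with that slack. -/
lemma CMDP.exists_slater {M : CMDP S A d γ} {ζ : ℝ} (h : M.IsSlaterConstant ζ) :
    ∃ π, M.Feasible π ∧ ∀ i, ζ ≤ value M.P γ (M.c i) π M.ρ - M.b i := by
  obtain ⟨π, hπ, rfl⟩ := h.1
  exact ⟨π, hπ, fun i => ciInf_le (Set.finite_range _).bddBelow i⟩

/-- Some feasible policy is nearly optimal among the feasible ones. -/
lemma CMDP.exists_nearly_optimal (hγ : 0 ≤ γ) (hγ1 : γ < 1) {M : CMDP S A d γ}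
    (h : ∃ π, M.Feasible π) {ε : ℝ} (hε : 0 < ε) :
    ∃ πo, M.Feasible πo ∧ ∀ π, M.Feasible π →
      value M.P γ M.r π M.ρ ≤ value M.P γ M.r πo M.ρ + ε := by
  obtain ⟨π₀, h₀⟩ := h
  set V : Set ℝ := {v | ∃ π, M.Feasible π ∧ v = value M.P γ M.r π M.ρ} with hV
  have hbdd : BddAbove V := ⟨1 / (1 - γ), by
    rintro v ⟨π, -, rfl⟩
    exact value_le_const (IsSubstochastic.of_mem M.P_mem) hγ hγ1 π M.ρ_mem zero_le_one
      fun s a => (M.r_mem s a).2⟩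
  obtain ⟨v, ⟨πo, hπo, rfl⟩, hlt⟩ :=
    exists_lt_of_lt_csSup (s := V) ⟨_, π₀, h₀, rfl⟩ (sub_lt_self (sSup V) hε)
  exact ⟨πo, hπo, fun π hπ => by linarith [le_csSup hbdd ⟨π, hπ, rfl⟩]⟩

end Feasibility

end StrictCMDP

end

open StrictCMDP in
theorem theorem4 :
    ∃ (C : ℝ) (k : ℕ), 0 < C ∧
      ∀ (S A : Type*) [Fintype S] [Fintype A] [Nonempty S] [Nonempty A] [DecidableEq S]
        [MeasurableSpace S] [MeasurableSingletonClass S]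
        (d : ℕ) (γ ε δ ζ ω U : ℝ),
        1 ≤ d → 0 ≤ γ → γ < 1 → 0 < ε → ε ≤ 1 / (1 - γ) → 0 < δ → δ < 1 → 0 < ζ →
        ω = ε * (1 - γ) / 10 → U = 4 * (1 + ω) / (ζ * (1 - γ)) →
        ∃ (N₀ T : ℕ) (ε₁ : ℝ),
          N₀ = ⌈C * sampleRate k (Fintype.card S) (Fintype.card A) d γ ε δ ζ⌉₊ ∧
          (Fintype.card (S × A × Fin N₀) : ℝ) ≤ Fintype.card S * Fintype.card A *
            (C * sampleRate k (Fintype.card S) (Fintype.card A) d γ ε δ ζ + 1) ∧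
          0 < ε₁ ∧ ε₁ ≤ C * (ε ^ 2 * (1 - γ) ^ 4 * ζ ^ 2) ∧
          (T : ℝ) ≤ C * ((d : ℝ) ^ 4 / ((1 - γ) ^ 6 * ε ^ 2 * ζ ^ 2)) ∧
          ∀ (N : ℕ), N₀ ≤ N → ∀ (M : CMDP S A d γ) (b' : Fin d → ℝ),
            M.IsSlaterConstant ζ →
            (∀ i, b' i = M.b i + ε * (1 - γ) * ζ / 20) → (∀ i, 0 ≤ b' i) →
            0 < T ∧
            dataLaw M.P N ω
              {D | ¬ ((∃ lam pol, IsRun M D b' U (U * (1 - γ) / √(T : ℝ)) ε₁ T lam pol) ∧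
                ∀ lam pol, IsRun M D b' U (U * (1 - γ) / √(T : ℝ)) ε₁ T lam pol →
                  M.StrictlySolvedBy ε T pol)}
              ≤ ENNReal.ofReal (4 * δ) := by
  refine ⟨10 ^ 8, 1, by norm_num, ?_⟩
  intro S A _ _ _ _ _ _ _ d γ ε δ ζ ω U hd hγ hγ1 hε hεγ' hδ hδ1 hζ hω hU
  have h1γ : 0 < 1 - γ := by linarith
  have h1γ1 : 1 - γ ≤ 1 := by linarith
  have hεγ : ε * (1 - γ) ≤ 1 := (le_div_iff₀ h1γ).1 hεγ'
  have hω0 : 0 < ω := by rw [hω]; positivity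
  have hd0 : (0 : ℝ) < d := by exact_mod_cast hd
  have hd1 : (1 : ℝ) ≤ d := by exact_mod_cast hd
  have hS1 : (1 : ℝ) ≤ Fintype.card S := by exact_mod_cast Fintype.card_pos
  have hA1 : (1 : ℝ) ≤ Fintype.card A := by exact_mod_cast Fintype.card_pos
  have hγX : 1 ≤ 1 / (1 - γ) := (one_le_div h1γ).2 h1γ1
  have hεX : 0 < 1 / ε := by positivity
  have hζX : 0 < 1 / ζ := by positivity
  set X : ℝ := 3 + Fintype.card S + Fintype.card A + d + 1 / (1 - γ) + 1 / ε + 1 / ζ with hX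
  have hX7 : 7 ≤ X := by linarith
  have hlogX : 0 < Real.log X := Real.log_pos (by linarith)
  have hlogδ : 0 < Real.log (1 / δ) := Real.log_pos ((one_lt_div hδ).2 hδ1)
  have hrate : sampleRate 1 (Fintype.card S) (Fintype.card A) d γ ε δ ζ
      = (d : ℝ) ^ 3 * Real.log (1 / δ) / ((1 - γ) ^ 5 * ε ^ 2 * ζ ^ 2) * Real.log X := by
    rw [sampleRate, pow_one]
  have hrate0 : 0 < sampleRate 1 (Fintype.card S) (Fintype.card A) d γ ε δ ζ := by
    rw [hrate]; positivity
  refine ⟨_, ⌊(10 : ℝ) ^ 8 * ((d : ℝ) ^ 4 / ((1 - γ) ^ 6 * ε ^ 2 * ζ ^ 2))⌋₊,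
    1 / 10 ^ 6 * (ε ^ 2 * (1 - γ) ^ 5 * ζ ^ 2 / (d : ℝ) ^ 3), rfl, ?_, by positivity, ?_,
    Nat.floor_le (by positivity), ?_⟩
  · rw [Fintype.card_prod, Fintype.card_prod, Fintype.card_fin]
    push_cast
    rw [← mul_assoc]
    gcongr
    exact (Nat.ceil_lt_add_one (by positivity)).le
  · calc 1 / 10 ^ 6 * (ε ^ 2 * (1 - γ) ^ 5 * ζ ^ 2 / (d : ℝ) ^ 3)
        ≤ 10 ^ 8 * (ε ^ 2 * (1 - γ) ^ 4 * ζ ^ 2 / 1 ^ 3) := by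
          gcongr ?_ * (ε ^ 2 * ?_ * ζ ^ 2 / ?_ ^ 3)
          · norm_num
          · exact pow_le_pow_of_le_one h1γ.le h1γ1 (by norm_num)
      _ = _ := by ring
  intro N hN M b' hslater hb' hb'0
  obtain ⟨πc, hπcf, hπc⟩ := M.exists_slater hslater
  obtain ⟨πo, hπo, hπo_max⟩ := M.exists_nearly_optimal hγ hγ1 ⟨πc, hπcf⟩ (half_pos hε)
  -- nonnegative shifted thresholds leave no room for a large Slater constant
  have hζγ : ζ * (1 - γ) ≤ 20 / 19 := by
    have h1 := value_le_const (IsSubstochastic.of_mem M.P_mem) hγ hγ1 πc M.ρ_mem zero_le_one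
      fun s a => (M.c_mem ⟨0, hd⟩ s a).2
    have h2 := hπc ⟨0, hd⟩
    have h3 := hb' ⟨0, hd⟩
    have h4 := hb'0 ⟨0, hd⟩
    have h5 : ε * (1 - γ) * ζ ≤ ζ := mul_le_of_le_one_left hζ.le hεγ
    have h6 : 19 / 20 * ζ ≤ 1 / (1 - γ) := by linarith
    rw [le_div_iff₀ h1γ] at h6
    linarith
  obtain ⟨hT, hε₁U, hopt⟩ := regret_budget hd h1γ h1γ1 hε hεγ hζ hζγ hω hU rfl rfl
  refine ⟨hT, ?_⟩
  rcases le_or_gt (1 / 4) δ with hδ4 | hδ4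
  · have := isProbabilityMeasure_dataLaw M.P_mem N hω0
    refine MeasureTheory.prob_le_one.trans ?_
    rw [← ENNReal.ofReal_one]
    exact ENNReal.ofReal_le_ofReal (by linarith)
  have hN' : (10 : ℝ) ^ 8 * ((d : ℝ) ^ 3 * Real.log (1 / δ) / ((1 - γ) ^ 5 * ε ^ 2 * ζ ^ 2)
      * Real.log X) ≤ N := by
    rw [← hrate]
    exact Nat.ceil_le.1 hN
  have hN0 : 0 < N := by
    have : (0 : ℝ) < N := lt_of_lt_of_le (by positivity) hN'
    exact_mod_cast this
  obtain ⟨hβ, herr⟩ := evaluation_budget hd h1γ hε hεγ hζ hζγ hlogδ hlogX hN'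
  refine (dataLaw_failure_le hγ hγ1 hε hεγ hζ hζγ hω hU hT hN0 (by positivity) hε₁U hb' hb'0 hopt
    (show 0 < 38 * d * Real.log (1 / δ) * Real.log X by positivity) hβ herr hπc hπo
    hπo_max).trans (ENNReal.ofReal_le_ofReal ?_)
  exact failure_budget hd h1γ hε hεγ hζ hδ hδ4 hω hU rfl hX7 (by linarith) (by linarith)
    (by linarith) (by linarith) (by linarith) (by linarith)
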